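/- Let $R$ be a commutative ring and $n\in\mathbb N$. Let $\mathcal P_n$ be the poset (pointwise order) of Goresky–MacPherson $n$-perversities, i.e. maps $\overline p:\{0,\dots,n\}\to\mathbb N$ with $\overline p(0)=\overline p(1)=\overline p(2)=0$ and $\overline p(i)\le\overline p(i+1)\le\overline p(i)+1$ for $1\le i\le n-1$. A perverse graded module $M_\bullet$ consists of $R$-modules $M^i_{\overline p}$ ($i\in\mathbb Z$, $\overline p\in\mathcal P_n$) with functorial structure maps $M^i_{\overline p}\to M^i_{\overline q}$ for $\overline p\le\overline q$. Tensor product and internal Hom are $(M\boxtimes N)^d_{\overline r}=\operatorname{colim}_{\overline p+\overline q\le\overline r}\bigoplus_{i+j=d}M^i_{\overline p}\otimes N^j_{\overline q}$ and $\operatorname{Hom}(M,N)^d_{\overline r}=\lim_{\overline r\le\overline q-\overline p}\prod_{j-i=d}\operatorname{Hom}_R(M^i_{\overline p},N^j_{\overline q})$. Let $A_\bullet$ be a perverse differential graded algebra: a perverse graded module with a differential $d$ of degree $+1$, an associative product $A^i_{\overline p}\otimes A^j_{\overline q}\to A^{i+j}_{\overline r}$ for $\overline p+\overline q\le\overline r$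 compatible with the structure maps, a unit $1\in A^0_{\overline 0}$, and $d(ab)=(da)b+(-1)^{|a|}a\,(db)$. Let $\overline A_\bullet=A_\bullet/R\cdot 1$, let $s\overline A$ be its suspension, $(s\overline A)^i=\overline A^{i+1}$, and $T(s\overline A)=\bigoplus_{k\ge0}(s\overline A)^{\boxtimes k}$ with elements $[a_1|\dots|a_k]$. The (normalized) Hochschild cochains are $HC^q_{\overline r}(A)=\operatorname{Hom}(T(s\overline A),A)^q_{\overline r}$. Put $\varepsilon_i=\sum_{j<i}(|a_j|-1)$ and $\overline\varepsilon_i=\sum_{j\le i}(|a_j|-1)$. For cochains $f,g$ define \[ \begin{aligned} (Df)[a_1|\dots|a_k]={}&d\,f[a_1|\dots|a_k]+\sum_{i=1}^k(-1)^{\varepsilon_i+|f|}f[a_1|\dots|da_i|\dots|a_k]\\ &-(-1)^{(|a_1|+1)|f|}a_1f[a_2|\dots|a_k]+(-1)^{\varepsilon_k+|f|}f[a_1|\dots|a_{k-1}]a_k\\ &-\sum_{i=2}^k(-1)^{\varepsilon_i+|f|}f[a_1|\dots|a_{i-1}a_i|\dots|a_k] \end{aligned} \] (for $k=0$ only the first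 term is present), \[ (f\cup g)[a_1|\dots|a_k]=\sum_{i=0}^k(-1)^{|g|\overline\varepsilon_i}f[a_1|\dots|a_i]\,g[a_{i+1}|\dots|a_k], \] \[ (f\circ g)[a_1|\dots|a_k]=\sum_{0\le i\le j\le k}(-1)^{(|g|-1)\overline\varepsilon_i}f[a_1|\dots|a_i|\,g[a_{i+1}|\dots|a_j]\,|a_{j+1}|\dots|a_k], \] \[ [f,g]=f\circ g-(-1)^{(|f|-1)(|g|-1)}g\circ f . \] \textbf{Theorem A.} These formulas give well-defined cochains, and $D^2=0$. Let $HH^*_\bullet(A)$ be the cohomology of $(HC^*_\bullet(A),D)$, a perverse graded module. Then $\cup$ and $[-,-]$ induce $R$-bilinear products \[ \cup:HH^m_{\overline p}(A)\otimes HH^l_{\overline q}(A)\to HH^{m+l}_{\overline r}(A),\qquad[-,-]:HH^m_{\overline p}(A)\otimes HH^l_{\overline q}(A)\to HH^{m+l-1}_{\overline r}(A)\qquad(\overline p+\overline q\le\overline r), \] compatible with the structure maps (i.e. of perverse degree $\overline 0$), which make $HH^*_\bullet(A)$ a perverse Gerstenhaber algebra, that is, for all $f,g,h\in HH^*_\bullet(A)$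 (whenever the sum of the perversities involved is bounded by the target perversity): (a) $\cup$ is associative and graded commutative, $f\cup g=(-1)^{|f||g|}g\cup f$; (b) $[f,g]=-(-1)^{(|f|-1)(|g|-1)}[g,f]$ and $[[f,g],h]=[f,[g,h]]-(-1)^{(|f|-1)(|g|-1)}[g,[f,h]]$; (c) $[f,g\cup h]=[f,g]\cup h+(-1)^{(|f|-1)|g|}g\cup[f,h]$. -/

import Mathlib

open scoped DirectSum TensorProduct

universe u v w

noncomputable section

/-! ### Goresky–MacPherson perversities -/

/-- A Goresky–MacPherson `n`-perversity: a map `p : {0, …, n} → ℕ` with `p 0 = p 1 = p 2 = 0`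
(as far as these indices are at most `n`) and `p i ≤ p (i + 1) ≤ p i + 1` for `1 ≤ i ≤ n - 1`. -/
@[ext]
structure GMPerversity (n : ℕ) where
  toFun : Fin (n + 1) → ℕ
  eq_zero : ∀ i : Fin (n + 1), (i : ℕ) ≤ 2 → toFun i = 0
  step : ∀ i j : Fin (n + 1), 1 ≤ (i : ℕ) → (j : ℕ) = i + 1 →
    toFun i ≤ toFun j ∧ toFun j ≤ toFun i + 1

namespace GMPerversity

variable {n : ℕ}

instance : CoeFun (GMPerversity n) (fun _ => Fin (n + 1) → ℕ) := ⟨GMPerversity.toFun⟩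

/-- The pointwise order. -/
instance : PartialOrder (GMPerversity n) :=
  PartialOrder.lift GMPerversity.toFun (fun _ _ h => GMPerversity.ext h)

/-- The zero perversity. -/
instance : Zero (GMPerversity n) :=
  ⟨⟨fun _ => 0, fun _ _ => rfl, fun _ _ _ _ => ⟨le_rfl, Nat.zero_le _⟩⟩⟩

theorem zero_le (p : GMPerversity n) : 0 ≤ p := fun _ => Nat.zero_le _

theorem le_add_sub (p : GMPerversity n) (i j : Fin (n + 1)) (hij : i ≤ j) :
    p i ≤ p j ∧ p j ≤ p i + ((j : ℕ) - i) := by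
  obtain ⟨i, hi⟩ := i
  obtain ⟨j, hj⟩ := j
  replace hij : i ≤ j := hij
  show p ⟨i, hi⟩ ≤ p ⟨j, hj⟩ ∧ p ⟨j, hj⟩ ≤ p ⟨i, hi⟩ + (j - i)
  induction j, hij using Nat.le_induction with
  | base => simp
  | succ j hij ih =>
    have ih := ih (by omega)
    rcases Nat.eq_zero_or_pos j with h0 | h0
    · have h1 := p.eq_zero ⟨i, hi⟩ (show i ≤ 2 by omega)
      have h2 := p.eq_zero ⟨j + 1, hj⟩ (show j + 1 ≤ 2 by omega)
      omega
    · have := p.step ⟨j, by omega⟩ ⟨j + 1, hj⟩ h0 rfl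
      omega

theorem monotone (p : GMPerversity n) : Monotone p := fun i j h => (p.le_add_sub i j h).1

theorem le_sub_two (p : GMPerversity n) (i : Fin (n + 1)) : p i ≤ (i : ℕ) - 2 := by
  by_cases h : (i : ℕ) ≤ 2
  · rw [p.eq_zero i h]; omega
  · have h2 : 2 < n + 1 := by omega
    have h3 := p.le_add_sub ⟨2, h2⟩ i (by rw [Fin.le_def]; simp; omega)
    have h4 := p.eq_zero ⟨2, h2⟩ le_rfl
    simp only at *
    omega

/-- For `x` below the top perversity `t i = i - 2`, `ceil x` is the smallest Goresky–MacPherson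
perversity that is `≥ x` (see `le_ceil` and `ceil_le`); `p ⊕ q` is `ceil (p + q)`. The minimum
with `i - 2` only matters when there is no such perversity. -/
def ceil (x : Fin (n + 1) → ℕ) : GMPerversity n where
  toFun i := min ((i : ℕ) - 2) (Finset.univ.sup fun j => x j - ((j : ℕ) - i))
  eq_zero i hi := by
    have : (i : ℕ) - 2 = 0 := by omega
    simp [this]
  step i j hi hj := by
    constructor
    · refine min_le_min (by omega) (Finset.sup_mono_fun fun k _ => by omega)
    · rw [← Nat.sub_le_iff_le_add]
      refine le_min (by omega) ?_
      rw [Nat.sub_le_iff_le_add]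
      refine (min_le_right _ _).trans (Finset.sup_le fun k _ => ?_)
      have : x k - ((k : ℕ) - i) ≤ Finset.univ.sup fun k => x k - ((k : ℕ) - i) :=
        Finset.le_sup (f := fun k => x k - ((k : ℕ) - i)) (Finset.mem_univ k)
      omega

theorem le_ceil {x : Fin (n + 1) → ℕ} {v : GMPerversity n} (h : x ≤ v) : x ≤ ceil x := by
  intro i
  refine le_min ((h i).trans (v.le_sub_two i)) ?_
  have := Finset.le_sup (f := fun k : Fin (n + 1) => x k - ((k : ℕ) - i)) (Finset.mem_univ i)
  simpa using this

theorem ceil_le {x : Fin (n + 1) → ℕ} {v : GMPerversity n} (h : x ≤ v) : ceil x ≤ v := by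
  intro i
  refine (min_le_right _ _).trans (Finset.sup_le fun j _ => ?_)
  have hj : x j ≤ v j := h j
  show x j - ((j : ℕ) - i) ≤ v i
  rcases le_total i j with hij | hij
  · have := (v.le_add_sub i j hij).2
    omega
  · have := (v.le_add_sub j i hij).1
    omega

theorem ceil_add_le {x y : Fin (n + 1) → ℕ} {v : GMPerversity n} (hx : Monotone x)
    (hy : Monotone y) (h : x + y ≤ v) : ceil x + y ≤ v := by
  intro i
  have key : (ceil x) i ≤ v i - y i := by
    refine (min_le_right _ _).trans (Finset.sup_le fun j _ => ?_)
    have hj := h j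
    have hi := h i
    simp only [Pi.add_apply] at hj hi
    rcases le_total i j with hij | hij
    · have h1 := (v.le_add_sub i j hij).2
      have h2 := hy hij
      omega
    · have h1 := hx hij
      omega
  have hi := h i
  simp only [Pi.add_apply] at hi ⊢
  omega

theorem le_of_add_le_left {x y : Fin (n + 1) → ℕ} {v : GMPerversity n} (h : x + y ≤ v) :
    x ≤ v := fun i => (Nat.le_add_right _ _).trans (h i)

theorem add_le_comm {x y : Fin (n + 1) → ℕ} {v : GMPerversity n} (h : x + y ≤ v) : y + x ≤ v :=
  (add_comm y x).trans_le h

theorem monotone_add {x y : Fin (n + 1) → ℕ} (hx : Monotone x) (hy : Monotone y) :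
    Monotone (x + y) := hx.add hy

theorem add_ceil_le {x y : Fin (n + 1) → ℕ} {v : GMPerversity n} (hx : Monotone x)
    (hy : Monotone y) (h : x + y ≤ v) : y + ceil x ≤ v :=
  add_le_comm (ceil_add_le hx hy h)

theorem zero_add_le (p : GMPerversity n) : (0 : GMPerversity n).toFun + p ≤ p :=
  fun i => by
    have : (0 : GMPerversity n) i = 0 := rfl
    simp [this]

theorem add_zero_le (p : GMPerversity n) : p.toFun + (0 : GMPerversity n) ≤ p :=
  fun i => by
    have : (0 : GMPerversity n) i = 0 := rfl
    simp [this]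

end GMPerversity

/-! ### Perverse graded modules -/

/-- A perverse graded `R`-module (with upper grading): `R`-modules `M_p^i` for `p` a perversity and
`i : ℤ`, with functorial structure maps `M_p^i → M_q^i` for `p ≤ q`. -/
structure PerverseGradedModule (R : Type u) [CommRing R] (n : ℕ) where
  obj : GMPerversity n → ℤ → Type v
  [addCommGroup : ∀ p i, AddCommGroup (obj p i)]
  [module : ∀ p i, Module R (obj p i)]
  map : ∀ {p q : GMPerversity n} (_ : p ≤ q) {i : ℤ}, obj p i →ₗ[R] obj q i
  map_id : ∀ {p : GMPerversity n} {i : ℤ} (x : obj p i), map (le_refl p) x = x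
  map_map : ∀ {p q r : GMPerversity n} (h : p ≤ q) (h' : q ≤ r) {i : ℤ} (x : obj p i),
    map h' (map h x) = map (h.trans h') x

attribute [instance] PerverseGradedModule.addCommGroup PerverseGradedModule.module

namespace PerverseGradedModule

variable {R : Type u} [CommRing R] {n : ℕ}

/-! #### Tensor powers `M ⊠ ⋯ ⊠ M` and the tensor algebra -/

/-- Indices `((p_1, …, p_k), (i_1, …, i_k))` with `p_1 + ⋯ + p_k ≤ u`, `i_1 + ⋯ + i_k = d`. -/
@[ext]
structure TensorIndex (n k : ℕ) (u : GMPerversity n) (d : ℤ) where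
  per : Fin k → GMPerversity n
  deg : Fin k → ℤ
  per_le : ∑ t, (per t).toFun ≤ u.toFun
  deg_eq : ∑ t, deg t = d

/-- The index for a larger perversity `u'`. -/
def TensorIndex.mono {k : ℕ} {u u' : GMPerversity n} {d : ℤ} (h : u ≤ u')
    (x : TensorIndex n k u d) : TensorIndex n k u' d :=
  ⟨x.per, x.deg, x.per_le.trans h, x.deg_eq⟩

variable (M : PerverseGradedModule.{u, v} R n)

/-- `⨁ M_{p_1}^{i_1} ⊗ ⋯ ⊗ M_{p_k}^{i_k}`, the sum over all indices. -/
abbrev PreTensorPower (k : ℕ) (u : GMPerversity n) (d : ℤ) : Type (max u v) :=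
  ⨁ x : TensorIndex n k u d, ⨂[R] t, M.obj (x.per t) (x.deg t)

open Classical in
/-- The pure tensor `a_1 ⊗ ⋯ ⊗ a_k` in the summand of index `x`. -/
def preTensor {k : ℕ} {u : GMPerversity n} {d : ℤ} (x : TensorIndex n k u d)
    (a : ∀ t, M.obj (x.per t) (x.deg t)) : M.PreTensorPower k u d :=
  DirectSum.lof R (TensorIndex n k u d) (fun x => ⨂[R] t, M.obj (x.per t) (x.deg t)) x
    (PiTensorProduct.tprod R a)

/-- The relations defining the colimit over `p_1 + ⋯ + p_k ≤ u`: a pure tensor is identified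
with its images under the structure maps of `M`. -/
def tensorRel (k : ℕ) (u : GMPerversity n) (d : ℤ) : Submodule R (M.PreTensorPower k u d) :=
  Submodule.span R {z | ∃ (x : TensorIndex n k u d) (p' : Fin k → GMPerversity n)
    (hp' : ∑ t, (p' t).toFun ≤ u.toFun) (hp : ∀ t, x.per t ≤ p' t)
    (a : ∀ t, M.obj (x.per t) (x.deg t)),
    z = M.preTensor x a - M.preTensor ⟨p', x.deg, hp', x.deg_eq⟩ (fun t => M.map (hp t) (a t))}

/-- The component of perversity `u` and degree `d` of `M ⊠ ⋯ ⊠ M` (`k` factors):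
`colim_{p_1 + ⋯ + p_k ≤ u} ⨁_{i_1 + ⋯ + i_k = d} M_{p_1}^{i_1} ⊗ ⋯ ⊗ M_{p_k}^{i_k}`.
For `k = 0` this is `R` in degree `0`, for all `u`. -/
def TensorPower (k : ℕ) (u : GMPerversity n) (d : ℤ) : Type (max u v) :=
  M.PreTensorPower k u d ⧸ M.tensorRel k u d

instance (k : ℕ) (u : GMPerversity n) (d : ℤ) : AddCommGroup (M.TensorPower k u d) :=
  inferInstanceAs (AddCommGroup (M.PreTensorPower k u d ⧸ M.tensorRel k u d))

instance (k : ℕ) (u : GMPerversity n) (d : ℤ) : Module R (M.TensorPower k u d) :=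
  inferInstanceAs (Module R (M.PreTensorPower k u d ⧸ M.tensorRel k u d))

open Classical in
/-- The map of direct sums induced by the inclusion of indices for `u ≤ u'`. -/
def preTensorMap {k : ℕ} {u u' : GMPerversity n} (h : u ≤ u') (d : ℤ) :
    M.PreTensorPower k u d →ₗ[R] M.PreTensorPower k u' d :=
  DirectSum.toModule R (TensorIndex n k u d) _ fun x =>
    DirectSum.lof R (TensorIndex n k u' d) (fun x => ⨂[R] t, M.obj (x.per t) (x.deg t)) (x.mono h)

theorem preTensorMap_preTensor {k : ℕ} {u u' : GMPerversity n} (h : u ≤ u') {d : ℤ}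
    (x : TensorIndex n k u d) (a : ∀ t, M.obj (x.per t) (x.deg t)) :
    M.preTensorMap h d (M.preTensor x a) = M.preTensor (x.mono h) a := by
  classical
  unfold preTensorMap preTensor
  exact DirectSum.toModule_lof R x _

theorem tensorRel_le {k : ℕ} {u u' : GMPerversity n} (h : u ≤ u') (d : ℤ) :
    M.tensorRel k u d ≤ (M.tensorRel k u' d).comap (M.preTensorMap h d) := by
  refine Submodule.span_le.2 ?_
  rintro _ ⟨x, p', hp', hp, a, rfl⟩
  refine Submodule.subset_span ⟨x.mono h, p', hp'.trans h, hp, a, ?_⟩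
  rw [map_sub, preTensorMap_preTensor, preTensorMap_preTensor]
  rfl

theorem preTensor_induction {k : ℕ} {u : GMPerversity n} {d : ℤ} {N : Type w} [AddCommGroup N]
    [Module R N] {f g : M.PreTensorPower k u d →ₗ[R] N}
    (h : ∀ x a, f (M.preTensor x a) = g (M.preTensor x a)) : f = g := by
  classical
  refine DirectSum.linearMap_ext R fun x => PiTensorProduct.ext (MultilinearMap.ext fun a => ?_)
  exact h x a

/-- The structure maps of the tensor power. -/
def tensorPowerMap {k : ℕ} {u u' : GMPerversity n} (h : u ≤ u') (d : ℤ) :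
    M.TensorPower k u d →ₗ[R] M.TensorPower k u' d :=
  Submodule.mapQ _ _ (M.preTensorMap h d) (M.tensorRel_le h d)

theorem tensorPowerMap_id {k : ℕ} (u : GMPerversity n) (d : ℤ) :
    M.tensorPowerMap (k := k) (le_refl u) d = LinearMap.id := by
  refine Submodule.linearMap_qext _ (M.preTensor_induction fun x a => ?_)
  exact congrArg (Submodule.Quotient.mk (p := M.tensorRel k u d))
    (M.preTensorMap_preTensor (le_refl u) x a)

theorem tensorPowerMap_comp {k : ℕ} {u u' u'' : GMPerversity n} (h : u ≤ u') (h' : u' ≤ u'')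
    (d : ℤ) : M.tensorPowerMap (k := k) h' d ∘ₗ M.tensorPowerMap h d
      = M.tensorPowerMap (h.trans h') d := by
  refine Submodule.linearMap_qext _ (M.preTensor_induction fun x a => ?_)
  refine congrArg (Submodule.Quotient.mk (p := M.tensorRel k u'' d)) ?_
  rw [M.preTensorMap_preTensor (h.trans h') x a, M.preTensorMap_preTensor h x a,
    M.preTensorMap_preTensor h' (x.mono h) a]
  rfl

/-- The tensor algebra `T(M) = ⨁_k M ⊠ ⋯ ⊠ M`, as a perverse graded module. -/
def tensorAlgebra : PerverseGradedModule.{u, max u v} R n where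
  obj u d := ⨁ k : ℕ, M.TensorPower k u d
  addCommGroup u d := inferInstance
  module u d := inferInstance
  map {_ _} h {d} := DirectSum.lmap fun _ => M.tensorPowerMap h d
  map_id {u d} x := by
    simp only [tensorPowerMap_id]
    exact LinearMap.congr_fun
      (DirectSum.lmap_id (R := R) (M := fun k => M.TensorPower k u d)) x
  map_map {_ _ _} h h' {d} x := by
    have := DirectSum.lmap_comp (R := R) (fun k => M.tensorPowerMap (k := k) h d)
      (fun k => M.tensorPowerMap (k := k) h' d)
    simp only [tensorPowerMap_comp] at this
    exact (LinearMap.congr_fun this x).symm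

/-! #### The internal Hom -/

/-- Indices `(u, v, i, j)` with `r ≤ v - u` and `j - i = q`. -/
structure HomIndex (n : ℕ) (r : GMPerversity n) (q : ℤ) where
  src : GMPerversity n
  tgt : GMPerversity n
  srcDeg : ℤ
  tgtDeg : ℤ
  le : r.toFun + src.toFun ≤ tgt.toFun
  deg_eq : srcDeg + q = tgtDeg

/-- The compatible families in `∏_{r ≤ v - u} ∏_{j - i = q} Hom_R (M_u^i, N_v^j)`. -/
def compatibleFamilies (M : PerverseGradedModule.{u, v} R n) (N : PerverseGradedModule.{u, w} R n)
    (r : GMPerversity n) (q : ℤ) :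
    Submodule R (∀ x : HomIndex n r q, M.obj x.src x.srcDeg →ₗ[R] N.obj x.tgt x.tgtDeg) where
  carrier := {f | ∀ (u u' v v' : GMPerversity n) (i j : ℤ) (h : r.toFun + u.toFun ≤ v.toFun)
    (h' : r.toFun + u'.toFun ≤ v'.toFun) (hj : i + q = j) (hu : u' ≤ u) (hv : v ≤ v')
    (x : M.obj u' i),
    N.map hv (f ⟨u, v, i, j, h, hj⟩ (M.map hu x)) = f ⟨u', v', i, j, h', hj⟩ x}
  add_mem' hf hg u u' v v' i j h h' hj hu hv x := by
    simp [hf u u' v v' i j h h' hj hu hv x, hg u u' v v' i j h h' hj hu hv x]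
  zero_mem' u u' v v' i j h h' hj hu hv x := by simp
  smul_mem' c f hf u u' v v' i j h h' hj hu hv x := by
    simp [hf u u' v v' i j h h' hj hu hv x]

/-- The component of perversity `r` and degree `q` of the internal Hom of perverse graded modules,
`lim_{r ≤ v - u} ∏_{j - i = q} Hom_R (M_u^i, N_v^j)`. -/
def IHom (M : PerverseGradedModule.{u, v} R n) (N : PerverseGradedModule.{u, w} R n)
    (r : GMPerversity n) (q : ℤ) : Type (max v w) :=
  compatibleFamilies M N r q

instance (M : PerverseGradedModule.{u, v} R n) (N : PerverseGradedModule.{u, w} R n)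
    (r : GMPerversity n) (q : ℤ) : AddCommGroup (IHom M N r q) :=
  inferInstanceAs (AddCommGroup (compatibleFamilies M N r q))

instance (M : PerverseGradedModule.{u, v} R n) (N : PerverseGradedModule.{u, w} R n)
    (r : GMPerversity n) (q : ℤ) : Module R (IHom M N r q) :=
  inferInstanceAs (Module R (compatibleFamilies M N r q))

/-- The structure map of the internal Hom for `r ≤ r'`: the restriction to fewer indices. -/
def IHom.map {M : PerverseGradedModule.{u, v} R n} {N : PerverseGradedModule.{u, w} R n}
    {r r' : GMPerversity n} (hr : r ≤ r') {q : ℤ} : IHom M N r q →ₗ[R] IHom M N r' q where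
  toFun f := ⟨fun x => f.1 ⟨x.src, x.tgt, x.srcDeg, x.tgtDeg,
      (add_le_add_left (show r.toFun ≤ r'.toFun from hr) _).trans x.le, x.deg_eq⟩,
    fun u u' v v' i j _ _ hj hu hv x => f.2 u u' v v' i j _ _ hj hu hv x⟩
  map_add' _ _ := rfl
  map_smul' _ _ := rfl

end PerverseGradedModule

/-! ### Perverse differential graded algebras -/

/-- A perverse differential (upper) graded `R`-algebra: a perverse cochain complex with a unit
`1 ∈ A_0^0` and an associative product `A_p ⊗ A_q → A_r` for `p + q ≤ r`, compatible with the
structure maps (equivalently `A_p ⊗ A_q → A_{p ⊕ q}`, or `A ⊠ A → A`), for which the differential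
is a derivation. Degrees of targets are given up to an equation, which avoids transports. -/
structure PerverseDGA (R : Type u) [CommRing R] (n : ℕ) extends PerverseGradedModule.{u, v} R n where
  d : ∀ {p : GMPerversity n} {i j : ℤ} (_ : i + 1 = j), obj p i →ₗ[R] obj p j
  d_map : ∀ {p q : GMPerversity n} (h : p ≤ q) {i j : ℤ} (hj : i + 1 = j) (x : obj p i),
    d hj (map h x) = map h (d hj x)
  d_d : ∀ {p : GMPerversity n} {i j k : ℤ} (hj : i + 1 = j) (hk : j + 1 = k) (x : obj p i),
    d hk (d hj x) = 0
  mul : ∀ {p q r : GMPerversity n} (_ : p.toFun + q.toFun ≤ r.toFun) {i j k : ℤ} (_ : i + j = k),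
    obj p i →ₗ[R] obj q j →ₗ[R] obj r k
  map_mul : ∀ {p q r p' q' r' : GMPerversity n} (h : p.toFun + q.toFun ≤ r.toFun)
    (h' : p'.toFun + q'.toFun ≤ r'.toFun) (hp : p ≤ p') (hq : q ≤ q') (hr : r ≤ r') {i j k : ℤ}
    (hk : i + j = k) (a : obj p i) (b : obj q j),
    map hr (mul h hk a b) = mul h' hk (map hp a) (map hq b)
  one : obj 0 0
  one_mul : ∀ {p : GMPerversity n} {i : ℤ} (a : obj p i),
    mul p.zero_add_le (zero_add i) one a = a
  mul_one : ∀ {p : GMPerversity n} {i : ℤ} (a : obj p i),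
    mul p.add_zero_le (add_zero i) a one = a
  mul_assoc : ∀ {p q s pq qs r : GMPerversity n} (h₁ : p.toFun + q.toFun ≤ pq.toFun)
    (h₂ : pq.toFun + s.toFun ≤ r.toFun) (h₃ : q.toFun + s.toFun ≤ qs.toFun)
    (h₄ : p.toFun + qs.toFun ≤ r.toFun) {i j k ij jk l : ℤ} (e₁ : i + j = ij) (e₂ : ij + k = l)
    (e₃ : j + k = jk) (e₄ : i + jk = l) (a : obj p i) (b : obj q j) (c : obj s k),
    mul h₂ e₂ (mul h₁ e₁ a b) c = mul h₄ e₄ a (mul h₃ e₃ b c)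
  d_mul : ∀ {p q r : GMPerversity n} (h : p.toFun + q.toFun ≤ r.toFun) {i j k i' j' k' : ℤ}
    (hk : i + j = k) (hi' : i + 1 = i') (hj' : j + 1 = j') (hk' : k + 1 = k') (e₁ : i' + j = k')
    (e₂ : i + j' = k') (a : obj p i) (b : obj q j),
    d hk' (mul h hk a b) = mul h e₁ (d hi' a) b + i.negOnePow • mul h e₂ a (d hj' b)

namespace PerverseDGA

open PerverseGradedModule

variable {R : Type u} [CommRing R] {n : ℕ} (A : PerverseDGA.{u, v} R n)

/-! #### The bar construction -/

/-- The image of the unit map `η : R → A_p^i` for `i = 0`, zero for `i ≠ 0`. -/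
def unitSubmodule (p : GMPerversity n) (i : ℤ) : Submodule R (A.obj p i) :=
  Submodule.span R {x | ∃ h : 0 = i, x = h ▸ A.map p.zero_le A.one}

theorem unitSubmodule_le {p q : GMPerversity n} (h : p ≤ q) (i : ℤ) :
    A.unitSubmodule p i ≤ (A.unitSubmodule q i).comap (A.map h) := by
  refine Submodule.span_le.2 ?_
  rintro _ ⟨rfl, rfl⟩
  exact Submodule.subset_span ⟨rfl, A.map_map _ _ _⟩

/-- The suspension `s Ā` of the quotient `Ā = A / η(R)`: `(s Ā)_p^i = A_p^{i+1} / η(R)`. -/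
def suspBar : PerverseGradedModule.{u, v} R n where
  obj p i := A.obj p (i + 1) ⧸ A.unitSubmodule p (i + 1)
  map {_ _} h {i} := Submodule.mapQ _ _ (A.map h) (A.unitSubmodule_le h (i + 1))
  map_id x := by
    obtain ⟨x, rfl⟩ := Submodule.Quotient.mk_surjective _ x
    exact congrArg Submodule.Quotient.mk (A.map_id x)
  map_map {_ _ _} h h' {_} x := by
    obtain ⟨x, rfl⟩ := Submodule.Quotient.mk_surjective _ x
    exact congrArg Submodule.Quotient.mk (A.map_map h h' x)

/-- The bar construction `T(s Ā)`. -/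
abbrev barConstruction : PerverseGradedModule.{u, max u v} R n := A.suspBar.tensorAlgebra

/-- A homogeneous element `a` of `A`, of perversity `per` and degree `|a| = deg + 1`; so `deg` is
the degree `|s(a)| = |a| - 1` of its suspension. -/
structure Letter where
  per : GMPerversity n
  deg : ℤ
  val : A.obj per (deg + 1)

/-- Words `a_1, …, a_k` of homogeneous elements of `A`. -/
abbrev Word := List A.Letter

variable {A}

/-- The sum of the perversities of the letters. -/
def Word.per (w : A.Word) : Fin (n + 1) → ℕ := (w.map fun a => a.per.toFun).sum

/-- The sum of the degrees `|s(a_1)| + ⋯ + |s(a_k)|`. -/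
def Word.deg (w : A.Word) : ℤ := (w.map fun a => a.deg).sum

/-- The element `[a_1|…|a_k]` of `T(s Ā)_u^d`. -/
def Word.bar (w : A.Word) {u : GMPerversity n} {d : ℤ} (hu : w.per ≤ u.toFun) (hd : w.deg = d) :
    A.barConstruction.obj u d :=
  DirectSum.lof R ℕ (fun k => A.suspBar.TensorPower k u d) w.length
    (Submodule.Quotient.mk (A.suspBar.preTensor
      ⟨fun t => (w.get t).per, fun t => (w.get t).deg,
        (Fin.sum_univ_fun_getElem w fun a => a.per.toFun).trans_le hu,
        (Fin.sum_univ_fun_getElem w fun a => a.deg).trans hd⟩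
      fun t => Submodule.Quotient.mk (w.get t).val))

theorem Word.per_nil : Word.per ([] : A.Word) = 0 := rfl

theorem Word.per_cons (a : A.Letter) (w : A.Word) :
    Word.per (a :: w) = a.per.toFun + Word.per w := by
  simp [Word.per]

theorem Word.per_append (w w' : A.Word) : Word.per (w ++ w') = Word.per w + Word.per w' := by
  simp [Word.per]

theorem Word.deg_nil : Word.deg ([] : A.Word) = 0 := rfl

theorem Word.deg_cons (a : A.Letter) (w : A.Word) : Word.deg (a :: w) = a.deg + Word.deg w := by
  simp [Word.deg]

theorem Word.deg_append (w w' : A.Word) : Word.deg (w ++ w') = Word.deg w + Word.deg w' := by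
  simp [Word.deg]

theorem Word.per_monotone (w : A.Word) : Monotone (Word.per w) := by
  induction w with
  | nil => exact monotone_const
  | cons a w ih => rw [Word.per_cons]; exact a.per.monotone.add ih

theorem Word.split_one (w : A.Word) (i : ℕ) (h : i < w.length) :
    w.take i ++ w[i] :: w.drop (i + 1) = w := by
  rw [← List.drop_eq_getElem_cons h, List.take_append_drop]

theorem Word.split_two (w : A.Word) (i : ℕ) (h : i + 1 < w.length) :
    w.take i ++ w[i] :: w[i + 1] :: w.drop (i + 2) = w := by
  rw [← List.drop_eq_getElem_cons h, Word.split_one]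

theorem Word.split_three (w : A.Word) (i l : ℕ) :
    w.take i ++ ((w.drop i).take l ++ (w.drop i).drop l) = w := by
  rw [List.take_append_drop, List.take_append_drop]

/-! #### Cochains and their values on words -/

variable (A)

/-- The Hochschild cochains of `A` of perversity `r` and degree `q`: the component
`Hom(T(s Ā), A)_r^q` of the internal Hom. -/
abbrev HC (r : GMPerversity n) (q : ℤ) :=
  IHom A.barConstruction A.toPerverseGradedModule r q

/-- A word `w = (a_1, …, a_k)` with a target in which a cochain of perversity `r` and degree `q`
takes its value on `[a_1|…|a_k]`. -/
structure WordIndex (r : GMPerversity n) (q : ℤ) where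
  word : A.Word
  tgt : GMPerversity n
  tgtDeg : ℤ
  le : r.toFun + word.per ≤ tgt.toFun
  deg_eq : word.deg + q = tgtDeg

/-- Arbitrary functions on words. -/
abbrev WordFun (r : GMPerversity n) (q : ℤ) := ∀ x : A.WordIndex r q, A.obj x.tgt x.tgtDeg

variable {A}

/-- The values `f [a_1|…|a_k]` of a cochain `f`; these determine `f`. -/
def HC.eval {r : GMPerversity n} {q : ℤ} : A.HC r q →ₗ[R] A.WordFun r q where
  toFun f x := f.1 ⟨.ceil x.word.per, x.tgt, x.word.deg, x.tgtDeg,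
      GMPerversity.add_ceil_le x.word.per_monotone r.monotone (GMPerversity.add_le_comm x.le),
      x.deg_eq⟩
    (x.word.bar (GMPerversity.le_ceil
      (GMPerversity.le_of_add_le_left (GMPerversity.add_le_comm x.le))) rfl)
  map_add' _ _ := rfl
  map_smul' _ _ := rfl

/-- The letter `d a`. -/
def Letter.d (a : A.Letter) : A.Letter := ⟨a.per, a.deg + 1, A.d rfl a.val⟩

/-- The letter `a b`. -/
def Letter.mul (a b : A.Letter) {v : GMPerversity n} (h : a.per.toFun + b.per.toFun ≤ v.toFun) :
    A.Letter :=
  ⟨.ceil (a.per.toFun + b.per.toFun), a.deg + b.deg + 1,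
    A.mul (GMPerversity.le_ceil h) (by ring) a.val b.val⟩

theorem Letter.mul_add_le (a b : A.Letter) {v : GMPerversity n} {y : Fin (n + 1) → ℕ}
    (hy : Monotone y) (h : a.per.toFun + b.per.toFun + y ≤ v.toFun) :
    (Letter.mul a b (GMPerversity.le_of_add_le_left h)).per.toFun + y ≤ v.toFun :=
  GMPerversity.ceil_add_le (GMPerversity.monotone_add a.per.monotone b.per.monotone) hy h

/-- The letter `g [a_1|…|a_k]`. -/
def letterOf {r : GMPerversity n} {q : ℤ} (g : A.WordFun r q) (w : A.Word) {v : GMPerversity n}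
    (h : r.toFun + w.per ≤ v.toFun) : A.Letter :=
  ⟨.ceil (r.toFun + w.per), w.deg + q - 1,
    g ⟨w, .ceil (r.toFun + w.per), w.deg + q - 1 + 1, GMPerversity.le_ceil h, by ring⟩⟩

/-! #### The Hochschild differential -/

variable {r : GMPerversity n} {q q' : ℤ}

/-- The word `(a_1, …, d a_i, …, a_k)` (positions in the code start at `0`). -/
def Word.dAt (w : A.Word) (i : ℕ) (hi : i < w.length) : A.Word :=
  w.take i ++ w[i].d :: w.drop (i + 1)

theorem dAt_le (x : A.WordIndex r q') (i : ℕ) (hi : i < x.word.length) :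
    r.toFun + Word.per (x.word.dAt i hi) ≤ x.tgt.toFun := by
  have h := x.le
  rw [← Word.split_one x.word i hi] at h
  simpa only [Word.dAt, Word.per_append, Word.per_cons, Letter.d] using h

theorem dAt_deg (hq : q + 1 = q') (x : A.WordIndex r q') (i : ℕ) (hi : i < x.word.length) :
    Word.deg (x.word.dAt i hi) + q = x.tgtDeg := by
  have h := x.deg_eq
  rw [← Word.split_one x.word i hi] at h
  simp only [Word.dAt, Word.deg_append, Word.deg_cons, Letter.d] at h ⊢
  omega

theorem mulLetter_aux (x : A.WordIndex r q') (i : ℕ) (hi : i + 1 < x.word.length) :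
    x.word[i].per.toFun + x.word[i + 1].per.toFun +
      (r.toFun + (Word.per (x.word.take i) + Word.per (x.word.drop (i + 2)))) ≤ x.tgt.toFun := by
  have h := x.le
  rw [← Word.split_two x.word i hi] at h
  simp only [Word.per_append, Word.per_cons] at h
  refine le_of_eq_of_le ?_ h
  abel

/-- The word `(a_1, …, a_i a_{i+1}, …, a_k)` (positions in the code start at `0`). -/
def mulWord (x : A.WordIndex r q') (i : ℕ) (hi : i + 1 < x.word.length) : A.Word :=
  x.word.take i ++
    x.word[i].mul x.word[i + 1] (GMPerversity.le_of_add_le_left (mulLetter_aux x i hi)) ::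
      x.word.drop (i + 2)

theorem mulWord_le (x : A.WordIndex r q') (i : ℕ) (hi : i + 1 < x.word.length) :
    r.toFun + Word.per (mulWord x i hi) ≤ x.tgt.toFun := by
  have := Letter.mul_add_le x.word[i] x.word[i + 1]
    (GMPerversity.monotone_add r.monotone
      (GMPerversity.monotone_add (Word.per_monotone _) (Word.per_monotone _))) (mulLetter_aux x i hi)
  simp only [mulWord, Word.per_append, Word.per_cons]
  refine le_of_eq_of_le ?_ this
  abel

theorem mulWord_deg (hq : q + 1 = q') (x : A.WordIndex r q') (i : ℕ)
    (hi : i + 1 < x.word.length) : Word.deg (mulWord x i hi) + q = x.tgtDeg := by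
  have h := x.deg_eq
  rw [← Word.split_two x.word i hi] at h
  simp only [mulWord, Word.deg_append, Word.deg_cons, Letter.mul] at h ⊢
  omega

theorem head_le (x : A.WordIndex r q') (hw : x.word ≠ []) :
    r.toFun + Word.per x.word.tail + (x.word.head hw).per.toFun ≤ x.tgt.toFun := by
  have h := x.le
  rw [← List.cons_head_tail hw, Word.per_cons] at h
  refine le_of_eq_of_le ?_ h
  abel

theorem getLast_le (x : A.WordIndex r q') (hw : x.word ≠ []) :
    r.toFun + Word.per x.word.dropLast + (x.word.getLast hw).per.toFun ≤ x.tgt.toFun := by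
  have h := x.le
  rw [← List.dropLast_append_getLast hw, Word.per_append, Word.per_cons, Word.per_nil] at h
  refine le_of_eq_of_le ?_ h
  abel

/-- `a_1 f [a_2|…|a_k]`. -/
def headTerm (hq : q + 1 = q') (f : A.WordFun r q) (x : A.WordIndex r q') (hw : x.word ≠ []) :
    A.obj x.tgt x.tgtDeg :=
  A.mul (p := (x.word.head hw).per) (q := .ceil (r.toFun + Word.per x.word.tail))
    (GMPerversity.add_ceil_le (GMPerversity.monotone_add r.monotone (Word.per_monotone _))
      (GMPerversity.monotone _) (head_le x hw))
    (by
      have h := x.deg_eq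
      rw [← List.cons_head_tail hw, Word.deg_cons] at h
      dsimp only
      omega)
    (x.word.head hw).val
    (f ⟨x.word.tail, .ceil (r.toFun + Word.per x.word.tail), Word.deg x.word.tail + q,
      GMPerversity.le_ceil (GMPerversity.le_of_add_le_left (head_le x hw)), rfl⟩)

/-- `f [a_1|…|a_{k-1}] a_k`. -/
def lastTerm (hq : q + 1 = q') (f : A.WordFun r q) (x : A.WordIndex r q') (hw : x.word ≠ []) :
    A.obj x.tgt x.tgtDeg :=
  A.mul (p := .ceil (r.toFun + Word.per x.word.dropLast)) (q := (x.word.getLast hw).per)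
    (GMPerversity.ceil_add_le (GMPerversity.monotone_add r.monotone (Word.per_monotone _))
        (GMPerversity.monotone _) (getLast_le x hw))
    (by
      have h := x.deg_eq
      rw [← List.dropLast_append_getLast hw, Word.deg_append, Word.deg_cons, Word.deg_nil] at h
      dsimp only
      omega)
    (f ⟨x.word.dropLast, .ceil (r.toFun + Word.per x.word.dropLast),
      Word.deg x.word.dropLast + q,
      GMPerversity.le_ceil (GMPerversity.le_of_add_le_left (getLast_le x hw)), rfl⟩)
    (x.word.getLast hw).val

/-- The internal part of the differential,
`d f [a_1|…|a_k] + ∑_{i=1}^k (-1)^{ε_i + |f|} f [a_1|…|d a_i|…|a_k]`,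
with `ε_i = |s(a_1)| + ⋯ + |s(a_{i-1})|`. -/
def diffInt (hq : q + 1 = q') (f : A.WordFun r q) : A.WordFun r q' := fun x =>
  A.d (by have := x.deg_eq; dsimp only; omega) (f ⟨x.word, x.tgt, x.word.deg + q, x.le, rfl⟩) +
    ∑ i : Fin x.word.length, (Word.deg (x.word.take i) + q).negOnePow •
      f ⟨x.word.dAt i i.2, x.tgt, x.tgtDeg, dAt_le x i i.2, dAt_deg hq x i i.2⟩

/-- The external part of the differential: for `k ≥ 1`,
`-(-1)^{(|a_1| + 1)|f|} a_1 f [a_2|…|a_k] + (-1)^{ε_k + |f|} f [a_1|…|a_{k-1}] a_k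
  - ∑_{i=2}^k (-1)^{ε_i + |f|} f [a_1|…|a_{i-1} a_i|…|a_k]`,
with `ε_i = |s(a_1)| + ⋯ + |s(a_{i-1})|`; for `k = 0` it vanishes. -/
def diffExt (hq : q + 1 = q') (f : A.WordFun r q) : A.WordFun r q' := fun x =>
  (if hw : x.word ≠ [] then
    -((((x.word.head hw).deg + 1 + 1) * q).negOnePow • headTerm hq f x hw) +
      (Word.deg x.word.dropLast + q).negOnePow • lastTerm hq f x hw
  else 0) -
    ∑ i : Fin (x.word.length - 1), (Word.deg (x.word.take (i + 1)) + q).negOnePow •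
      f ⟨mulWord x i (by omega), x.tgt, x.tgtDeg, mulWord_le x i _, mulWord_deg hq x i _⟩

/-- The formula for the Hochschild differential. -/
def diff (hq : q + 1 = q') : A.WordFun r q →ₗ[R] A.WordFun r q' where
  toFun f := diffInt hq f + diffExt hq f
  map_add' f g := by
    funext x
    simp only [diffInt, diffExt, headTerm, lastTerm, Pi.add_apply, map_add, smul_add,
      Finset.sum_add_distrib, LinearMap.add_apply]
    split_ifs <;> abel
  map_smul' c f := by
    funext x
    simp only [diffInt, diffExt, headTerm, lastTerm, Pi.add_apply, Pi.smul_apply, map_smul,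
      smul_add, smul_sub, Finset.smul_sum, LinearMap.smul_apply, smul_comm _ c, RingHom.id_apply,
      ← smul_neg]
    split_ifs <;> simp [smul_add]

/-! #### The cup product and the bracket on cochains -/

variable {r₁ r₂ s : GMPerversity n} {q₁ q₂ q₃ : ℤ}

theorem cup_aux (h : r₁.toFun + r₂.toFun ≤ s.toFun) (x : A.WordIndex s q) (i : ℕ) :
    r₁.toFun + Word.per (x.word.take i) + (r₂.toFun + Word.per (x.word.drop i)) ≤
      x.tgt.toFun := by
  have h' := x.le
  rw [← List.take_append_drop i x.word, Word.per_append] at h'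
  refine le_trans ?_ ((add_le_add_left h _).trans h')
  exact le_of_eq (by abel)

/-- The cup product
`(f ∪ g) [a_1|…|a_k] = ∑_{i=0}^k (-1)^{|g| (|s(a_1)| + ⋯ + |s(a_i)|)} f [a_1|…|a_i] g [a_{i+1}|…|a_k]`. -/
def cup (h : r₁.toFun + r₂.toFun ≤ s.toFun) (hq : q₁ + q₂ = q₃) (f : A.WordFun r₁ q₁)
    (g : A.WordFun r₂ q₂) : A.WordFun s q₃ := fun x =>
  ∑ i : Fin (x.word.length + 1), (q₂ * Word.deg (x.word.take i)).negOnePow •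
    A.mul (p := .ceil (r₁.toFun + Word.per (x.word.take i)))
      (q := .ceil (r₂.toFun + Word.per (x.word.drop i)))
      (GMPerversity.add_ceil_le
        (GMPerversity.monotone_add r₂.monotone (Word.per_monotone _)) (GMPerversity.monotone _)
        (GMPerversity.add_ceil_le
          (GMPerversity.monotone_add r₁.monotone (Word.per_monotone _))
          (GMPerversity.monotone_add r₂.monotone (Word.per_monotone _)) (cup_aux h x i)))
      (by
        have h' := x.deg_eq
        rw [← List.take_append_drop i x.word, Word.deg_append] at h'
        dsimp only
        omega)
      (f ⟨x.word.take i, .ceil (r₁.toFun + Word.per (x.word.take i)),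
        Word.deg (x.word.take i) + q₁,
        GMPerversity.le_ceil (GMPerversity.le_of_add_le_left (cup_aux h x i)), rfl⟩)
      (g ⟨x.word.drop i, .ceil (r₂.toFun + Word.per (x.word.drop i)),
        Word.deg (x.word.drop i) + q₂,
        GMPerversity.le_ceil (GMPerversity.le_of_add_le_left
          (GMPerversity.add_le_comm (cup_aux h x i))), rfl⟩)

theorem circ_aux (h : r₁.toFun + r₂.toFun ≤ s.toFun) (x : A.WordIndex s q) (i l : ℕ) :
    r₂.toFun + Word.per ((x.word.drop i).take l) +
      (r₁.toFun + (Word.per (x.word.take i) + Word.per ((x.word.drop i).drop l))) ≤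
      x.tgt.toFun := by
  have h' := x.le
  rw [← Word.split_three x.word i l, Word.per_append, Word.per_append] at h'
  refine le_trans ?_ ((add_le_add_left h _).trans h')
  exact le_of_eq (by abel)

/-- The word `(a_1, …, a_i, g [a_{i+1}|…|a_{i+l}], a_{i+l+1}, …, a_k)`. -/
def insertWord (h : r₁.toFun + r₂.toFun ≤ s.toFun) (g : A.WordFun r₂ q₂) (x : A.WordIndex s q)
    (i l : ℕ) : A.Word :=
  x.word.take i ++
    letterOf g ((x.word.drop i).take l) (GMPerversity.le_of_add_le_left (circ_aux h x i l)) ::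
      (x.word.drop i).drop l

theorem insertWord_le (h : r₁.toFun + r₂.toFun ≤ s.toFun) (g : A.WordFun r₂ q₂)
    (x : A.WordIndex s q) (i l : ℕ) :
    r₁.toFun + Word.per (insertWord h g x i l) ≤ x.tgt.toFun := by
  have := GMPerversity.ceil_add_le (GMPerversity.monotone_add r₂.monotone (Word.per_monotone _))
    (GMPerversity.monotone_add r₁.monotone
      (GMPerversity.monotone_add (Word.per_monotone _) (Word.per_monotone _))) (circ_aux h x i l)
  simp only [insertWord, Word.per_append, Word.per_cons, letterOf]
  refine le_of_eq_of_le ?_ this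
  abel

theorem insertWord_deg (h : r₁.toFun + r₂.toFun ≤ s.toFun) (hq : q₁ + q₂ - 1 = q₃)
    (g : A.WordFun r₂ q₂) (x : A.WordIndex s q₃) (i l : ℕ) :
    Word.deg (insertWord h g x i l) + q₁ = x.tgtDeg := by
  have h' := x.deg_eq
  rw [← Word.split_three x.word i l] at h'
  simp only [insertWord, Word.deg_append, Word.deg_cons, letterOf] at h' ⊢
  omega

/-- The operation
`(f ∘ g) [a_1|…|a_k] = ∑_{0 ≤ i ≤ j ≤ k} (-1)^{(|g| - 1) (|s(a_1)| + ⋯ + |s(a_i)|)}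
  f [a_1|…|a_i| g [a_{i+1}|…|a_j] |a_{j+1}|…|a_k]`, where `j = i + l` in the code. -/
def circ (h : r₁.toFun + r₂.toFun ≤ s.toFun) (hq : q₁ + q₂ - 1 = q₃) (f : A.WordFun r₁ q₁)
    (g : A.WordFun r₂ q₂) : A.WordFun s q₃ := fun x =>
  ∑ i : Fin (x.word.length + 1), ∑ l : Fin (x.word.length + 1 - i),
    ((q₂ - 1) * Word.deg (x.word.take i)).negOnePow •
      f ⟨insertWord h g x i l, x.tgt, x.tgtDeg, insertWord_le h g x i l,
        insertWord_deg h hq g x i l⟩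

/-- The Gerstenhaber bracket `[f, g] = f ∘ g - (-1)^{(|f| - 1)(|g| - 1)} g ∘ f`. -/
def bracket (h : r₁.toFun + r₂.toFun ≤ s.toFun) (hq : q₁ + q₂ - 1 = q₃) (f : A.WordFun r₁ q₁)
    (g : A.WordFun r₂ q₂) : A.WordFun s q₃ :=
  circ h hq f g - ((q₁ - 1) * (q₂ - 1)).negOnePow •
    circ (GMPerversity.add_le_comm h) (by rw [add_comm]; exact hq) g f

/-! #### Hochschild cohomology -/

/-- The restriction of functions on words along `r ≤ r'`. -/
def WordFun.restrict {r r' : GMPerversity n} (hr : r ≤ r') {q : ℤ} (f : A.WordFun r q) :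
    A.WordFun r' q := fun x =>
  f ⟨x.word, x.tgt, x.tgtDeg,
    (add_le_add_left (show r.toFun ≤ r'.toFun from hr) _).trans x.le, x.deg_eq⟩

theorem HC.map_eval (f : A.HC r q) (w : A.Word) {v v' : GMPerversity n} (hv : v ≤ v') {j : ℤ}
    (h : r.toFun + w.per ≤ v.toFun) (h' : r.toFun + w.per ≤ v'.toFun) (hj : w.deg + q = j) :
    A.map hv (HC.eval f ⟨w, v, j, h, hj⟩) = HC.eval f ⟨w, v', j, h', hj⟩ := by
  have := f.2 (.ceil w.per) (.ceil w.per) v v' w.deg j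
    (GMPerversity.add_ceil_le w.per_monotone r.monotone (GMPerversity.add_le_comm h))
    (GMPerversity.add_ceil_le w.per_monotone r.monotone (GMPerversity.add_le_comm h')) hj le_rfl hv
    (w.bar (GMPerversity.le_ceil
      (GMPerversity.le_of_add_le_left (GMPerversity.add_le_comm h))) rfl)
  rw [PerverseGradedModule.map_id] at this
  exact this

theorem HC.eval_map {r r' : GMPerversity n} (hr : r ≤ r') {q : ℤ} (f : A.HC r q) :
    HC.eval (IHom.map hr f) = (HC.eval f).restrict hr := rfl

theorem HC.diff_eval_map {r r' : GMPerversity n} (hr : r ≤ r') (hq : q + 1 = q') (f : A.HC r q) :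
    diff hq (HC.eval (IHom.map hr f)) = (diff hq (HC.eval f)).restrict hr := by
  rw [HC.eval_map]
  have hle : ∀ y : Fin (n + 1) → ℕ, r.toFun + y ≤ r'.toFun + y := fun y =>
    add_le_add_left (show r.toFun ≤ r'.toFun from hr) y
  funext x
  have hx := (hle _).trans x.le
  have hint : diffInt hq ((HC.eval f).restrict hr) x = (diffInt hq (HC.eval f)).restrict hr x := rfl
  have hext : diffExt hq ((HC.eval f).restrict hr) x = (diffExt hq (HC.eval f)).restrict hr x := by
    simp only [diffExt, WordFun.restrict]
    refine congrArg₂ _ ?_ rfl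
    split_ifs with hw
    · have hc : ∀ {y : Fin (n + 1) → ℕ} {v : GMPerversity n}, r'.toFun + y ≤ v.toFun →
          GMPerversity.ceil (r.toFun + y) ≤ GMPerversity.ceil (r'.toFun + y) := fun {y v} h =>
        GMPerversity.ceil_le ((hle y).trans (GMPerversity.le_ceil h))
      have h₁ := hc (GMPerversity.le_of_add_le_left (head_le x hw))
      have h₂ := hc (GMPerversity.le_of_add_le_left (getLast_le x hw))
      have e₁ : headTerm hq ((HC.eval f).restrict hr) x hw
          = headTerm hq (HC.eval f) ⟨x.word, x.tgt, x.tgtDeg, hx, x.deg_eq⟩ hw := by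
        simp only [headTerm, WordFun.restrict]
        rw [← HC.map_eval f x.word.tail h₁
          (GMPerversity.le_ceil (v := x.tgt)
            ((hle _).trans (GMPerversity.le_of_add_le_left (head_le x hw)))) _ rfl]
        conv_lhs => rw [← A.map_id (x.word.head hw).val]
        rw [← A.map_mul _ _ _ _ (le_refl x.tgt), A.map_id]
      have e₂ : lastTerm hq ((HC.eval f).restrict hr) x hw
          = lastTerm hq (HC.eval f) ⟨x.word, x.tgt, x.tgtDeg, hx, x.deg_eq⟩ hw := by
        simp only [lastTerm, WordFun.restrict]
        rw [← HC.map_eval f x.word.dropLast h₂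
          (GMPerversity.le_ceil (v := x.tgt)
            ((hle _).trans (GMPerversity.le_of_add_le_left (getLast_le x hw)))) _ rfl]
        conv_lhs => rw [← A.map_id (x.word.getLast hw).val]
        rw [← A.map_mul _ _ _ _ (le_refl x.tgt), A.map_id]
      rw [e₁, e₂]
    · rfl
  exact congrArg₂ (· + ·) hint hext

variable (A)

/-- The Hochschild cocycles. -/
def cocycles (r : GMPerversity n) (q : ℤ) : Submodule R (A.HC r q) :=
  LinearMap.ker (diff (r := r) (rfl : q + 1 = q + 1) ∘ₗ HC.eval)

/-- The Hochschild coboundaries: the cochains `g` such that `g = D f` for a cochain `f`. -/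
def coboundaries (r : GMPerversity n) (q : ℤ) : Submodule R (A.HC r q) :=
  (LinearMap.range
    (diff (r := r) (sub_add_cancel q 1) ∘ₗ (HC.eval : A.HC r (q - 1) →ₗ[R] _))).comap HC.eval

variable {A}

theorem cocycles_map {r r' : GMPerversity n} (hr : r ≤ r') {q : ℤ} (f : A.HC r q)
    (hf : f ∈ A.cocycles r q) : IHom.map hr f ∈ A.cocycles r' q := by
  have h : diff rfl (HC.eval f) = 0 := hf
  show diff rfl (HC.eval (IHom.map hr f)) = 0
  rw [HC.diff_eval_map, h]
  rfl

theorem coboundaries_map {r r' : GMPerversity n} (hr : r ≤ r') {q : ℤ} (f : A.HC r q)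
    (hf : f ∈ A.coboundaries r q) : IHom.map hr f ∈ A.coboundaries r' q := by
  obtain ⟨g, hg⟩ := hf
  replace hg : diff _ (HC.eval g) = HC.eval f := hg
  refine ⟨IHom.map hr g, ?_⟩
  show diff _ (HC.eval (IHom.map hr g)) = HC.eval (IHom.map hr f)
  rw [HC.diff_eval_map, hg, HC.eval_map]

variable (A)

/-- The Hochschild cohomology `HH_•^*(A)`: cocycles modulo coboundaries. -/
def HH : PerverseGradedModule.{u, max u v} R n where
  obj r q := A.cocycles r q ⧸ (A.coboundaries r q).submoduleOf (A.cocycles r q)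
  map {_ _} h {_} := Submodule.mapQ _ _
    ((IHom.map h).restrict fun f hf => cocycles_map h f hf)
    (fun f hf => coboundaries_map h f.1 hf)
  map_id x := by
    obtain ⟨x, rfl⟩ := Submodule.Quotient.mk_surjective _ x
    rfl
  map_map {_ _ _} h h' {_} x := by
    obtain ⟨x, rfl⟩ := Submodule.Quotient.mk_surjective _ x
    rfl

/-- The class of a cocycle. -/
def HH.mk {r : GMPerversity n} {q : ℤ} (f : A.cocycles r q) : A.HH.obj r q :=
  Submodule.Quotient.mk f

end PerverseDGA

/-! ### Perverse Gerstenhaber algebras -/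

/-- A perverse Gerstenhaber algebra structure on a perverse graded module `H`: products
`H_p^i ⊗ H_q^j → H_r^{i+j}` and brackets `H_p^i ⊗ H_q^j → H_r^{i+j-1}` for `p + q ≤ r`, compatible
with the structure maps (that is, of perverse degree `0`), such that the product is associative
and graded commutative, the bracket is a graded Lie bracket on the suspension, and the Leibniz
rule holds. -/
structure PerverseGerstenhaber {R : Type u} [CommRing R] {n : ℕ}
    (H : PerverseGradedModule.{u, v} R n) where
  cup : ∀ {p q r : GMPerversity n} (_ : p.toFun + q.toFun ≤ r.toFun) {i j k : ℤ} (_ : i + j = k),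
    H.obj p i →ₗ[R] H.obj q j →ₗ[R] H.obj r k
  bracket : ∀ {p q r : GMPerversity n} (_ : p.toFun + q.toFun ≤ r.toFun) {i j k : ℤ}
    (_ : i + j - 1 = k), H.obj p i →ₗ[R] H.obj q j →ₗ[R] H.obj r k
  map_cup : ∀ {p q r p' q' r' : GMPerversity n} (h : p.toFun + q.toFun ≤ r.toFun)
    (h' : p'.toFun + q'.toFun ≤ r'.toFun) (hp : p ≤ p') (hq : q ≤ q') (hr : r ≤ r') {i j k : ℤ}
    (hk : i + j = k) (a : H.obj p i) (b : H.obj q j),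
    H.map hr (cup h hk a b) = cup h' hk (H.map hp a) (H.map hq b)
  map_bracket : ∀ {p q r p' q' r' : GMPerversity n} (h : p.toFun + q.toFun ≤ r.toFun)
    (h' : p'.toFun + q'.toFun ≤ r'.toFun) (hp : p ≤ p') (hq : q ≤ q') (hr : r ≤ r') {i j k : ℤ}
    (hk : i + j - 1 = k) (a : H.obj p i) (b : H.obj q j),
    H.map hr (bracket h hk a b) = bracket h' hk (H.map hp a) (H.map hq b)
  cup_assoc : ∀ {p q s pq qs r : GMPerversity n} (h₁ : p.toFun + q.toFun ≤ pq.toFun)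
    (h₂ : pq.toFun + s.toFun ≤ r.toFun) (h₃ : q.toFun + s.toFun ≤ qs.toFun)
    (h₄ : p.toFun + qs.toFun ≤ r.toFun) {i j k ij jk l : ℤ} (e₁ : i + j = ij) (e₂ : ij + k = l)
    (e₃ : j + k = jk) (e₄ : i + jk = l) (a : H.obj p i) (b : H.obj q j) (c : H.obj s k),
    cup h₂ e₂ (cup h₁ e₁ a b) c = cup h₄ e₄ a (cup h₃ e₃ b c)
  cup_comm : ∀ {p q r : GMPerversity n} (h : p.toFun + q.toFun ≤ r.toFun)
    (h' : q.toFun + p.toFun ≤ r.toFun) {i j k : ℤ} (e : i + j = k) (e' : j + i = k)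
    (a : H.obj p i) (b : H.obj q j),
    cup h e a b = (i * j).negOnePow • cup h' e' b a
  bracket_skew : ∀ {p q r : GMPerversity n} (h : p.toFun + q.toFun ≤ r.toFun)
    (h' : q.toFun + p.toFun ≤ r.toFun) {i j k : ℤ} (e : i + j - 1 = k) (e' : j + i - 1 = k)
    (a : H.obj p i) (b : H.obj q j),
    bracket h e a b = -(((i - 1) * (j - 1)).negOnePow • bracket h' e' b a)
  /-- `[[a, b], c] = [a, [b, c]] - (-1)^{(|a| - 1)(|b| - 1)} [b, [a, c]]` -/
  jacobi : ∀ {p q s pq qs ps r : GMPerversity n} (h₁ : p.toFun + q.toFun ≤ pq.toFun)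
    (h₂ : pq.toFun + s.toFun ≤ r.toFun) (h₃ : q.toFun + s.toFun ≤ qs.toFun)
    (h₄ : p.toFun + qs.toFun ≤ r.toFun) (h₅ : p.toFun + s.toFun ≤ ps.toFun)
    (h₆ : q.toFun + ps.toFun ≤ r.toFun) {i j k ij jk ik l : ℤ} (e₁ : i + j - 1 = ij)
    (e₂ : ij + k - 1 = l) (e₃ : j + k - 1 = jk) (e₄ : i + jk - 1 = l) (e₅ : i + k - 1 = ik)
    (e₆ : j + ik - 1 = l) (a : H.obj p i) (b : H.obj q j) (c : H.obj s k),
    bracket h₂ e₂ (bracket h₁ e₁ a b) c = bracket h₄ e₄ a (bracket h₃ e₃ b c) -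
      ((i - 1) * (j - 1)).negOnePow • bracket h₆ e₆ b (bracket h₅ e₅ a c)
  /-- `[a, b ∪ c] = [a, b] ∪ c + (-1)^{(|a| - 1)|b|} b ∪ [a, c]` -/
  leibniz : ∀ {p q s pq qs ps r : GMPerversity n} (h₁ : p.toFun + q.toFun ≤ pq.toFun)
    (h₂ : pq.toFun + s.toFun ≤ r.toFun) (h₃ : q.toFun + s.toFun ≤ qs.toFun)
    (h₄ : p.toFun + qs.toFun ≤ r.toFun) (h₅ : p.toFun + s.toFun ≤ ps.toFun)
    (h₆ : q.toFun + ps.toFun ≤ r.toFun) {i j k ij jk ik l : ℤ} (e₁ : i + j - 1 = ij)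
    (e₂ : ij + k = l) (e₃ : j + k = jk) (e₄ : i + jk - 1 = l) (e₅ : i + k - 1 = ik)
    (e₆ : j + ik = l) (a : H.obj p i) (b : H.obj q j) (c : H.obj s k),
    bracket h₄ e₄ a (cup h₃ e₃ b c) = cup h₂ e₂ (bracket h₁ e₁ a b) c +
      ((i - 1) * j).negOnePow • cup h₆ e₆ b (bracket h₅ e₅ a c)

end

/-! The theorem rests on the calculus of insertions (braces) of multilinear functions. Let m (`str`)
be the function with m[a] = da and m[a|b] = ±ab. The relations d² = 0, the Leibniz rule and
associativity give m ∘ m = 0 (`str_circ_str`), and the Hochschild differential is Df = m ∘ f -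
(-1)^{|f|-1} f ∘ m (`D_eq_br`). The pre-Lie identity (f ∘ g) ∘ h = f ∘ (g ∘ h) + f{g,h} ± f{h,g}
(`circ_circ`) then yields D² = 0 and the graded Jacobi identity already for cochains, without
dividing by 2. The cup product is associative on cochains, and D is a derivation of the cup product
and of the bracket (`D_cup`, `D_br`). Commutativity and the Leibniz rule hold only up to homotopy: f
∘ g is the homotopy for the first (`D_circ`), the brace f{g,h} for the second (`D_brace`).

To control sums and signs, everything takes place over one ring, the direct sum `Total` of all
components of A, with sign operators τ_k acting by (-1)^{k(|a|-1)}. A cochain becomes a multilinear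
function on lists of elements of this ring, and the cup product becomes a twisted convolution over
the splittings of a list. A multilinear function factors through the tensor algebra
(`IsMulti.exists_eq_post`), so a brace identity need only be checked for the universal function
`tens`. There an insertion is a product in the convolution algebra, and insertions satisfy product
rules (`ins_mul`, `ins₂_mul`). The identity thus becomes an expansion of products, followed by a
check of signs by parity.

The product in `Total` of components of perversities p and q lands in perversity `ceil (p + q)`, and
is zero if no perversity bounds p + q. The structure maps of A are invisible in this ring. They are
recovered by a relation, `Rel`, between homogeneous elements and their images, and `Typed` says that
a function sends related lists to related values; all operations preserve this. Perversities are
carried along as unrounded functions x, because `ceil (ceil x + y) = ceil (x + y)` makes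
intermediate rounding harmless.

Multilinear, typed functions which vanish when an entry is 1 form `IsFun`. Every cochain comes from
such a function (`HC.exists_isFun`) and every such function gives a cochain
(`IsFun.exists_cochain`). The lemmas `toWordFun_D`, `toWordFun_cup` and `toWordFun_bracket` match
the operations with the explicit formulas. Each axiom on cohomology is then an equality of
functions, possibly up to D of an explicit function. -/

noncomputable section

/-! ### Sums over the splittings of a list -/

section SplitSum

variable {V : Type*} {N : Type*} [AddCommMonoid N]

/-- The sum of `Θ b c` over all splittings `l = b ++ c`. -/
def splitSum : (List V → List V → N) → List V → N
  | Θ, [] => Θ [] []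
  | Θ, x :: l => Θ [] (x :: l) + splitSum (fun b c => Θ (x :: b) c) l

theorem splitSum_nil (Θ : List V → List V → N) : splitSum Θ [] = Θ [] [] := rfl

theorem splitSum_cons (Θ : List V → List V → N) (x : V) (l : List V) :
    splitSum Θ (x :: l) = Θ [] (x :: l) + splitSum (fun b c => Θ (x :: b) c) l := rfl

theorem splitSum_add (Θ Θ' : List V → List V → N) (l : List V) :
    splitSum (fun b c => Θ b c + Θ' b c) l = splitSum Θ l + splitSum Θ' l := by
  induction l generalizing Θ Θ' with
  | nil => rfl
  | cons x l ih => rw [splitSum_cons, splitSum_cons, splitSum_cons, ih]; abel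

theorem map_splitSum {M F : Type*} [AddCommMonoid M] [FunLike F N M] [AddMonoidHomClass F N M]
    (φ : F) (Θ : List V → List V → N) (l : List V) :
    φ (splitSum Θ l) = splitSum (fun b c => φ (Θ b c)) l := by
  induction l generalizing Θ with
  | nil => rfl
  | cons x l ih => rw [splitSum_cons, splitSum_cons, map_add, ih]

theorem splitSum_congr {Θ Θ' : List V → List V → N} {l : List V}
    (h : ∀ b c, b ++ c = l → Θ b c = Θ' b c) : splitSum Θ l = splitSum Θ' l := by
  induction l generalizing Θ Θ' with
  | nil => exact h _ _ rfl
  | cons x l ih =>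
    rw [splitSum_cons, splitSum_cons, h [] (x :: l) rfl,
      ih fun b c hbc => h (x :: b) c (by rw [List.cons_append, hbc])]

theorem splitSum_zero (l : List V) : splitSum (fun _ _ => (0 : N)) l = 0 := by
  induction l with
  | nil => rfl
  | cons x l ih => rw [splitSum_cons, ih, add_zero]

theorem splitSum_eq_zero {Θ : List V → List V → N} {l : List V}
    (h : ∀ b c, b ++ c = l → Θ b c = 0) : splitSum Θ l = 0 :=
  (splitSum_congr h).trans (splitSum_zero l)

theorem splitSum_smul {S : Type*} [DistribSMul S N] (s : S) (Θ : List V → List V → N)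
    (l : List V) : splitSum (fun b c => s • Θ b c) l = s • splitSum Θ l :=
  (map_splitSum (DistribSMul.toAddMonoidHom N s) Θ l).symm

theorem splitSum_map {W : Type*} (t : W → V) (Θ : List V → List V → N) (l : List W) :
    splitSum Θ (l.map t) = splitSum (fun b c => Θ (b.map t) (c.map t)) l := by
  induction l generalizing Θ with
  | nil => rfl
  | cons x l ih => rw [List.map_cons, splitSum_cons, splitSum_cons, ih]; rfl

/-- Both sides run over the splittings into three parts: deconcatenation is coassociative.
Associativity of convolution comes from here. -/
theorem splitSum_assoc (Θ : List V → List V → List V → N) (l : List V) :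
    splitSum (fun a r => splitSum (Θ a) r) l =
      splitSum (fun s c => splitSum (fun a b => Θ a b c) s) l := by
  induction l generalizing Θ with
  | nil => rfl
  | cons x l ih =>
    simp only [splitSum_cons, splitSum_nil]
    rw [ih, splitSum_add, add_assoc]

/-- The cut falls either before or after the marked entry `x`. This is how multilinearity and
normalization in one entry pass to convolutions and insertions. -/
theorem splitSum_append_cons (Θ : List V → List V → N) (a : List V) (x : V) (b : List V) :
    splitSum Θ (a ++ x :: b) = splitSum (fun a₁ a₂ => Θ a₁ (a₂ ++ x :: b)) a +
      splitSum (fun b₁ b₂ => Θ (a ++ x :: b₁) b₂) b := by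
  induction a generalizing Θ with
  | nil => rfl
  | cons y a ih =>
    rw [List.cons_append, splitSum_cons, ih, splitSum_cons, add_assoc]
    rfl

/-- The bridge from the recursive sums, suited to induction on lists, to the indexed sums in the
explicit formulas. -/
theorem splitSum_eq_sum (Θ : List V → List V → N) (l : List V) :
    splitSum Θ l = ∑ i : Fin (l.length + 1), Θ (l.take i) (l.drop i) := by
  induction l generalizing Θ with
  | nil => simp [splitSum_nil]
  | cons x l ih =>
    rw [splitSum_cons, ih]
    exact (Fin.sum_univ_succ (n := l.length + 1)
      (fun i => Θ ((x :: l).take i) ((x :: l).drop i))).symm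

/-- A sum in which only the splittings with empty first part contribute. -/
theorem splitSum_eq_nil_left {Θ : List V → List V → N} (l : List V)
    (h : ∀ x b c, Θ (x :: b) c = 0) : splitSum Θ l = Θ [] l := by
  cases l with
  | nil => rfl
  | cons x l => rw [splitSum_cons, splitSum_eq_zero fun b c _ => h x b c, add_zero]

/-- A sum in which only the splittings with empty second part contribute. -/
theorem splitSum_eq_nil_right {Θ : List V → List V → N} (l : List V)
    (h : ∀ x b c, Θ b (x :: c) = 0) : splitSum Θ l = Θ l [] := by
  induction l generalizing Θ with
  | nil => rfl
  | cons x l ih => rw [splitSum_cons, h, zero_add, ih fun y b c => h y (x :: b) c]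

end SplitSum

/-! ### The convolution product of functions on lists -/

/-- Functions on the lists in `V`, with the convolution product if `B` is a ring. -/
@[ext]
structure ConvAlg (V B : Type*) where
  /-- A function on lists as an element of `ConvAlg V B`. -/
  ofFun ::
  toFun : List V → B

namespace ConvAlg

variable {V : Type*} {B : Type*} {R : Type*}

instance : CoeFun (ConvAlg V B) (fun _ => List V → B) := ⟨ConvAlg.toFun⟩

/-- `ConvAlg V B` consists of the functions `List V → B`. -/
def equivFun : ConvAlg V B ≃ (List V → B) := ⟨toFun, ofFun, fun _ => rfl, fun _ => rfl⟩

instance [AddCommGroup B] : AddCommGroup (ConvAlg V B) := equivFun.addCommGroup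

instance [CommRing R] [AddCommGroup B] [Module R B] : Module R (ConvAlg V B) :=
  equivFun.module R

theorem ext_apply {Φ Ψ : ConvAlg V B} (h : ∀ l, Φ l = Ψ l) : Φ = Ψ :=
  ConvAlg.ext (funext h)

section

variable [AddCommGroup B]

theorem add_apply (Φ Ψ : ConvAlg V B) (l : List V) : (Φ + Ψ) l = Φ l + Ψ l := rfl
theorem sub_apply (Φ Ψ : ConvAlg V B) (l : List V) : (Φ - Ψ) l = Φ l - Ψ l := rfl
theorem zero_apply (l : List V) : (0 : ConvAlg V B) l = 0 := rfl
theorem smul_apply [CommRing R] [Module R B] (s : R) (Φ : ConvAlg V B) (l : List V) :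
    (s • Φ) l = s • Φ l := rfl

end

section Ring

variable [Ring B]

instance : Mul (ConvAlg V B) := ⟨fun Φ Ψ => ofFun (splitSum fun b c => Φ b * Ψ c)⟩

theorem mul_apply (Φ Ψ : ConvAlg V B) (l : List V) :
    (Φ * Ψ) l = splitSum (fun b c => Φ b * Ψ c) l := rfl

instance : NonUnitalRing (ConvAlg V B) where
  left_distrib Φ Ψ Ω := by
    refine ConvAlg.ext_apply fun l => ?_; simp only [mul_apply, add_apply, mul_add, splitSum_add]
  right_distrib Φ Ψ Ω := by
    refine ConvAlg.ext_apply fun l => ?_; simp only [mul_apply, add_apply, add_mul, splitSum_add]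
  zero_mul Φ := by
    refine ConvAlg.ext_apply fun l => ?_; simp only [mul_apply, zero_apply, zero_mul, splitSum_zero]
  mul_zero Φ := by
    refine ConvAlg.ext_apply fun l => ?_; simp only [mul_apply, zero_apply, mul_zero, splitSum_zero]
  mul_assoc Φ Ψ Ω := by
    refine ConvAlg.ext_apply fun l => ?_
    have h₁ : ∀ c s, splitSum (fun b c' => Φ b * Ψ c') s * Ω c =
        splitSum (fun b c' => Φ b * Ψ c' * Ω c) s := fun c s =>
      map_splitSum (AddMonoidHom.mulRight (Ω c)) _ s
    have h₂ : ∀ a r, Φ a * splitSum (fun b c => Ψ b * Ω c) r =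
        splitSum (fun b c => Φ a * (Ψ b * Ω c)) r := fun a r =>
      map_splitSum (AddMonoidHom.mulLeft (Φ a)) _ r
    simp only [mul_apply, h₁, h₂]
    rw [splitSum_assoc]
    simp only [mul_assoc]

variable [CommRing R] [Algebra R B]

instance : IsScalarTower R (ConvAlg V B) (ConvAlg V B) :=
  ⟨fun s Φ Ψ => by
    refine ConvAlg.ext_apply fun l => ?_
    simp only [smul_eq_mul, mul_apply, smul_apply, smul_mul_assoc, splitSum_smul]⟩

instance : SMulCommClass R (ConvAlg V B) (ConvAlg V B) :=
  ⟨fun s Φ Ψ => by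
    refine ConvAlg.ext_apply fun l => ?_
    simp only [smul_eq_mul, mul_apply, smul_apply, mul_smul_comm, splitSum_smul]⟩

end Ring

/-! ### Insertions -/

section Insertion

variable {N : Type*} [AddCommGroup N]

/-- `Φ (t a ++ h b :: c)`, summed over the splittings `a ++ b ++ c` of a list. -/
def ins (t : V → V) (h : ConvAlg V V) (Φ : ConvAlg V N) : ConvAlg V N := .ofFun fun l =>
  splitSum (fun a r => splitSum (fun b c => Φ (a.map t ++ h b :: c)) r) l

/-- `Φ (h b :: c)`, summed over the splittings `b ++ c` of a list. -/
def insHead (h : ConvAlg V V) (Φ : ConvAlg V N) : ConvAlg V N := .ofFun fun l =>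
  splitSum (fun b c => Φ (h b :: c)) l

/-- `Φ (t a ++ g b :: t' c ++ h d :: e)`, summed over the splittings `a ++ b ++ c ++ d ++ e` of a
list. -/
def ins₂ (t : V → V) (g : ConvAlg V V) (t' : V → V) (h : ConvAlg V V) (Φ : ConvAlg V N) :
    ConvAlg V N := .ofFun fun l =>
  splitSum (fun a r => splitSum (fun b r' =>
    ins t' h (ofFun fun w => Φ (a.map t ++ g b :: w)) r') r) l

/-- `Φ (g b :: t' c ++ h d :: e)`, summed over the splittings `b ++ c ++ d ++ e` of a list. -/
def ins₂Head (g : ConvAlg V V) (t' : V → V) (h : ConvAlg V V) (Φ : ConvAlg V N) :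
    ConvAlg V N := .ofFun fun l =>
  splitSum (fun b r => ins t' h (ofFun fun w => Φ (g b :: w)) r) l

/-- `Φ (t a ++ g b :: t' c)`, summed over the splittings `a ++ b ++ c` of a list. -/
def insTwist (t : V → V) (g : ConvAlg V V) (t' : V → V) (Φ : ConvAlg V N) : ConvAlg V N :=
  .ofFun fun l => splitSum (fun a r => splitSum (fun b c => Φ (a.map t ++ g b :: c.map t')) r) l

/-- `Φ (t a)`. -/
def twist (t : V → V) (Φ : ConvAlg V N) : ConvAlg V N := .ofFun fun l => Φ (l.map t)

variable (t t' : V → V) (g h : ConvAlg V V)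

theorem ins_cons (Φ : ConvAlg V N) (x : V) (l : List V) :
    ins t h Φ (x :: l) =
      insHead h Φ (x :: l) + ins t h (ofFun fun w => Φ (t x :: w)) l := rfl

theorem ins₂_cons (Φ : ConvAlg V N) (x : V) (l : List V) :
    ins₂ t g t' h Φ (x :: l) = ins₂Head g t' h Φ (x :: l) +
      ins₂ t g t' h (ofFun fun w => Φ (t x :: w)) l := rfl

theorem ins_add (Φ Ψ : ConvAlg V N) : ins t h (Φ + Ψ) = ins t h Φ + ins t h Ψ := by
  refine ext_apply fun l => ?_; simp only [ins, add_apply, splitSum_add]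

theorem ins₂_add (Φ Ψ : ConvAlg V N) :
    ins₂ t g t' h (Φ + Ψ) = ins₂ t g t' h Φ + ins₂ t g t' h Ψ := by
  refine ext_apply fun l => ?_; simp only [ins₂, ins, add_apply, splitSum_add]

theorem ins_zero : ins t h (0 : ConvAlg V N) = 0 := by
  refine ext_apply fun l => ?_; simp only [ins, zero_apply, splitSum_zero]

theorem ins₂_zero : ins₂ t g t' h (0 : ConvAlg V N) = 0 := by
  refine ext_apply fun l => ?_; simp only [ins₂, ins, zero_apply, splitSum_zero]

/-- Applying an additive map to the values commutes with insertions. -/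
theorem map_ins {M F : Type*} [AddCommGroup M] [FunLike F N M] [AddMonoidHomClass F N M] (φ : F)
    (Φ : ConvAlg V N) (l : List V) :
    φ (ins t h Φ l) = ins t h (ofFun fun w => φ (Φ w)) l := by
  simp only [ins, map_splitSum]

theorem map_ins₂ {M F : Type*} [AddCommGroup M] [FunLike F N M] [AddMonoidHomClass F N M]
    (φ : F) (Φ : ConvAlg V N) (l : List V) :
    φ (ins₂ t g t' h Φ l) = ins₂ t g t' h (ofFun fun w => φ (Φ w)) l := by
  simp only [ins₂, map_splitSum, map_ins]

theorem ins_smul [CommRing R] [Module R N] (s : R) (Φ : ConvAlg V N) :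
    ins t h (s • Φ) = s • ins t h Φ := by
  refine ext_apply fun l => ?_; exact (map_ins t h (DistribSMul.toAddMonoidHom N s) Φ l).symm

theorem ins₂_smul [CommRing R] [Module R N] (s : R) (Φ : ConvAlg V N) :
    ins₂ t g t' h (s • Φ) = s • ins₂ t g t' h Φ := by
  refine ext_apply fun l => ?_; exact (map_ins₂ t t' g h (DistribSMul.toAddMonoidHom N s) Φ l).symm

variable [Ring B]

theorem mul_splitSum (x : B) (Θ : List V → List V → B) (l : List V) :
    x * splitSum Θ l = splitSum (fun b c => x * Θ b c) l :=
  map_splitSum (AddMonoidHom.mulLeft x) Θ l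

theorem splitSum_mul (x : B) (Θ : List V → List V → B) (l : List V) :
    splitSum Θ l * x = splitSum (fun b c => Θ b c * x) l :=
  map_splitSum (AddMonoidHom.mulRight x) Θ l

theorem mul_cons (Φ Ψ : ConvAlg V B) (x : V) (l : List V) :
    (Φ * Ψ) (x :: l) = Φ [] * Ψ (x :: l) + ((ofFun fun w => Φ (x :: w)) * Ψ) l := rfl

/-- The block inserted at the head belongs to the second factor exactly when the first factor
receives the empty list. -/
theorem insHead_mul (Φ Ψ : ConvAlg V B) (l : List V) :
    insHead h (Φ * Ψ) l = Φ [] * insHead h Ψ l + (insHead h Φ * Ψ) l := by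
  simp only [insHead, mul_apply, mul_splitSum, splitSum_mul, splitSum_cons, splitSum_add]
  congr 1
  exact splitSum_assoc (fun b c e => Φ (h b :: c) * Ψ e) l

theorem const_mul_ins (x : B) (Ψ : ConvAlg V B) (l : List V) :
    x * ins t h Ψ l = ins t h (ofFun fun w => x * Ψ w) l :=
  map_ins t h (AddMonoidHom.mulLeft x) Ψ l

theorem const_mul_ins₂ (x : B) (Ψ : ConvAlg V B) (l : List V) :
    x * ins₂ t g t' h Ψ l = ins₂ t g t' h (ofFun fun w => x * Ψ w) l :=
  map_ins₂ t t' g h (AddMonoidHom.mulLeft x) Ψ l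

/-- Insertion is a derivation of the convolution product. -/
theorem ins_mul (Φ Ψ : ConvAlg V B) :
    ins t h (Φ * Ψ) = ins t h Φ * Ψ + twist t Φ * ins t h Ψ := by
  refine ext_apply fun l => ?_
  induction l generalizing Φ with
  | nil =>
    show Φ [] * Ψ [h []] + Φ [h []] * Ψ [] = Φ [h []] * Ψ [] + Φ [] * Ψ [h []]
    abel
  | cons x l ih =>
    -- Induction on the list: either the inserted block begins before `x` (`insHead`), or `x` is
    -- passed and twisted by `t`. In the second case the cut of the product falls before or after
    -- `x`.
    have e : (ofFun fun w => (Φ * Ψ) (t x :: w)) = (ofFun fun w => Φ [] * Ψ (t x :: w)) +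
        (ofFun fun w => Φ (t x :: w)) * Ψ := rfl
    have e' : (ofFun fun w => ins t h Φ (x :: w)) =
        (ofFun fun w => insHead h Φ (x :: w)) + ins t h (ofFun fun w => Φ (t x :: w)) := rfl
    rw [ins_cons, e, ins_add, add_apply, ih, add_apply, add_apply,
      mul_cons, mul_cons, e', add_mul, insHead_mul, mul_cons (insHead h Φ), add_apply,
      ins_cons t h Ψ, mul_add, const_mul_ins]
    have e₁ : insHead h Φ [] = ins t h Φ [] := rfl
    have e₂ : twist t Φ [] = Φ [] := rfl
    have e₃ : (ofFun fun w => twist t Φ (x :: w)) =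
      twist t (ofFun fun w => Φ (t x :: w)) := rfl
    rw [e₁, e₂, e₃]
    abel

/-- With the first block at the head, three cases remain: both blocks in the second factor, both in
the first, or one in each. In the last case the rest of the first factor lies between the blocks and
is twisted by `t'`. -/
theorem ins₂Head_mul (Φ Ψ : ConvAlg V B) (l : List V) :
    ins₂Head g t' h (Φ * Ψ) l = Φ [] * ins₂Head g t' h Ψ l + (ins₂Head g t' h Φ * Ψ) l +
      ((ofFun fun w => splitSum (fun b c => Φ (g b :: c.map t')) w) * ins t' h Ψ) l := by
  have e : ∀ b, (ofFun fun w => (Φ * Ψ) (g b :: w)) = (ofFun fun w => Φ [] * Ψ (g b :: w)) +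
        (ofFun fun w => Φ (g b :: w)) * Ψ := fun b => rfl
  simp only [ins₂Head, e, ins_add, ins_mul, add_apply, splitSum_add, mul_splitSum,
    const_mul_ins]
  rw [← add_assoc]
  congr 1
  · congr 1
    simp only [mul_apply, splitSum_mul]
    exact splitSum_assoc (fun b c e => ins t' h (ofFun fun w => Φ (g b :: w)) c * Ψ e) l
  · simp only [mul_apply, splitSum_mul]
    exact splitSum_assoc (fun b c e => Φ (g b :: c.map t') * ins t' h Ψ e) l

/-- The product rule for double insertions. -/
theorem ins₂_mul (Φ Ψ : ConvAlg V B) :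
    ins₂ t g t' h (Φ * Ψ) = ins₂ t g t' h Φ * Ψ + insTwist t g t' Φ * ins t' h Ψ +
      twist t Φ * ins₂ t g t' h Ψ := by
  refine ext_apply fun l => ?_
  induction l generalizing Φ with
  | nil =>
    show Φ [] * Ψ [g [], h []] + (Φ [g []] * Ψ [h []] + Φ [g [], h []] * Ψ []) =
      Φ [g [], h []] * Ψ [] + Φ [g []] * Ψ [h []] + Φ [] * Ψ [g [], h []]
    abel
  | cons x l ih =>
    have e : (ofFun fun w => (Φ * Ψ) (t x :: w)) = (ofFun fun w => Φ [] * Ψ (t x :: w)) +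
        (ofFun fun w => Φ (t x :: w)) * Ψ := rfl
    have e' : (ofFun fun w => ins₂ t g t' h Φ (x :: w)) =
        (ofFun fun w => ins₂Head g t' h Φ (x :: w)) +
          ins₂ t g t' h (ofFun fun w => Φ (t x :: w)) := rfl
    have e'' : (ofFun fun w => insTwist t g t' Φ (x :: w)) =
        (ofFun fun w => splitSum (fun b c => Φ (g b :: c.map t')) (x :: w)) +
          insTwist t g t' (ofFun fun w => Φ (t x :: w)) := rfl
    rw [ins₂_cons, e, ins₂_add, add_apply, ih, add_apply, add_apply,
      add_apply, add_apply,
      mul_cons, mul_cons, mul_cons, e', e'', add_mul, add_mul, ins₂Head_mul,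
      mul_cons (ins₂Head g t' h Φ), mul_cons (ofFun fun w => splitSum _ w),
      add_apply, add_apply, ins₂_cons t t' g h Ψ, mul_add, const_mul_ins₂]
    have e₁ : ins₂Head g t' h Φ [] = ins₂ t g t' h Φ [] := rfl
    have e₂ : twist t Φ [] = Φ [] := rfl
    have e₃ : (ofFun fun w => twist t Φ (x :: w)) =
      twist t (ofFun fun w => Φ (t x :: w)) := rfl
    have e₄ : insTwist t g t' Φ [] = splitSum (fun b c => Φ (g b :: c.map t')) [] := rfl
    rw [e₁, e₂, e₃, e₄]
    abel

end Insertion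

end ConvAlg
end

noncomputable section

/-! ### Multilinear functions on lists -/

/-- The sign `(-1)^k` in a commutative ring. -/
def sgn (R : Type*) [CommRing R] (k : ℤ) : R := ((k.negOnePow : ℤˣ) : ℤ)

section Sgn

variable {R : Type*} [CommRing R]

theorem sgn_eq_ite (k : ℤ) : sgn R k = if Even k then 1 else -1 := by
  unfold sgn
  split_ifs with h
  · simp [Int.negOnePow_even k h]
  · simp [Int.negOnePow_odd k (Int.not_even_iff_odd.1 h)]

theorem negOnePow_smul_eq {N : Type*} [AddCommGroup N] [Module R N] (k : ℤ) (x : N) :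
    k.negOnePow • x = sgn R k • x := by
  rw [sgn, Int.cast_smul_eq_zsmul, Units.smul_def]

theorem sgn_add (k l : ℤ) : sgn R (k + l) = sgn R k * sgn R l := by
  simp [sgn, Int.negOnePow_add]

theorem sgn_mul_self (k : ℤ) : sgn R k * sgn R k = 1 := by
  rw [sgn_eq_ite]; split_ifs <;> simp

end Sgn

set_option linter.unusedSectionVars false

namespace ConvAlg

variable {R : Type*} [CommRing R] {V N M : Type*} [AddCommGroup V] [Module R V]
  [AddCommGroup N] [Module R N] [AddCommGroup M] [Module R M]

variable (R) in
/-- A function on lists is multilinear if it is linear in each entry. -/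
structure IsMulti (Φ : ConvAlg V N) : Prop where
  add : ∀ a x y b, Φ (a ++ (x + y) :: b) = Φ (a ++ x :: b) + Φ (a ++ y :: b)
  smul : ∀ a (s : R) x b, Φ (a ++ (s • x) :: b) = s • Φ (a ++ x :: b)

/-- The composition with a linear map. -/
def post (φ : N →ₗ[R] M) (Φ : ConvAlg V N) : ConvAlg V M := .ofFun fun l => φ (Φ l)

theorem post_apply (φ : N →ₗ[R] M) (Φ : ConvAlg V N) (l : List V) :
    post φ Φ l = φ (Φ l) := rfl

theorem post_add (φ : N →ₗ[R] M) (Φ Ψ : ConvAlg V N) :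
    post φ (Φ + Ψ) = post φ Φ + post φ Ψ := ext_apply fun _ => map_add φ _ _

theorem post_sub (φ : N →ₗ[R] M) (Φ Ψ : ConvAlg V N) :
    post φ (Φ - Ψ) = post φ Φ - post φ Ψ := ext_apply fun _ => map_sub φ _ _

theorem post_smul (φ : N →ₗ[R] M) (s : R) (Φ : ConvAlg V N) :
    post φ (s • Φ) = s • post φ Φ := ext_apply fun _ => map_smul φ _ _

theorem post_ins (φ : N →ₗ[R] M) (t : V → V) (h : ConvAlg V V) (Φ : ConvAlg V N) :
    ins t h (post φ Φ) = post φ (ins t h Φ) :=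
  ext_apply fun l => (map_ins t h φ Φ l).symm

theorem post_ins₂ (φ : N →ₗ[R] M) (t t' : V → V) (g h : ConvAlg V V) (Φ : ConvAlg V N) :
    ins₂ t g t' h (post φ Φ) = post φ (ins₂ t g t' h Φ) :=
  ext_apply fun l => (map_ins₂ t t' g h φ Φ l).symm

theorem twist_apply (t : V → V) (Φ : ConvAlg V N) (l : List V) :
    twist t Φ l = Φ (l.map t) := rfl

theorem twist_add (t : V → V) (Φ Ψ : ConvAlg V N) :
    twist t (Φ + Ψ) = twist t Φ + twist t Ψ := rfl

theorem twist_smul (t : V → V) (s : R) (Φ : ConvAlg V N) :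
    twist t (s • Φ) = s • twist t Φ := rfl

theorem twist_post (t : V → V) (φ : N →ₗ[R] M) (Φ : ConvAlg V N) :
    twist t (post φ Φ) = post φ (twist t Φ) := rfl

theorem twist_mul {B : Type*} [Ring B] (t : V → V) (Φ Ψ : ConvAlg V B) :
    twist t (Φ * Ψ) = twist t Φ * twist t Ψ :=
  ext_apply fun l => splitSum_map t _ l

theorem isMulti_zero : IsMulti R (0 : ConvAlg V N) :=
  ⟨fun _ _ _ _ => (add_zero _).symm, fun _ _ _ _ => (smul_zero _).symm⟩

namespace IsMulti

theorem zero_entry {Φ : ConvAlg V N} (hΦ : IsMulti R Φ) (a b : List V) : Φ (a ++ 0 :: b) = 0 := by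
  simpa using hΦ.smul a 0 0 b

theorem addFun {Φ Ψ : ConvAlg V N} (hΦ : IsMulti R Φ) (hΨ : IsMulti R Ψ) : IsMulti R (Φ + Ψ) where
  add a x y b := by simp only [add_apply, hΦ.add, hΨ.add]; abel
  smul a s x b := by simp only [add_apply, hΦ.smul, hΨ.smul, smul_add]

theorem smulFun {Φ : ConvAlg V N} (hΦ : IsMulti R Φ) (c : R) : IsMulti R (c • Φ) where
  add a x y b := by simp only [smul_apply, hΦ.add, smul_add]
  smul a s x b := by simp only [smul_apply, hΦ.smul, smul_comm c]

theorem subFun {Φ Ψ : ConvAlg V N} (hΦ : IsMulti R Φ) (hΨ : IsMulti R Ψ) : IsMulti R (Φ - Ψ) := by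
  simpa [sub_eq_add_neg] using hΦ.addFun (hΨ.smulFun (-1))

theorem post {Φ : ConvAlg V N} (hΦ : IsMulti R Φ) (φ : N →ₗ[R] M) : IsMulti R (ConvAlg.post φ Φ) where
  add a x y b := by simp only [post_apply, hΦ.add, map_add]
  smul a s x b := by simp only [post_apply, hΦ.smul, map_smul]

theorem twist {Φ : ConvAlg V N} (hΦ : IsMulti R Φ) (t : V →ₗ[R] V) : IsMulti R (ConvAlg.twist t Φ) where
  add a x y b := by simp only [twist_apply, List.map_append, List.map_cons, map_add, hΦ.add]
  smul a s x b := by simp only [twist_apply, List.map_append, List.map_cons, map_smul, hΦ.smul]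

theorem mul {B : Type*} [Ring B] [Algebra R B] {Φ Ψ : ConvAlg V B} (hΦ : IsMulti R Φ)
    (hΨ : IsMulti R Ψ) : IsMulti R (Φ * Ψ) where
  add a x y b := by
    simp only [mul_apply, splitSum_append_cons, hΦ.add, hΨ.add, mul_add, add_mul, splitSum_add]
    abel
  smul a s x b := by
    simp only [mul_apply, splitSum_append_cons, hΦ.smul, hΨ.smul, mul_smul_comm, smul_mul_assoc,
      splitSum_smul, smul_add]

end IsMulti

variable (R V) in
/-- The list `x₁, …, x_k` as the element `x₁ ⊗ ⋯ ⊗ x_k` of the tensor algebra. -/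
def tens : ConvAlg V (TensorAlgebra R V) := .ofFun fun l => (l.map (TensorAlgebra.ι R)).prod

theorem tens_append (a b : List V) : tens R V (a ++ b) = tens R V a * tens R V b := by
  simp [tens]

theorem tens_cons (x : V) (b : List V) :
    tens R V (x :: b) = TensorAlgebra.ι R x * tens R V b := by
  simp [tens]

theorem isMulti_tens : IsMulti R (tens R V) where
  add a x y b := by simp only [tens_append, tens_cons, map_add, add_mul, mul_add]
  smul a s x b := by
    simp only [tens_append, tens_cons, map_smul, mul_smul_comm, smul_mul_assoc]

variable (R V N) in
/-- The module of multilinear functions. -/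
def multi : Submodule R (ConvAlg V N) where
  carrier := {Φ | IsMulti R Φ}
  add_mem' h h' := h.addFun h'
  zero_mem' := isMulti_zero
  smul_mem' c _ h := h.smulFun c

variable (R V N) in
/-- The operation of `V` on multilinear functions by adding a last entry. -/
def addLast : V →ₗ[R] Module.End R (multi R V N) where
  toFun x :=
    { toFun Φ := ⟨.ofFun fun l => Φ.1 (l ++ [x]),
        ⟨fun a y z b => by simpa using Φ.2.add a y z (b ++ [x]),
          fun a s y b => by simpa using Φ.2.smul a s y (b ++ [x])⟩⟩
      map_add' _ _ := rfl
      map_smul' _ _ := rfl }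
  map_add' x y := LinearMap.ext fun Φ => Subtype.ext (ext_apply fun l => Φ.2.add l x y [])
  map_smul' s x := LinearMap.ext fun Φ => Subtype.ext (ext_apply fun l => Φ.2.smul l s x [])

/-- A multilinear function factors through the tensor algebra. -/
theorem IsMulti.exists_eq_post {Φ : ConvAlg V N} (hΦ : IsMulti R Φ) :
    ∃ φ : TensorAlgebra R V →ₗ[R] N, Φ = ConvAlg.post φ (tens R V) := by
  -- The multilinear functions form a module over the tensor algebra, where a generator adds a last
  -- entry. The linear form sought sends a tensor `u` to the value of `u • Φ` at the empty list.
  let ev : multi R V N →ₗ[R] N :=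
    { toFun Ψ := Ψ.1 []
      map_add' _ _ := rfl
      map_smul' _ _ := rfl }
  let φ : TensorAlgebra R V →ₗ[R] N :=
    ev ∘ₗ LinearMap.applyₗ (⟨Φ, hΦ⟩ : multi R V N) ∘ₗ
      (TensorAlgebra.lift R (addLast R V N)).toLinearMap
  refine ⟨φ, ext_apply fun l => ?_⟩
  -- In `ι x * tens l` the factor `tens l` acts first and puts `l` at the end; then `x` is added
  -- just before `l`. Adding entries at the end is what makes the order come out right.
  have key : ∀ (l : List V) (Ψ : multi R V N) (b : List V),
      (TensorAlgebra.lift R (addLast R V N) (tens R V l) Ψ).1 b = Ψ.1 (b ++ l) := by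
    intro l
    induction l with
    | nil => intro Ψ b; simp [tens]
    | cons x l ih =>
      intro Ψ b
      rw [tens_cons, map_mul, TensorAlgebra.lift_ι_apply]
      show (TensorAlgebra.lift R (addLast R V N) (tens R V l) Ψ).1 (b ++ [x]) = _
      rw [ih]
      simp
  exact (key l ⟨Φ, hΦ⟩ []).symm

/-- For the universal function, concatenation is multiplication in the tensor algebra, so an
insertion is a convolution of three factors: the letters passed, the inserted value and the
remaining letters. -/
theorem ins_tens (t : V → V) (H : ConvAlg V V) :
    ins t H (tens R V) =
      ConvAlg.twist t (tens R V) * (ConvAlg.post (TensorAlgebra.ι R) H * tens R V) := by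
  refine ext_apply fun l => ?_
  simp only [ins, mul_apply, mul_splitSum, tens_append, tens_cons]
  rfl

theorem ins₂_tens (t t' : V → V) (G H : ConvAlg V V) :
    ins₂ t G t' H (tens R V) = ConvAlg.twist t (tens R V) * (ConvAlg.post (TensorAlgebra.ι R) G *
      (ConvAlg.twist t' (tens R V) * (ConvAlg.post (TensorAlgebra.ι R) H * tens R V))) := by
  refine ext_apply fun l => ?_
  simp only [ins₂, ins, mul_apply, mul_splitSum, tens_append, tens_cons]
  rfl

theorem ins_twist_tens (s t : V →ₗ[R] V) (H : ConvAlg V V) :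
    ins t H (ConvAlg.twist s (tens R V)) = ConvAlg.twist (s ∘ₗ t) (tens R V) *
      (ConvAlg.post (TensorAlgebra.ι R) (ConvAlg.post s H) * ConvAlg.twist s (tens R V)) := by
  refine ext_apply fun l => ?_
  simp only [ins, mul_apply, mul_splitSum, twist_apply, List.map_append, List.map_cons,
    tens_append, tens_cons, List.map_map]
  rfl

theorem IsMulti.ins {Φ : ConvAlg V N} (hΦ : IsMulti R Φ) (t : V →ₗ[R] V) {H : ConvAlg V V}
    (hH : IsMulti R H) : IsMulti R (ConvAlg.ins t H Φ) := by
  obtain ⟨φ, rfl⟩ := hΦ.exists_eq_post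
  rw [post_ins, ins_tens]
  exact ((isMulti_tens.twist t).mul ((hH.post _).mul isMulti_tens)).post φ

theorem IsMulti.ins₂ {Φ : ConvAlg V N} (hΦ : IsMulti R Φ) (t t' : V →ₗ[R] V) {G H : ConvAlg V V}
    (hG : IsMulti R G) (hH : IsMulti R H) : IsMulti R (ConvAlg.ins₂ t G t' H Φ) := by
  obtain ⟨φ, rfl⟩ := hΦ.exists_eq_post
  rw [post_ins₂, ins₂_tens]
  exact ((isMulti_tens.twist t).mul ((hG.post _).mul ((isMulti_tens.twist t').mul
    ((hH.post _).mul isMulti_tens)))).post φ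

/-- Insertion into a multilinear function is additive in the inserted function. -/
theorem IsMulti.ins_add {Φ : ConvAlg V N} (hΦ : IsMulti R Φ) (t : V → V) (H H' : ConvAlg V V) :
    ConvAlg.ins t (H + H') Φ = ConvAlg.ins t H Φ + ConvAlg.ins t H' Φ := by
  obtain ⟨φ, rfl⟩ := hΦ.exists_eq_post
  simp only [post_ins, ins_tens, post_add, add_mul, mul_add]

theorem IsMulti.ins_smul {Φ : ConvAlg V N} (hΦ : IsMulti R Φ) (t : V → V) (s : R)
    (H : ConvAlg V V) : ConvAlg.ins t (s • H : ConvAlg V V) Φ = s • ConvAlg.ins t H Φ := by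
  obtain ⟨φ, rfl⟩ := hΦ.exists_eq_post
  simp only [post_ins, ins_tens, post_smul, smul_mul_assoc, mul_smul_comm]

theorem IsMulti.ins_sub {Φ : ConvAlg V N} (hΦ : IsMulti R Φ) (t : V → V) (H H' : ConvAlg V V) :
    ConvAlg.ins t (H - H') Φ = ConvAlg.ins t H Φ - ConvAlg.ins t H' Φ := by
  obtain ⟨φ, rfl⟩ := hΦ.exists_eq_post
  simp only [post_ins, ins_tens, post_sub, sub_mul, mul_sub]

end ConvAlg
end

noncomputable section

/-! ### The brace operations on multilinear functions -/

open ConvAlg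

/-- A differential algebra `V` with sign operators `τ k`, which on an element of degree `i` of a
graded algebra are given by `(-1)^{k (i - 1)}`. -/
structure SignedDGA (R V : Type*) [CommRing R] [Ring V] [Algebra R V] where
  τ : ℤ → V →ₗ[R] V
  τ_τ : ∀ k l x, τ k (τ l x) = τ (k + l) x
  τ_mul : ∀ k x y, τ k (x * y) = sgn R k • (τ k x * τ k y)
  τ_one : ∀ k, τ k 1 = sgn R k • 1
  d : V →ₗ[R] V
  d_d : ∀ x, d (d x) = 0
  d_mul : ∀ x y, d (x * y) = d x * y - τ 1 x * d y
  d_τ : ∀ k x, d (τ k x) = sgn R k • τ k (d x)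

namespace SignedDGA

variable {R V : Type*} [CommRing R] [Ring V] [Algebra R V] (S : SignedDGA R V)

/-- The function `F` has degree `f + 1`. -/
def HasDeg (f : ℤ) (F : ConvAlg V V) : Prop :=
  ∀ k, twist (S.τ k) F = sgn R (k * f) • post (S.τ k) F

/-- The cup product of `F` and a function `G` of degree `q`. -/
def cup (q : ℤ) (F G : ConvAlg V V) : ConvAlg V V := twist (S.τ q) F * G

/-- The insertion of a function `G` of degree `g + 1` into `F`. -/
def circ (g : ℤ) (F G : ConvAlg V V) : ConvAlg V V := ins (S.τ g) G F

/-- The insertion of functions `G` and `H` of degrees `g + 1` and `h + 1` into `F`. -/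
def brace (g h : ℤ) (F G H : ConvAlg V V) : ConvAlg V V :=
  ins₂ (S.τ (g + h)) (twist (S.τ h) G) (S.τ h) H F

variable (V) in
/-- The projection to the lists of length one. -/
def proj : ConvAlg V V := .ofFun fun l => match l with
  | [x] => x
  | _ => 0

/-- The structure maps of the algebra, `[a] ↦ d a` and `[a|b] ↦ (-1)^{|a|} a b`. -/
def str : ConvAlg V V := post S.d (proj V) - S.cup 1 (proj V) (proj V)

/-- The Hochschild differential of a function `F` of degree `f + 1`. -/
def D (f : ℤ) (F : ConvAlg V V) : ConvAlg V V :=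
  post S.d F - S.cup (f + 1) (proj V) F +
    sgn R (f + 1) • (S.cup 1 F (proj V) + S.circ 1 F S.str)

/-- The Gerstenhaber bracket. -/
def br (f g : ℤ) (F G : ConvAlg V V) : ConvAlg V V :=
  S.circ g F G - sgn R (f * g) • S.circ f G F

variable {S}

theorem twist_τ_τ {N : Type*} [AddCommGroup N] (k l : ℤ) (F : ConvAlg V N) :
    twist (S.τ k) (twist (S.τ l) F) = twist (S.τ (k + l)) F := by
  refine ext_apply fun w => ?_
  simp only [ConvAlg.twist_apply, List.map_map]
  congr 2
  funext x
  simp [S.τ_τ, add_comm]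

theorem HasDeg.post_τ {f : ℤ} {F : ConvAlg V V} (hF : S.HasDeg f F) (k : ℤ) :
    post (S.τ k) F = sgn R (k * f) • twist (S.τ k) F := by
  rw [hF, smul_smul, sgn_mul_self, one_smul]

theorem HasDeg.τ_apply {f : ℤ} {F : ConvAlg V V} (hF : S.HasDeg f F) (k : ℤ) (l : List V) :
    S.τ k (F l) = sgn R (k * f) • F (l.map (S.τ k)) :=
  congrArg (fun Φ : ConvAlg V V => Φ l) (hF.post_τ k)

theorem τ_comm (k l : ℤ) (x : V) : S.τ k (S.τ l x) = S.τ l (S.τ k x) := by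
  rw [S.τ_τ, S.τ_τ, add_comm]

theorem map_τ_comm (k l : ℤ) (a : List V) :
    (a.map (S.τ k)).map (S.τ l) = (a.map (S.τ l)).map (S.τ k) := by
  simp only [List.map_map]
  exact List.map_congr_left fun x _ => τ_comm _ _ _

/-- Moving `τ k` across the inserted value costs the Koszul sign of its suspended degree `h`. -/
theorem ins_twist {N : Type*} [AddCommGroup N] [Module R N] {h : ℤ} {F : ConvAlg V N}
    {H : ConvAlg V V} (hF : IsMulti R F) (hH : S.HasDeg h H) (k g : ℤ) :
    ins (S.τ g) H (twist (S.τ k) F) = sgn R (k * h) • twist (S.τ k) (ins (S.τ g) H F) := by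
  refine ext_apply fun l => ?_
  simp only [ConvAlg.smul_apply, ConvAlg.twist_apply, ins, splitSum_map, ← splitSum_smul]
  refine splitSum_congr fun a r _ => splitSum_congr fun b c _ => ?_
  rw [List.map_append, List.map_cons, hH.τ_apply, hF.smul, map_τ_comm]

/-- The middle term of `ins₂_mul` is an ordinary insertion of `G` in which all letters are twisted
by `τ h`, as the second inserted function passes all of them. -/
theorem insTwist_eq {N : Type*} [AddCommGroup N] (Φ : ConvAlg V N) (G : ConvAlg V V) (g h : ℤ) :
    insTwist (S.τ (g + h)) (twist (S.τ h) G) (S.τ h) Φ = twist (S.τ h) (ins (S.τ g) G Φ) := by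
  refine ext_apply fun l => ?_
  simp only [ConvAlg.twist_apply, insTwist, ins, splitSum_map]
  refine splitSum_congr fun a r _ => splitSum_congr fun b c _ => ?_
  rw [List.map_map]
  congr 3
  funext x
  exact (S.τ_τ _ _ _).symm

theorem ins₂_twist {g h : ℤ} {F G H : ConvAlg V V} (hF : IsMulti R F) (hG : S.HasDeg g G)
    (hH : S.HasDeg h H) (k : ℤ) :
    S.brace g h (twist (S.τ k) F) G H = sgn R (k * (g + h)) • twist (S.τ k) (S.brace g h F G H) := by
  refine ext_apply fun l => ?_
  simp only [brace, ConvAlg.smul_apply, ConvAlg.twist_apply, ins₂, ins, splitSum_map,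
    ← splitSum_smul]
  refine splitSum_congr fun a r _ => splitSum_congr fun b r' _ => splitSum_congr fun c s _ =>
    splitSum_congr fun d e _ => ?_
  simp only [List.map_append, List.map_cons]
  rw [hG.τ_apply, hF.smul, hH.τ_apply]
  have := hF.smul (List.map (⇑(S.τ k)) (List.map (⇑(S.τ (g + h))) a) ++
    G (List.map (⇑(S.τ k)) (List.map (⇑(S.τ h)) b)) :: List.map (⇑(S.τ k)) (List.map (⇑(S.τ h)) c))
    (sgn R (k * h)) (H (List.map (⇑(S.τ k)) d)) (List.map (⇑(S.τ k)) e)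
  simp only [List.append_assoc, List.cons_append] at this
  rw [this, smul_smul, mul_add, sgn_add, map_τ_comm k, map_τ_comm k, map_τ_comm k]

/-! #### Degrees -/

theorem HasDeg.addFun {f : ℤ} {F G : ConvAlg V V} (hF : S.HasDeg f F) (hG : S.HasDeg f G) :
    S.HasDeg f (F + G) := fun k => by
  rw [twist_add, hF, hG, post_add, smul_add]

theorem HasDeg.smulFun {f : ℤ} {F : ConvAlg V V} (hF : S.HasDeg f F) (s : R) :
    S.HasDeg f (s • F) := fun k => by
  rw [twist_smul, hF, post_smul, smul_comm]

theorem HasDeg.subFun {f : ℤ} {F G : ConvAlg V V} (hF : S.HasDeg f F) (hG : S.HasDeg f G) :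
    S.HasDeg f (F - G) := by
  have : F - G = F + (-1 : R) • G := by simp [sub_eq_add_neg]
  rw [this]
  exact hF.addFun (hG.smulFun _)

theorem HasDeg.cup {f g : ℤ} {F G : ConvAlg V V} (hF : S.HasDeg f F) (hG : S.HasDeg g G) (q : ℤ) :
    S.HasDeg (f + g + 1) (S.cup q F G) := fun k => by
  have h : post (S.τ k) (S.cup q F G) =
      sgn R k • (post (S.τ k) (twist (S.τ q) F) * post (S.τ k) G) := by
    refine ext_apply fun l => ?_
    simp only [SignedDGA.cup, post_apply, ConvAlg.smul_apply, ConvAlg.mul_apply, map_splitSum,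
      S.τ_mul, splitSum_smul]
  rw [h, SignedDGA.cup, twist_mul, hG, twist_τ_τ, add_comm k, ← twist_τ_τ, hF, twist_smul,
    twist_post, smul_mul_assoc, mul_smul_comm, smul_smul, smul_smul, mul_add, mul_add, sgn_add,
    sgn_add, mul_one, mul_assoc _ (sgn R k), sgn_mul_self, mul_one]

theorem HasDeg.circ {f g : ℤ} {F G : ConvAlg V V} (hm : IsMulti R F) (hF : S.HasDeg f F)
    (hG : S.HasDeg g G) : S.HasDeg (f + g) (S.circ g F G) := fun k => by
  -- The twisted function `twist (τ k) F` equals `post (τ k) F` up to sign; inserting `G` into both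
  -- expressions and comparing gives the degree of `F ∘ G`.
  have h := ins_twist hm hG k g
  rw [hF, ins_smul, post_ins] at h
  replace h := congrArg (sgn R (k * g) • ·) h
  simp only [smul_smul, sgn_mul_self, one_smul] at h
  rw [SignedDGA.circ, ← h, mul_add, sgn_add, mul_comm]

theorem HasDeg.brace {f g h : ℤ} {F G H : ConvAlg V V} (hm : IsMulti R F) (hF : S.HasDeg f F)
    (hG : S.HasDeg g G) (hH : S.HasDeg h H) : S.HasDeg (f + (g + h)) (S.brace g h F G H) :=
  fun k => by
  have e := ins₂_twist hm hG hH k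
  rw [hF, SignedDGA.brace, ins₂_smul, post_ins₂] at e
  replace e := congrArg (sgn R (k * (g + h)) • ·) e
  simp only [smul_smul, sgn_mul_self, one_smul] at e
  rw [← e, mul_add k f, sgn_add, mul_comm]
  rfl

theorem HasDeg.post_d {f : ℤ} {F : ConvAlg V V} (hF : S.HasDeg f F) :
    S.HasDeg (f + 1) (post S.d F) := fun k => by
  rw [twist_post, hF, post_smul, mul_add, sgn_add, mul_one, ← smul_smul]
  congr 1
  exact ext_apply fun l => S.d_τ k _

theorem hasDeg_proj : S.HasDeg 0 (proj V) := fun k => by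
  refine ext_apply fun l => ?_
  rw [mul_zero, show sgn R 0 = 1 by simp [sgn], one_smul]
  match l with
  | [] => exact (map_zero _).symm
  | [x] => rfl
  | x :: y :: l => exact (map_zero _).symm

theorem isMulti_proj : IsMulti R (proj V) where
  add a x y b := by
    match a, b with
    | [], [] => rfl
    | [], z :: b => exact (add_zero _).symm
    | [_], b => exact (add_zero _).symm
    | _ :: _ :: _, b => exact (add_zero _).symm
  smul a s x b := by
    match a, b with
    | [], [] => rfl
    | [], z :: b => exact (smul_zero _).symm
    | [_], b => exact (smul_zero _).symm
    | _ :: _ :: _, b => exact (smul_zero _).symm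

variable (S) in
/-- Multilinear functions of degree `f + 1`. -/
structure IsCochain (f : ℤ) (F : ConvAlg V V) : Prop where
  multi : IsMulti R F
  deg : S.HasDeg f F

namespace IsCochain

variable {f g h : ℤ} {F G H : ConvAlg V V}

theorem addFun (hF : S.IsCochain f F) (hG : S.IsCochain f G) : S.IsCochain f (F + G) :=
  ⟨hF.1.addFun hG.1, hF.2.addFun hG.2⟩

theorem subFun (hF : S.IsCochain f F) (hG : S.IsCochain f G) : S.IsCochain f (F - G) :=
  ⟨hF.1.subFun hG.1, hF.2.subFun hG.2⟩

theorem smulFun (hF : S.IsCochain f F) (s : R) : S.IsCochain f (s • F) :=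
  ⟨hF.1.smulFun s, hF.2.smulFun s⟩

theorem cup (hF : S.IsCochain f F) (hG : S.IsCochain g G) (q : ℤ) :
    S.IsCochain (f + g + 1) (S.cup q F G) := ⟨(hF.1.twist _).mul hG.1, hF.2.cup hG.2 q⟩

theorem circ (hF : S.IsCochain f F) (hG : S.IsCochain g G) :
    S.IsCochain (f + g) (S.circ g F G) := ⟨hF.1.ins _ hG.1, hF.2.circ hF.1 hG.2⟩

theorem brace (hF : S.IsCochain f F) (hG : S.IsCochain g G) (hH : S.IsCochain h H) :
    S.IsCochain (f + (g + h)) (S.brace g h F G H) :=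
  ⟨hF.1.ins₂ _ _ (hG.1.twist _) hH.1, hF.2.brace hF.1 hG.2 hH.2⟩

theorem post_d (hF : S.IsCochain f F) : S.IsCochain (f + 1) (post S.d F) :=
  ⟨hF.1.post _, hF.2.post_d⟩

end IsCochain

theorem isCochain_proj : S.IsCochain 0 (proj V) := ⟨isMulti_proj, hasDeg_proj⟩

theorem isCochain_str : S.IsCochain 1 S.str :=
  isCochain_proj.post_d.subFun (isCochain_proj.cup isCochain_proj 1)

theorem IsCochain.D {f : ℤ} {F : ConvAlg V V} (hF : S.IsCochain f F) :
    S.IsCochain (f + 1) (S.D f F) := by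
  have h₁ : S.IsCochain (f + 1) (S.cup (f + 1) (proj V) F) := by
    simpa using isCochain_proj.cup hF (f + 1)
  have h₂ : S.IsCochain (f + 1) (S.cup 1 F (proj V)) := by
    simpa using hF.cup isCochain_proj 1
  exact (hF.post_d.subFun h₁).addFun ((h₂.addFun (hF.circ isCochain_str)).smulFun _)

end SignedDGA
end

noncomputable section
open ConvAlg

namespace SignedDGA

variable {R V : Type*} [CommRing R] [Ring V] [Algebra R V] {S : SignedDGA R V}
variable {f g h : ℤ} {F G H : ConvAlg V V}

/-! #### Linearity -/

theorem cup_add (q : ℤ) (F G G' : ConvAlg V V) :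
    S.cup q F (G + G') = S.cup q F G + S.cup q F G' := mul_add _ _ _

theorem add_cup (q : ℤ) (F F' G : ConvAlg V V) :
    S.cup q (F + F') G = S.cup q F G + S.cup q F' G := add_mul (twist _ F) (twist _ F') _

theorem cup_sub (q : ℤ) (F G G' : ConvAlg V V) :
    S.cup q F (G - G') = S.cup q F G - S.cup q F G' := mul_sub _ _ _

theorem sub_cup (q : ℤ) (F F' G : ConvAlg V V) :
    S.cup q (F - F') G = S.cup q F G - S.cup q F' G := sub_mul (twist _ F) (twist _ F') _

theorem cup_smul (q : ℤ) (s : R) (F G : ConvAlg V V) :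
    S.cup q F (s • G) = s • S.cup q F G := mul_smul_comm _ _ _

theorem smul_cup (q : ℤ) (s : R) (F G : ConvAlg V V) :
    S.cup q (s • F) G = s • S.cup q F G := smul_mul_assoc s (twist _ F) _

theorem cup_zero (q : ℤ) (F : ConvAlg V V) : S.cup q F 0 = 0 := mul_zero _

theorem zero_cup (q : ℤ) (F : ConvAlg V V) : S.cup q 0 F = 0 := zero_mul F

theorem add_circ (g : ℤ) (F F' G : ConvAlg V V) :
    S.circ g (F + F') G = S.circ g F G + S.circ g F' G := ins_add _ _ _ _

theorem smul_circ (g : ℤ) (s : R) (F G : ConvAlg V V) :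
    S.circ g (s • F) G = s • S.circ g F G := ins_smul _ _ _ _

theorem sub_circ (g : ℤ) (F F' G : ConvAlg V V) :
    S.circ g (F - F') G = S.circ g F G - S.circ g F' G := by
  have : F - F' = F + (-1 : R) • F' := by simp [sub_eq_add_neg]
  rw [this, add_circ, smul_circ]; simp [sub_eq_add_neg]

theorem zero_circ (g : ℤ) (G : ConvAlg V V) : S.circ g 0 G = 0 := ins_zero _ _

theorem circ_add (hF : IsMulti R F) (g : ℤ) (G G' : ConvAlg V V) :
    S.circ g F (G + G') = S.circ g F G + S.circ g F G' := hF.ins_add _ _ _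

theorem circ_sub (hF : IsMulti R F) (g : ℤ) (G G' : ConvAlg V V) :
    S.circ g F (G - G') = S.circ g F G - S.circ g F G' := hF.ins_sub _ _ _

theorem circ_smul (hF : IsMulti R F) (g : ℤ) (s : R) (G : ConvAlg V V) :
    S.circ g F (s • G) = s • S.circ g F G := hF.ins_smul _ _ _

theorem circ_zero (hF : IsMulti R F) (g : ℤ) : S.circ g F 0 = 0 := by
  simpa using S.circ_smul hF g 0 0

theorem add_brace (g h : ℤ) (F F' G H : ConvAlg V V) :
    S.brace g h (F + F') G H = S.brace g h F G H + S.brace g h F' G H := ins₂_add _ _ _ _ _ _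

theorem smul_brace (g h : ℤ) (s : R) (F G H : ConvAlg V V) :
    S.brace g h (s • F) G H = s • S.brace g h F G H := ins₂_smul _ _ _ _ _ _

theorem sub_brace (g h : ℤ) (F F' G H : ConvAlg V V) :
    S.brace g h (F - F') G H = S.brace g h F G H - S.brace g h F' G H := by
  have : F - F' = F + (-1 : R) • F' := by simp [sub_eq_add_neg]
  rw [this, add_brace, smul_brace]; simp [sub_eq_add_neg]

theorem zero_brace (g h : ℤ) (G H : ConvAlg V V) : S.brace g h 0 G H = 0 := ins₂_zero _ _ _ _

theorem brace_smul_left (hF : IsMulti R F) (g h : ℤ) (s : R) (G H : ConvAlg V V) :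
    S.brace g h F (s • G) H = s • S.brace g h F G H := by
  obtain ⟨φ, rfl⟩ := hF.exists_eq_post
  simp only [brace, post_ins₂, ins₂_tens, twist_smul, post_smul, smul_mul_assoc, mul_smul_comm]

theorem brace_smul_right (hF : IsMulti R F) (g h : ℤ) (s : R) (G H : ConvAlg V V) :
    S.brace g h F G (s • H) = s • S.brace g h F G H := by
  obtain ⟨φ, rfl⟩ := hF.exists_eq_post
  simp only [brace, post_ins₂, ins₂_tens, post_smul, smul_mul_assoc, mul_smul_comm]

/-! #### The cup product and insertions -/

theorem cup_assoc (q q' : ℤ) (F G H : ConvAlg V V) :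
    S.cup q' (S.cup q F G) H = S.cup (q' + q) F (S.cup q' G H) := by
  rw [cup, cup, twist_mul, twist_τ_τ, mul_assoc]; rfl

theorem post_d_cup (hF : S.HasDeg f F) (q : ℤ) (G : ConvAlg V V) :
    post S.d (S.cup q F G) =
      S.cup q (post S.d F) G + sgn R (f + 1) • S.cup (q + 1) F (post S.d G) := by
  have h₁ : post S.d (S.cup q F G) =
      post S.d (twist (S.τ q) F) * G - post (S.τ 1) (twist (S.τ q) F) * post S.d G := by
    refine ext_apply fun l => ?_
    have e : ∀ Θ Θ' : List V → List V → V,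
        splitSum (fun b c => Θ b c - Θ' b c) l = splitSum Θ l - splitSum Θ' l := fun Θ Θ' => by
      rw [eq_sub_iff_add_eq, ← splitSum_add]
      simp
    simp only [cup, post_apply, ConvAlg.mul_apply, ConvAlg.sub_apply, map_splitSum, S.d_mul, e]
  rw [h₁, ← twist_post _ (S.τ 1), hF.post_τ, twist_smul, twist_τ_τ, smul_mul_assoc, one_mul,
    sgn_add, show sgn R 1 = -1 by simp [sgn], mul_neg_one, neg_smul, ← sub_eq_add_neg]
  rfl

/-- Insertion is a derivation of convolution. The sign in the first term comes from the twist by `τ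
q` of the first factor, and in the second term the inserted `H` passes the first factor, which
raises its twist to `q + h`. -/
theorem cup_circ (hF : IsMulti R F) (hH : S.HasDeg h H) (q : ℤ) :
    S.circ h (S.cup q F G) H = sgn R (q * h) • S.cup q (S.circ h F H) G +
      S.cup (q + h) F (S.circ h G H) := by
  rw [circ, cup, ins_mul, ins_twist hF hH, twist_τ_τ, smul_mul_assoc, add_comm h q]
  rfl

/-- The product rule for double insertions: both functions go into the first factor, one into each,
or both into the second. -/
theorem cup_brace (hF : IsMulti R F) (hG : S.HasDeg g G) (hH : S.HasDeg h H) (q : ℤ)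
    (K : ConvAlg V V) :
    S.brace g h (S.cup q F K) G H = sgn R (q * (g + h)) • S.cup q (S.brace g h F G H) K +
      sgn R (q * g) • S.cup (q + h) (S.circ g F G) (S.circ h K H) +
      S.cup (q + (g + h)) F (S.brace g h K G H) := by
  have e := ins₂_twist hF hG hH q
  rw [brace] at e
  rw [brace, cup, ins₂_mul, e, insTwist_eq, ins_twist hF hG, twist_smul, twist_τ_τ, twist_τ_τ,
    smul_mul_assoc, smul_mul_assoc, add_comm h q, add_comm (g + h) q]
  rfl

theorem post_d_circ (g : ℤ) (F G : ConvAlg V V) :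
    S.circ g (post S.d F) G = post S.d (S.circ g F G) := post_ins _ _ _ _

theorem post_d_brace (g h : ℤ) (F G H : ConvAlg V V) :
    S.brace g h (post S.d F) G H = post S.d (S.brace g h F G H) := post_ins₂ _ _ _ _ _ _

theorem proj_cons_append_cons (a b : List V) (x y : V) : proj V (x :: a ++ y :: b) = 0 := by
  match a with
  | [] => rfl
  | _ :: _ => rfl

theorem proj_circ (g : ℤ) (G : ConvAlg V V) : S.circ g (proj V) G = G := by
  refine ext_apply fun l => ?_
  simp only [circ, ins]
  rw [splitSum_eq_nil_left, splitSum_eq_nil_right]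
  · rfl
  · intro x b c; rfl
  · intro x b c
    exact splitSum_eq_zero fun b' c' _ => proj_cons_append_cons _ _ _ _

theorem proj_brace (g h : ℤ) (G H : ConvAlg V V) : S.brace g h (proj V) G H = 0 := by
  refine ext_apply fun l => ?_
  simp only [brace, ins₂, ins]
  refine splitSum_eq_zero fun a r _ => splitSum_eq_zero fun b r' _ => splitSum_eq_zero fun c s _ =>
    splitSum_eq_zero fun d e _ => ?_
  match a, c with
  | [], [] => rfl
  | [], _ :: _ => rfl
  | [_], _ => rfl
  | _ :: _ :: _, _ => rfl

/-- Inserting `F` into `str` either differentiates `F` or multiplies it by a letter on the right or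
on the left: the terms of `D` which do not change the arguments of `F` by `str`. -/
theorem cup_proj_eq (hF : S.HasDeg f F) :
    S.circ f S.str F =
      post S.d F - sgn R f • S.cup 1 F (proj V) - S.cup (f + 1) (proj V) F := by
  rw [str, sub_circ, post_d_circ, proj_circ, cup_circ isMulti_proj hF, proj_circ,
    one_mul, add_comm 1 f, sub_sub]

/-- Only the binary part of `str` has room for two insertions, so the cup product is a brace with
`str`. -/
theorem str_brace (hG : S.HasDeg g G) (hH : S.HasDeg h H) :
    S.brace g h S.str G H = -(sgn R g • S.cup (h + 1) G H) := by
  rw [str, sub_brace, post_d_brace, proj_brace, cup_brace isMulti_proj hG hH, proj_brace,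
    proj_circ, proj_circ, zero_cup, cup_zero, smul_zero, zero_add, add_zero, one_mul,
    add_comm 1 h]
  have : post S.d (0 : ConvAlg V V) = 0 := ext_apply fun _ => map_zero _
  rw [this, zero_sub]

/-- The differential is the bracket with the structure maps. -/
theorem D_eq_br (hF : S.HasDeg f F) : S.D f F = S.circ f S.str F - sgn R f • S.circ 1 F S.str := by
  rw [cup_proj_eq hF, D, sgn_add, show sgn R 1 = -1 by simp [sgn]]
  module

/-- The Maurer–Cartan equation of the algebra: the unary part vanishes by d² = 0, the binary part by
the Leibniz rule and the ternary part by associativity. -/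
theorem str_circ_str : S.circ 1 S.str S.str = 0 := by
  have hdd : post S.d (post S.d (proj V)) = 0 := ext_apply fun _ => S.d_d _
  have h0 : post S.d S.str = S.cup (1 + 1) (proj V) (post S.d (proj V)) -
      S.cup 1 (post S.d (proj V)) (proj V) := by
    rw [str, post_sub, hdd, post_d_cup hasDeg_proj, zero_add, show sgn R 1 = -1 by simp [sgn]]
    module
  rw [cup_proj_eq isCochain_str.2, h0, show sgn R 1 = -1 by simp [sgn]]
  have h1 : S.cup 1 S.str (proj V) = S.cup 1 (post S.d (proj V)) (proj V) -
      S.cup (1 + 1) (proj V) (S.cup 1 (proj V) (proj V)) := by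
    conv_lhs => rw [str, sub_cup, cup_assoc]
  have h2 : S.cup (1 + 1) (proj V) S.str = S.cup (1 + 1) (proj V) (post S.d (proj V)) -
      S.cup (1 + 1) (proj V) (S.cup 1 (proj V) (proj V)) := by
    conv_lhs => rw [str, cup_sub]
  rw [h1, h2]
  module

/-! #### The pre-Lie identity -/

/-- Insertion satisfies the pre-Lie identity. -/
theorem circ_circ (hF : IsMulti R F) (hH : S.HasDeg h H) (g : ℤ) (G : ConvAlg V V) :
    S.circ h (S.circ g F G) H = S.circ (g + h) F (S.circ h G H) + S.brace g h F G H +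
      sgn R (g * h) • S.brace h g F H G := by
  obtain ⟨φ, rfl⟩ := hF.exists_eq_post
  have hτ : S.τ g ∘ₗ S.τ h = S.τ (g + h) := LinearMap.ext fun x => S.τ_τ _ _ _
  -- For the universal function, inserting `H` into a product of three factors gives three terms:
  -- `H` before `G`, inside `G`, or after `G`.
  simp only [circ, brace, post_ins, post_ins₂, ins_tens, ins₂_tens, ins_mul, ins_twist_tens, hτ,
    hH.post_τ, twist_τ_τ, post_smul, twist_post]
  rw [add_comm h g]
  simp only [mul_add, mul_assoc, smul_mul_assoc, mul_smul_comm, post_add, post_smul]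
  abel

/-- The graded Jacobi identity. -/
theorem br_br (hF : S.IsCochain f F) (hG : S.IsCochain g G) (hH : S.IsCochain h H) :
    S.br (f + g) h (S.br f g F G) H = S.br f (g + h) F (S.br g h G H) -
      sgn R (f * g) • S.br g (f + h) G (S.br f h F H) := by
  simp only [br, sub_circ, smul_circ, circ_sub hF.1, circ_sub hG.1, circ_sub hH.1,
    circ_smul hF.1, circ_smul hG.1, circ_smul hH.1]
  rw [circ_circ hF.1 hH.2 g G, circ_circ hG.1 hH.2 f F, circ_circ hG.1 hF.2 h H,
    circ_circ hH.1 hF.2 g G, circ_circ hF.1 hG.2 h H, circ_circ hH.1 hG.2 f F]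
  rw [add_comm h g, add_comm h f, add_comm g f]
  -- All brace terms from the pre-Lie identity occur in cancelling pairs. The signs depend only on
  -- the parities of the degrees, and in each case the identity is linear in the remaining terms.
  simp only [sgn_eq_ite, Int.even_add, Int.even_mul]
  by_cases e₁ : Even f <;> by_cases e₂ : Even g <;> by_cases e₃ : Even h <;>
    simp only [e₁, e₂, e₃, or_true, or_false,
    if_true, if_false, iff_true, iff_false, not_true] <;> module

/-- Three instances of the pre-Lie identity suffice: for (m ∘ m) ∘ F and (F ∘ m) ∘ m the composite m
∘ m vanishes, and in the latter the two braces F{m,m} cancel because m is odd. Nothing is divided by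
2. -/
theorem D_D (hF : S.IsCochain f F) : S.D (f + 1) (S.D f F) = 0 := by
  have hm := S.isCochain_str
  rw [D_eq_br hF.D.2, D_eq_br hF.2]
  simp only [sub_circ, smul_circ, circ_sub hm.1, circ_smul hm.1]
  have e₁ := circ_circ hm.1 hF.2 1 S.str
  have e₂ := circ_circ hm.1 hm.2 f F
  have e₃ := circ_circ hF.1 hm.2 1 S.str
  rw [str_circ_str, zero_circ, add_comm 1 f] at e₁
  rw [str_circ_str, circ_zero hF.1, show sgn R (1 * 1) = -1 by simp [sgn], zero_add, neg_smul,
    one_smul, add_neg_cancel] at e₃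
  rw [e₂, e₃, eq_neg_of_add_eq_zero_left ((add_assoc _ _ _).symm.trans e₁.symm)]
  simp only [sgn_eq_ite, Int.even_add, Int.even_mul, Int.not_even_one]
  by_cases e₁ : Even f <;>
    simp only [e₁, or_true, or_false, if_true, if_false, iff_false, not_true] <;> module


/-! #### The differential of cup products, insertions and braces -/

/-- Each of the maps composing `D` is a derivation or a multiplication; the two terms in which a
letter is multiplied between `F` and `G` cancel. -/
theorem D_cup (hF : S.IsCochain f F) (g : ℤ) (G : ConvAlg V V) :
    S.D (f + g + 1) (S.cup (g + 1) F G) = S.cup (g + 1) (S.D f F) G +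
      sgn R (f + 1) • S.cup (g + 1 + 1) F (S.D g G) := by
  have e₁ : g + 1 + (f + 1) = f + g + 1 + 1 := by ring
  have e₂ : (1 : ℤ) + (g + 1) = g + 1 + 1 := by ring
  simp only [D, post_d_cup hF.2, cup_circ hF.1 isCochain_str.2, add_cup, cup_add, sub_cup,
    cup_sub, smul_cup, cup_smul, cup_assoc, e₁, e₂]
  rw [add_comm (g + 1) (1 : ℤ)]
  simp only [sgn_eq_ite, Int.even_add, Int.even_mul, Int.not_even_one]
  by_cases h₁ : Even f <;> by_cases h₂ : Even g <;> simp only [h₁, h₂, or_false,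
    if_true, if_false, iff_true, iff_false, not_true] <;> module

/-- The braces of `F` with `G` and `str` cancel between the pre-Lie expansions of (F ∘ G) ∘ m and (F
∘ m) ∘ G. The defect from a derivation consists of the two cup products, which arise when `G`
replaces the outer letter multiplied with `F`. This is the homotopy for commutativity. -/
theorem D_circ (hF : S.IsCochain f F) (hG : S.IsCochain g G) :
    S.D (f + g) (S.circ g F G) = S.circ g (S.D f F) G + sgn R f • S.circ (g + 1) F (S.D g G) +
      sgn R ((f + 1) * g) • S.cup (f + 1) G F + sgn R f • S.cup (g + 1) F G := by
  have e₁ : f + 1 + g = f + g + 1 := by ring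
  rw [D_eq_br hG.2]
  simp only [D, add_circ, sub_circ, smul_circ, post_d_circ, cup_circ isMulti_proj hG.2,
    cup_circ hF.1 hG.2, proj_circ, circ_sub hF.1, circ_smul hF.1,
    circ_circ hF.1 hG.2 1 S.str, circ_circ hF.1 isCochain_str.2 g G, e₁]
  rw [add_comm (1 : ℤ) g]
  simp only [sgn_eq_ite, Int.even_add, Int.even_mul, Int.not_even_one]
  by_cases h₁ : Even f <;> by_cases h₂ : Even g <;> simp only [h₁, h₂, or_true, or_false,
    if_true, if_false, iff_true, iff_false, not_true] <;> module

theorem D_sub (f : ℤ) (F F' : ConvAlg V V) : S.D f (F - F') = S.D f F - S.D f F' := by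
  simp only [D, post_sub, cup_sub, sub_cup, sub_circ]; module

theorem D_smul (f : ℤ) (s : R) (F : ConvAlg V V) : S.D f (s • F) = s • S.D f F := by
  simp only [D, post_smul, cup_smul, smul_cup, smul_circ]; module

/-- The cup product defects of F ∘ G and of G ∘ F cancel in the bracket. -/
theorem D_br (hF : S.IsCochain f F) (hG : S.IsCochain g G) :
    S.D (f + g) (S.br f g F G) =
      S.br (f + 1) g (S.D f F) G + sgn R f • S.br f (g + 1) F (S.D g G) := by
  have h := D_circ hG hF
  rw [add_comm g f] at h
  simp only [br, D_sub, D_smul, D_circ hF hG, h]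
  simp only [sgn_eq_ite, Int.even_add, Int.even_mul, Int.not_even_one]
  by_cases h₁ : Even f <;> by_cases h₂ : Even g <;> simp only [h₁, h₂, or_true, or_false,
    if_true, if_false, iff_false, not_true] <;> module

theorem ins₂_twist_tens (s t t' : V →ₗ[R] V) (G H : ConvAlg V V) :
    ins₂ t G t' H (twist s (tens R V)) = twist (s ∘ₗ t) (tens R V) *
      (post (TensorAlgebra.ι R) (post s G) * (twist (s ∘ₗ t') (tens R V) *
        (post (TensorAlgebra.ι R) (post s H) * twist s (tens R V)))) := by
  refine ext_apply fun l => ?_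
  simp only [ins₂, ins, ConvAlg.mul_apply, mul_splitSum, ConvAlg.twist_apply, List.map_append,
    List.map_cons, tens_append, tens_cons, List.map_map]
  rfl

/-- The compatibility of the braces with insertions. -/
theorem brace_circ (hF : IsMulti R F) (hG : S.IsCochain g G) (hH : S.IsCochain h H) {k : ℤ}
    {K : ConvAlg V V} (hK : S.IsCochain k K) :
    sgn R (k * (g + h)) • S.circ k (S.brace g h F G H) K - S.brace g h (S.circ k F K) G H =
      sgn R (k * (g + h)) • (sgn R (k * h) • S.brace (g + k) h F (S.circ k G K) H +
        S.brace g (h + k) F G (S.circ k H K)) -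
      (sgn R (k * g) • S.brace g (h + k) F G (S.circ h K H) +
        S.brace (g + k) h F (S.circ g K G) H) -
      S.circ (g + h + k) F (S.brace g h K G H) := by
  obtain ⟨φ, rfl⟩ := hF.exists_eq_post
  have hτ : ∀ a b, S.τ a ∘ₗ S.τ b = S.τ (a + b) := fun a b => LinearMap.ext fun x => S.τ_τ _ _ _
  have e₁ : h + (k + g) = g + h + k := by ring
  have e₂ : g + (h + k) = g + h + k := by ring
  have e₃ : g + k + h = g + h + k := by ring
  have e₄ : k + (g + h) = g + h + k := by ring
  simp only [circ, brace, post_ins, post_ins₂, ins_tens, ins₂_tens, ins_mul, ins₂_mul,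
    ins_twist_tens, ins₂_twist_tens, insTwist_eq, hτ, twist_mul, ins_twist (hG.1.post _) hK.2,
    ← twist_post, twist_τ_τ, hG.2.post_τ, hH.2.post_τ, hK.2.post_τ, twist_smul,
    post_smul, post_ins, post_ins₂, e₁, e₂, e₃, e₄]
  -- The terms in which `G`, `H` and `K` occupy separate slots of `F` occur in both braces on the
  -- left and cancel, so no triple brace is needed in the statement.
  rw [add_comm k h]
  simp only [mul_add, add_mul, mul_assoc, smul_mul_assoc, mul_smul_comm, post_add, post_smul]
  simp only [sgn_eq_ite, Int.even_add, Int.even_mul]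
  by_cases h₁ : Even g <;> by_cases h₂ : Even h <;> by_cases h₃ : Even k <;>
    simp only [h₁, h₂, h₃, or_true, or_false, if_true, if_false, iff_true, iff_false,
      not_true] <;> module

/-- The failure of the Leibniz rule for insertions is a coboundary. -/
theorem D_brace (hF : S.IsCochain f F) (hG : S.IsCochain g G) (hH : S.IsCochain h H)
    (hDF : S.D f F = 0) (hDG : S.D g G = 0) (hDH : S.D h H = 0) :
    S.D (f + (g + h)) (S.brace g h F G H) =
      sgn R ((f + 1) * g) • S.cup (f + h + 1) G (S.circ h F H) +
        sgn R (f + g) • (S.cup (h + 1) (S.circ g F G) H -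
          S.circ (g + h + 1) F (S.cup (h + 1) G H)) := by
  have hm := S.isCochain_str
  -- With `K = str`, the term with both `G` and `H` inside `K` is their cup product, inserted into
  -- `F`.
  have e := brace_circ hF.1 hG hH hm
  rw [str_brace hG.2 hH.2, ← neg_one_smul R, smul_smul, circ_smul hF.1] at e
  -- For cocycles, m ∘ G and G ∘ m agree up to sign, and likewise for `H`; the corresponding braces
  -- in `e` then cancel.
  have eG := sub_eq_zero.1 ((D_eq_br hG.2).symm.trans hDG)
  have eH := sub_eq_zero.1 ((D_eq_br hH.2).symm.trans hDH)
  rw [eG, eH, brace_smul_left hF.1, brace_smul_right hF.1] at e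
  -- Expanding `(D F){G,H} = 0` gives the terms of `D (F{G,H})`, together with (F ∘ m){G,H} and with
  -- cup products in which `G` or `H` replaces an outer letter.
  have eF : S.brace g h (S.D f F) G H = 0 := by rw [hDF, zero_brace]
  have e₁ : f + 1 + h = f + h + 1 := by ring
  have e₂ : f + 1 + (g + h) = f + (g + h) + 1 := by ring
  have e₃ : (1 : ℤ) + h = h + 1 := by ring
  simp only [D, add_brace, sub_brace, smul_brace, post_d_brace, cup_brace isMulti_proj hG.2 hH.2,
    cup_brace hF.1 hG.2 hH.2, proj_brace, proj_circ, zero_cup, cup_zero, e₁, e₂, e₃] at eF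
  rw [D]
  simp only [sgn_eq_ite, Int.even_add, Int.even_mul, Int.not_even_one] at e eF ⊢
  by_cases h₁ : Even f <;> by_cases h₂ : Even g <;> by_cases h₃ : Even h <;>
    simp only [h₁, h₂, h₃, or_true, or_false, if_true, if_false, iff_true, iff_false,
      not_true] at e eF ⊢
  -- The relation `e` eliminates (F ∘ m){G,H} from `eF`; the sign with which it is used depends on
  -- the parity of `f`.
  all_goals first
    | linear_combination (norm := module) eF + e
    | linear_combination (norm := module) eF - e

end SignedDGA
end

noncomputable section
open ConvAlg

/-! ### Normalized functions -/

set_option linter.unusedSectionVars false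

namespace ConvAlg

variable {R V N : Type*} [CommRing R] [Ring V] [Algebra R V] [AddCommGroup N] [Module R N]

/-- A function on lists is normalized if it vanishes whenever an entry is `1`. -/
def IsNormalized (Φ : ConvAlg V N) : Prop := ∀ a b, Φ (a ++ 1 :: b) = 0

/-- The function `w ↦ Φ (a ++ w)`. -/
def shift (a : List V) (Φ : ConvAlg V N) : ConvAlg V N := .ofFun fun w => Φ (a ++ w)

theorem shift_apply (a : List V) (Φ : ConvAlg V N) (w : List V) : shift a Φ w = Φ (a ++ w) := rfl

theorem IsMulti.shift {Φ : ConvAlg V N} (hΦ : IsMulti R Φ) (a : List V) :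
    IsMulti R (shift a Φ) where
  add b x y c := by simpa only [shift_apply, List.append_assoc] using hΦ.add (a ++ b) x y c
  smul b s x c := by simpa only [shift_apply, List.append_assoc] using hΦ.smul (a ++ b) s x c

theorem IsNormalized.shift {Φ : ConvAlg V N} (hΦ : IsNormalized Φ) (a : List V) :
    IsNormalized (shift a Φ) := fun b c => by
  simpa only [shift_apply, List.append_assoc] using hΦ (a ++ b) c

theorem IsNormalized.addFun {Φ Ψ : ConvAlg V N} (hΦ : IsNormalized Φ) (hΨ : IsNormalized Ψ) :
    IsNormalized (Φ + Ψ) := fun a b => by rw [add_apply, hΦ, hΨ, add_zero]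

theorem IsNormalized.smulFun {Φ : ConvAlg V N} (hΦ : IsNormalized Φ) (s : R) :
    IsNormalized (s • Φ) := fun a b => by rw [smul_apply, hΦ, smul_zero]

theorem IsNormalized.subFun {Φ Ψ : ConvAlg V N} (hΦ : IsNormalized Φ) (hΨ : IsNormalized Ψ) :
    IsNormalized (Φ - Ψ) := fun a b => by rw [sub_apply, hΦ, hΨ, sub_zero]

/-- Wherever the cut falls, the entry `1` lands in one of the two factors. -/
theorem IsNormalized.mul {Φ Ψ : ConvAlg V V} (hΦ : IsNormalized Φ) (hΨ : IsNormalized Ψ) :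
    IsNormalized (Φ * Ψ) := fun a b => by
  rw [mul_apply, splitSum_append_cons, splitSum_eq_zero, splitSum_eq_zero, add_zero]
  · exact fun b₁ b₂ _ => by rw [hΦ, zero_mul]
  · exact fun a₁ a₂ _ => by rw [hΨ, mul_zero]

end ConvAlg

namespace SignedDGA

variable {R V N : Type*} [CommRing R] [Ring V] [Algebra R V] [AddCommGroup N] [Module R N]
  {S : SignedDGA R V} {f g h : ℤ} {F G H : ConvAlg V V}

theorem isNormalized_twist {Φ : ConvAlg V N} (hm : IsMulti R Φ) (hΦ : IsNormalized Φ) (k : ℤ) :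
    IsNormalized (twist (S.τ k) Φ) := fun a b => by
  rw [ConvAlg.twist_apply, List.map_append, List.map_cons, S.τ_one, hm.smul, hΦ, smul_zero]

theorem isNormalized_ins {Φ : ConvAlg V N} (hm : IsMulti R Φ) (hΦ : IsNormalized Φ)
    (hH : IsNormalized H) (k : ℤ) : IsNormalized (ins (S.τ k) H Φ) := fun a b => by
  simp only [ins]
  -- The entry `1` is passed by the insertion, lies in the inserted block, or comes after it.
  -- Passing it only changes its sign.
  rw [splitSum_append_cons, splitSum_eq_zero, splitSum_eq_zero, add_zero]
  · refine fun b₁ b₂ _ => splitSum_eq_zero fun c d _ => ?_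
    rw [List.map_append, List.map_cons, S.τ_one, List.append_assoc, List.cons_append, hm.smul, hΦ,
      smul_zero]
  · intro a₁ a₂ _
    rw [splitSum_append_cons, splitSum_eq_zero, splitSum_eq_zero, add_zero]
    · exact fun b₁ b₂ _ => by rw [hH, hm.zero_entry]
    · intro a₃ a₄ _
      simpa using hΦ (a₁.map (S.τ k) ++ H a₃ :: a₄) b

theorem isNormalized_cup (hFm : IsMulti R F) (hF : IsNormalized F) (hG : IsNormalized G) (q : ℤ) :
    IsNormalized (S.cup q F G) := (isNormalized_twist hFm hF q).mul hG

theorem isNormalized_brace (hFm : IsMulti R F) (hGm : IsMulti R G) (hF : IsNormalized F)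
    (hG : IsNormalized G) (hH : IsNormalized H) (g h : ℤ) :
    IsNormalized (S.brace g h F G H) := fun a b => by
  have key : ∀ c x, ins (S.τ h) H (.ofFun fun w => F (c ++ x :: w)) =
      ins (S.τ h) H (shift (c ++ [x]) F) := fun c x => by
    congr 2; funext w; simp
  have hins : ∀ c, IsNormalized (ins (S.τ h) H (shift c F)) := fun c =>
    isNormalized_ins (hFm.shift c) (hF.shift c) hH h
  have hG' := isNormalized_twist (S := S) hGm hG h
  simp only [brace, ins₂]
  rw [splitSum_append_cons, splitSum_eq_zero, splitSum_eq_zero, add_zero]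
  · refine fun b₁ b₂ _ => splitSum_eq_zero fun c d _ => splitSum_eq_zero fun c₁ c₂ _ =>
      splitSum_eq_zero fun d₁ d₂ _ => ?_
    dsimp only
    rw [List.map_append, List.map_cons, S.τ_one, List.append_assoc, List.cons_append, hFm.smul, hF,
      smul_zero]
  · intro a₁ a₂ _
    rw [splitSum_append_cons, splitSum_eq_zero, splitSum_eq_zero, add_zero]
    · refine fun b₁ b₂ _ => splitSum_eq_zero fun c₁ c₂ _ => splitSum_eq_zero fun d₁ d₂ _ => ?_
      dsimp only
      rw [hG', hFm.zero_entry]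
    · exact fun a₃ a₄ _ => by rw [key, hins]

/-! #### Explicit formulas -/

theorem str_nil : S.str [] = 0 := by
  show S.d 0 - (0 : V) * 0 = 0
  simp

theorem str_one (x : V) : S.str [x] = S.d x := by
  show S.d x - ((0 : V) * x + S.τ 1 x * 0) = S.d x
  simp

theorem str_two (x y : V) : S.str [x, y] = -(S.τ 1 x * y) := by
  show S.d 0 - ((0 : V) * 0 + (S.τ 1 x * y + 0 * 0)) = _
  simp

theorem proj_cup_cons (q : ℤ) (F : ConvAlg V V) (x : V) (l : List V) :
    S.cup q (proj V) F (x :: l) = S.τ q x * F l := by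
  rw [cup, ConvAlg.mul_cons, ConvAlg.mul_apply, splitSum_eq_nil_left]
  · show 0 * F (x :: l) + S.τ q x * F l = _
    simp
  · exact fun y b c => zero_mul (F c)

theorem proj_cup_nil (q : ℤ) (F : ConvAlg V V) : S.cup q (proj V) F [] = 0 := zero_mul (F [])

theorem cup_proj_nil (q : ℤ) (F : ConvAlg V V) : S.cup q F (proj V) [] = 0 := mul_zero _

theorem cup_proj_concat (q : ℤ) (F : ConvAlg V V) (x : V) (l : List V) :
    S.cup q F (proj V) (l ++ [x]) = F (l.map (S.τ q)) * x := by
  rw [cup, ConvAlg.mul_apply, splitSum_append_cons, splitSum_eq_nil_right]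
  · show F (l.map (S.τ q)) * x + F ((l ++ [x]).map (S.τ q)) * 0 = _
    simp
  · intro y b c
    show _ * proj V (y :: c ++ x :: []) = 0
    rw [proj_cons_append_cons, mul_zero]

theorem str_long (x y z : V) (l : List V) : S.str (x :: y :: z :: l) = 0 := by
  rw [str, ConvAlg.sub_apply, proj_cup_cons]
  show S.d 0 - _ * 0 = 0
  simp

theorem insHead_str_nil {Φ : ConvAlg V N} (hΦ : IsMulti R Φ) : insHead S.str Φ [] = 0 := by
  show Φ [S.str []] = 0
  rw [str_nil]
  exact hΦ.zero_entry [] []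

theorem insHead_str_one {Φ : ConvAlg V N} (hΦ : IsMulti R Φ) (x : V) :
    insHead S.str Φ [x] = Φ [S.d x] := by
  show Φ (S.str [] :: [x]) + Φ [S.str [x]] = _
  rw [str_nil, str_one, ← List.nil_append (0 :: [x]), hΦ.zero_entry, zero_add]

/-- `str` vanishes on lists of length different from one and two, so a block at the head is either
the first letter or the first two letters. -/
theorem insHead_str_cons_cons {Φ : ConvAlg V N} (hΦ : IsMulti R Φ) (x y : V) (l : List V) :
    insHead S.str Φ (x :: y :: l) = Φ (S.d x :: y :: l) - Φ ((S.τ 1 x * y) :: l) := by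
  have h0 : ∀ l, Φ (0 :: l) = 0 := fun l => hΦ.zero_entry [] l
  simp only [insHead, splitSum_cons]
  rw [str_nil, str_one, h0, zero_add, sub_eq_add_neg, splitSum_eq_nil_left, str_two]
  · congr 1
    have := hΦ.smul [] (-1) (S.τ 1 x * y) l
    simpa using this
  · intro z b c
    rw [str_long, h0]

/-- An inner entry `1` can be multiplied with its left or its right neighbour, and these two
contributions cancel. At an end of the list only one neighbour exists, and its contribution
survives. -/
theorem ins_str_append_one {Φ : ConvAlg V N} (hm : IsMulti R Φ) (hΦ : IsNormalized Φ)
    (hd : S.d 1 = 0) (a b : List V) :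
    ins (S.τ 1) S.str Φ (a ++ 1 :: b) =
      (if a = [] ∧ b ≠ [] then Φ b else 0) - (if a ≠ [] ∧ b = [] then Φ (a.map (S.τ 1)) else 0) := by
  have h0 : ∀ l, Φ (0 :: l) = 0 := fun l => hm.zero_entry [] l
  have h1 : S.τ 1 1 = (-1 : R) • (1 : V) := by rw [S.τ_one]; simp [sgn]
  induction a generalizing Φ with
  | nil =>
    have e : (ConvAlg.ofFun fun w => Φ (S.τ 1 1 :: w)) = 0 := ext_apply fun w => by
      rw [h1]
      show Φ ([] ++ ((-1 : R) • (1 : V)) :: w) = 0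
      rw [hm.smul, hΦ, smul_zero]
    rw [List.nil_append, ins_cons, e, ins_zero]
    cases b with
    | nil => rw [insHead_str_one hm, hd, h0]; simp [ConvAlg.zero_apply]
    | cons y b =>
      rw [insHead_str_cons_cons hm, hd, h0, h1, smul_mul_assoc, one_mul,
        ← List.nil_append (((-1 : R) • y) :: b), hm.smul]
      simp [ConvAlg.zero_apply]
  | cons x a ih =>
    have e : (ConvAlg.ofFun fun w => Φ (S.τ 1 x :: w)) = shift [S.τ 1 x] Φ := rfl
    rw [List.cons_append, ins_cons, e, ih (hm.shift _) (hΦ.shift _)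
      (fun l => (hm.shift _).zero_entry [] l)]
    cases a with
    | nil =>
      rw [List.nil_append, insHead_str_cons_cons hm, mul_one]
      have := hΦ [S.d x] b
      rw [List.singleton_append] at this
      rw [this]
      by_cases hb : b = []
      · subst hb; simp
      · simp [hb, shift_apply]
    | cons y a =>
      rw [List.cons_append, insHead_str_cons_cons hm]
      have h2 := hΦ (S.d x :: y :: a) b
      have h3 := hΦ ((S.τ 1 x * y) :: a) b
      simp only [List.cons_append] at h2 h3
      rw [h2, h3]
      simp [shift_apply]

theorem d_one : S.d 1 = 0 := by
  have h := S.d_mul 1 1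
  rw [S.τ_one, mul_one, mul_one, smul_mul_assoc, one_mul, show sgn R 1 = -1 by simp [sgn]] at h
  simpa using h

/-- The surviving end terms of `ins_str_append_one` cancel against the left and right multiplication
by the letter `1` in the differential. -/
theorem isNormalized_D (hm : IsMulti R F) (hF : IsNormalized F) (f : ℤ) :
    IsNormalized (S.D f F) := fun a b => by
  have hs : S.circ 1 F S.str (a ++ 1 :: b) = _ := ins_str_append_one hm hF d_one a b
  have hd : post S.d F (a ++ 1 :: b) = 0 := by rw [post_apply, hF, map_zero]
  have h1 : S.cup (f + 1) (proj V) F (a ++ 1 :: b) =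
      if a = [] then sgn R (f + 1) • F b else 0 := by
    cases a with
    | nil => rw [List.nil_append, proj_cup_cons, S.τ_one, smul_mul_assoc, one_mul]; simp
    | cons x a => rw [List.cons_append, proj_cup_cons, hF, mul_zero]; simp
  have h2 : S.cup 1 F (proj V) (a ++ 1 :: b) = if b = [] then F (a.map (S.τ 1)) else 0 := by
    rcases List.eq_nil_or_concat b with rfl | ⟨c, x, rfl⟩
    · rw [cup_proj_concat, mul_one]; simp
    · rw [List.concat_eq_append, show a ++ 1 :: (c ++ [x]) = (a ++ 1 :: c) ++ [x] by simp,
        cup_proj_concat, ← ConvAlg.twist_apply, isNormalized_twist hm hF 1, zero_mul]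
      simp
  rw [D, ConvAlg.add_apply, ConvAlg.sub_apply, ConvAlg.smul_apply, ConvAlg.add_apply, hd, h1, h2,
    hs]
  by_cases ha : a = [] <;> by_cases hb : b = [] <;> simp [ha, hb]

end SignedDGA
end

noncomputable section
open ConvAlg

/-! ### Bounded functions and perversities -/

namespace GMPerversity

variable {n : ℕ}

/-- `x` is bounded by a perversity. -/
def Bdd (x : Fin (n + 1) → ℕ) : Prop := ∃ v : GMPerversity n, x ≤ v.toFun

theorem Bdd.le_ceil {x : Fin (n + 1) → ℕ} (h : Bdd x) : x ≤ (ceil x).toFun :=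
  GMPerversity.le_ceil h.choose_spec

theorem Bdd.mono {x y : Fin (n + 1) → ℕ} (h : Bdd y) (hxy : x ≤ y) : Bdd x :=
  ⟨h.choose, hxy.trans h.choose_spec⟩

theorem bdd_self (p : GMPerversity n) : Bdd p.toFun := ⟨p, le_rfl⟩

theorem ceil_mono {x y : Fin (n + 1) → ℕ} (h : x ≤ y) : ceil x ≤ ceil y := fun _ =>
  min_le_min le_rfl (Finset.sup_mono_fun fun j _ => Nat.sub_le_sub_right (h j) _)

theorem ceil_self (p : GMPerversity n) : ceil p.toFun = p :=
  le_antisymm (ceil_le le_rfl) (GMPerversity.le_ceil (v := p) le_rfl)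

theorem Bdd.left {x y : Fin (n + 1) → ℕ} (h : Bdd (x + y)) : Bdd x :=
  h.mono fun _ => Nat.le_add_right _ _

theorem Bdd.right {x y : Fin (n + 1) → ℕ} (h : Bdd (x + y)) : Bdd y :=
  h.mono fun _ => Nat.le_add_left _ _

theorem Bdd.ceil_add {x y : Fin (n + 1) → ℕ} (hx : Monotone x) (hy : Monotone y)
    (h : Bdd (x + y)) : (ceil x).toFun + y ≤ (ceil (x + y)).toFun :=
  ceil_add_le hx hy h.le_ceil

theorem Bdd.ceil_add_ceil {x y : Fin (n + 1) → ℕ} (hx : Monotone x) (hy : Monotone y)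
    (h : Bdd (x + y)) : (ceil x).toFun + (ceil y).toFun ≤ (ceil (x + y)).toFun :=
  add_ceil_le hy (ceil x).monotone (add_le_comm (h.ceil_add hx hy))

/-- Rounding an intermediate sum does not change the rounded total, since a perversity bounding `x +
y` also bounds `ceil x + y`. Associativity in `Total` and the use of unrounded perversities depend
on it. -/
theorem ceil_ceil_add {x y : Fin (n + 1) → ℕ} (hx : Monotone x) (hy : Monotone y)
    (h : Bdd (x + y)) : ceil ((ceil x).toFun + y) = ceil (x + y) :=
  le_antisymm (ceil_le (h.ceil_add hx hy)) (ceil_mono (add_le_add_left h.left.le_ceil y))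

theorem bdd_ceil_add_iff {x y : Fin (n + 1) → ℕ} (hx : Monotone x) (hy : Monotone y)
    (h : Bdd x) : Bdd ((ceil x).toFun + y) ↔ Bdd (x + y) :=
  ⟨fun h' => h'.mono (add_le_add_left h.le_ceil y), fun h' => ⟨_, h'.ceil_add hx hy⟩⟩

theorem ceil_ceil_add_ceil {x y : Fin (n + 1) → ℕ} (hx : Monotone x) (hy : Monotone y)
    (h : Bdd (x + y)) : ceil ((ceil x).toFun + (ceil y).toFun) = ceil (x + y) :=
  le_antisymm (ceil_le (h.ceil_add_ceil hx hy))
    (ceil_mono (add_le_add h.left.le_ceil h.right.le_ceil))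

theorem zero_toFun : (0 : GMPerversity n).toFun = 0 := rfl

end GMPerversity

namespace PerverseDGA

open GMPerversity

variable {R : Type u} [CommRing R] {n : ℕ} (A : PerverseDGA.{u, v} R n)

/-! ### The total algebra -/

/-- The direct sum of all components of `A`. -/
def Total : Type v := ⨁ x : GMPerversity n × ℤ, A.obj x.1 x.2

instance : AddCommGroup A.Total :=
  inferInstanceAs (AddCommGroup (⨁ x : GMPerversity n × ℤ, A.obj x.1 x.2))

instance : Module R A.Total :=
  inferInstanceAs (Module R (⨁ x : GMPerversity n × ℤ, A.obj x.1 x.2))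

namespace Total

open Classical in
/-- The inclusion of a component. -/
def of (p : GMPerversity n) (i : ℤ) : A.obj p i →ₗ[R] A.Total :=
  DirectSum.lof R (GMPerversity n × ℤ) (fun x => A.obj x.1 x.2) (p, i)

/-- The projection to a component. -/
def comp (p : GMPerversity n) (i : ℤ) : A.Total →ₗ[R] A.obj p i :=
  DirectSum.component R (GMPerversity n × ℤ) (fun x => A.obj x.1 x.2) (p, i)

variable {A}

theorem comp_of {p : GMPerversity n} {i : ℤ} (a : A.obj p i) : comp A p i (of A p i a) = a := by
  classical
  exact DirectSum.component.lof_self R _ _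

open Classical in
/-- Linear maps on the total algebra are given by linear maps on the components. -/
def lift {N : Type w} [AddCommGroup N] [Module R N] (φ : ∀ p i, A.obj p i →ₗ[R] N) :
    A.Total →ₗ[R] N :=
  DirectSum.toModule R (GMPerversity n × ℤ) N fun x => φ x.1 x.2

theorem lift_of {N : Type w} [AddCommGroup N] [Module R N] (φ : ∀ p i, A.obj p i →ₗ[R] N)
    {p : GMPerversity n} {i : ℤ} (a : A.obj p i) : lift φ (of A p i a) = φ p i a := by
  classical
  exact DirectSum.toModule_lof R (M := fun x : GMPerversity n × ℤ => A.obj x.1 x.2)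
    (φ := fun x => φ x.1 x.2) (p, i) a

theorem induction {P : A.Total → Prop} (x : A.Total) (zero : P 0)
    (of : ∀ p i (a : A.obj p i), P (of A p i a)) (add : ∀ x y, P x → P y → P (x + y)) : P x := by
  classical
  exact DirectSum.induction_on x zero (fun y a => of y.1 y.2 a) add

/-- The product of two homogeneous elements. -/
def mulAux (p : GMPerversity n) (i : ℤ) (q : GMPerversity n) (j : ℤ) :
    A.obj p i →ₗ[R] A.obj q j →ₗ[R] A.Total :=
  -- Where no perversity bounds `p + q`, the product is set to zero. This default is compatible with
  -- associativity and the derivation property.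
  open Classical in
  if h : Bdd (p.toFun + q.toFun) then
    (A.mul h.le_ceil (rfl : i + j = i + j)).compr₂ (of A (ceil (p.toFun + q.toFun)) (i + j))
  else 0

/-- The product of the total algebra. -/
def mulₗ : A.Total →ₗ[R] A.Total →ₗ[R] A.Total :=
  lift fun p i => LinearMap.flip (lift fun q j => (mulAux p i q j).flip)

instance : Mul A.Total := ⟨fun x y => mulₗ x y⟩

instance : One A.Total := ⟨of A 0 0 A.one⟩

theorem one_def : (1 : A.Total) = of A 0 0 A.one := rfl

theorem of_mul_of_aux {p q : GMPerversity n} {i j : ℤ} (a : A.obj p i) (b : A.obj q j) :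
    of A p i a * of A q j b = mulAux p i q j a b := by
  show mulₗ _ _ = _
  rw [mulₗ, lift_of, LinearMap.flip_apply, lift_of, LinearMap.flip_apply]

theorem of_mul_of {p q s : GMPerversity n} {i j k : ℤ} (a : A.obj p i) (b : A.obj q j)
    (h : p.toFun + q.toFun ≤ s.toFun) (hs : s = ceil (p.toFun + q.toFun)) (e : i + j = k) :
    of A p i a * of A q j b = of A s k (A.mul h e a b) := by
  subst hs e
  rw [of_mul_of_aux, mulAux, dif_pos ⟨_, h⟩]
  rfl

theorem of_mul_of_eq_zero {p q : GMPerversity n} {i j : ℤ} (a : A.obj p i) (b : A.obj q j)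
    (h : ¬ Bdd (p.toFun + q.toFun)) : of A p i a * of A q j b = 0 := by
  rw [of_mul_of_aux, mulAux, dif_neg h]
  rfl

/-- If `p + q + s` is bounded, both products land in perversity `ceil (p + q + s)` and associativity
of `A` applies. If it is not, both products vanish, since rounding a partial sum does not change
boundedness. -/
theorem of_mul_of_mul_of {p q s : GMPerversity n} {i j k : ℤ} (a : A.obj p i) (b : A.obj q j)
    (c : A.obj s k) :
    of A p i a * of A q j b * of A s k c = of A p i a * (of A q j b * of A s k c) := by
  have hz : ∀ (p' : GMPerversity n) (i' : ℤ) (a' : A.obj p' i'), of A p' i' a' * 0 = 0 :=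
    fun _ _ _ => map_zero (mulₗ _)
  have hz' : ∀ (x : A.Total), 0 * x = 0 :=
    fun x => (congrArg (fun φ : A.Total →ₗ[R] A.Total => φ x) (map_zero mulₗ))
  have hm := monotone_add p.monotone q.monotone
  have hm' := monotone_add q.monotone s.monotone
  by_cases h : Bdd (p.toFun + q.toFun + s.toFun)
  · have h' : Bdd (q.toFun + s.toFun + p.toFun) := by
      rwa [add_comm, ← add_assoc]
    have h₂ := h.ceil_add hm s.monotone
    have h₄ : p.toFun + (ceil (q.toFun + s.toFun)).toFun ≤
        (ceil (p.toFun + q.toFun + s.toFun)).toFun := by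
      rw [add_comm p.toFun, show p.toFun + q.toFun + s.toFun = q.toFun + s.toFun + p.toFun by abel]
      exact h'.ceil_add hm' p.monotone
    rw [of_mul_of a b h.left.le_ceil rfl rfl, of_mul_of b c h'.left.le_ceil rfl rfl,
      of_mul_of _ c h₂ (ceil_ceil_add hm s.monotone h).symm rfl,
      of_mul_of a _ h₄ ?_ (show i + (j + k) = i + j + k by ring),
      A.mul_assoc h.left.le_ceil h₂ h'.left.le_ceil h₄ rfl rfl rfl (by ring)]
    rw [add_comm p.toFun (ceil _).toFun, ceil_ceil_add hm' p.monotone h', add_comm _ p.toFun,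
      ← add_assoc]
  · have e₁ : of A p i a * of A q j b * of A s k c = 0 := by
      by_cases h₁ : Bdd (p.toFun + q.toFun)
      · rw [of_mul_of a b h₁.le_ceil rfl rfl, of_mul_of_eq_zero]
        rwa [bdd_ceil_add_iff hm s.monotone h₁]
      · rw [of_mul_of_eq_zero a b h₁, hz']
    have e₂ : of A p i a * (of A q j b * of A s k c) = 0 := by
      by_cases h₁ : Bdd (q.toFun + s.toFun)
      · rw [of_mul_of b c h₁.le_ceil rfl rfl, of_mul_of_eq_zero]
        rwa [add_comm, bdd_ceil_add_iff hm' p.monotone h₁, add_comm, ← add_assoc]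
      · rw [of_mul_of_eq_zero b c h₁, hz]
    rw [e₁, e₂]

theorem one_mul_of {p : GMPerversity n} {i : ℤ} (a : A.obj p i) : 1 * of A p i a = of A p i a := by
  rw [one_def, of_mul_of _ _ p.zero_add_le ?_ (zero_add i), A.one_mul]
  rw [zero_toFun, zero_add, ceil_self]

theorem of_mul_one {p : GMPerversity n} {i : ℤ} (a : A.obj p i) : of A p i a * 1 = of A p i a := by
  rw [one_def, of_mul_of _ _ p.add_zero_le ?_ (add_zero i), A.mul_one]
  rw [zero_toFun, add_zero, ceil_self]

theorem add_mul_aux (x y z : A.Total) : (x + y) * z = x * z + y * z :=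
  congrArg (fun φ : A.Total →ₗ[R] A.Total => φ z) (map_add mulₗ x y)

theorem mul_add_aux (x y z : A.Total) : x * (y + z) = x * y + x * z := map_add (mulₗ x) y z

theorem zero_mul_aux (x : A.Total) : 0 * x = 0 :=
  congrArg (fun φ : A.Total →ₗ[R] A.Total => φ x) (map_zero mulₗ)

theorem mul_zero_aux (x : A.Total) : x * 0 = 0 := map_zero (mulₗ x)

instance : Ring A.Total where
  __ := (inferInstance : AddCommGroup A.Total)
  left_distrib := mul_add_aux
  right_distrib := add_mul_aux
  zero_mul := zero_mul_aux
  mul_zero := mul_zero_aux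
  mul_assoc x y z := by
    induction x using Total.induction with
    | zero => simp only [zero_mul_aux]
    | add x x' hx hx' => simp only [add_mul_aux, hx, hx']
    | of p i a =>
      induction y using Total.induction with
      | zero => simp only [zero_mul_aux, mul_zero_aux]
      | add y y' hy hy' => simp only [add_mul_aux, mul_add_aux, hy, hy']
      | of q j b =>
        induction z using Total.induction with
        | zero => simp only [mul_zero_aux]
        | add z z' hz hz' => simp only [mul_add_aux, hz, hz']
        | of s k c => exact of_mul_of_mul_of a b c
  one_mul x := by
    induction x using Total.induction with
    | zero => exact mul_zero_aux _
    | add x x' hx hx' => rw [mul_add_aux, hx, hx']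
    | of p i a => exact one_mul_of a
  mul_one x := by
    induction x using Total.induction with
    | zero => exact zero_mul_aux _
    | add x x' hx hx' => rw [add_mul_aux, hx, hx']
    | of p i a => exact of_mul_one a

instance : Algebra R A.Total :=
  Algebra.ofModule
    (fun s x y => congrArg (fun φ : A.Total →ₗ[R] A.Total => φ y) (map_smul mulₗ s x))
    (fun s x y => map_smul (mulₗ x) s y)

/-- The sign operator `a ↦ (-1)^{k (|a| - 1)} a`. -/
def τ (k : ℤ) : A.Total →ₗ[R] A.Total := lift fun p i => sgn R (k * (i - 1)) • of A p i

theorem τ_of (k : ℤ) {p : GMPerversity n} {i : ℤ} (a : A.obj p i) :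
    τ k (of A p i a) = sgn R (k * (i - 1)) • of A p i a := lift_of _ a

/-- The differential of the total algebra. -/
def d : A.Total →ₗ[R] A.Total := lift fun p i => of A p (i + 1) ∘ₗ A.d rfl

theorem d_of {p : GMPerversity n} {i j : ℤ} (h : i + 1 = j) (a : A.obj p i) :
    d (of A p i a) = of A p j (A.d h a) := by
  subst h
  exact lift_of _ a

theorem τ_mul_of (k : ℤ) {p q : GMPerversity n} {i j : ℤ} (a : A.obj p i) (b : A.obj q j) :
    τ k (of A p i a * of A q j b) = sgn R k • (τ k (of A p i a) * τ k (of A q j b)) := by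
  rw [τ_of, τ_of, smul_mul_assoc, mul_smul_comm, smul_smul, smul_smul]
  by_cases h : Bdd (p.toFun + q.toFun)
  · rw [of_mul_of a b h.le_ceil rfl rfl, τ_of, ← sgn_add, ← sgn_add]
    congr 1
    simp only [sgn_eq_ite, Int.even_add, Int.even_sub, Int.even_mul, Int.not_even_one]
    by_cases h₁ : Even k <;> by_cases h₂ : Even i <;> by_cases h₃ : Even j <;> simp [h₁, h₂, h₃]
  · rw [of_mul_of_eq_zero a b h, map_zero, smul_zero]

theorem d_mul_of {p q : GMPerversity n} {i j : ℤ} (a : A.obj p i) (b : A.obj q j) :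
    d (of A p i a * of A q j b) =
      d (of A p i a) * of A q j b - τ 1 (of A p i a) * d (of A q j b) := by
  rw [τ_of, d_of rfl, d_of rfl, smul_mul_assoc]
  by_cases h : Bdd (p.toFun + q.toFun)
  · rw [of_mul_of a b h.le_ceil rfl rfl, d_of rfl,
      A.d_mul h.le_ceil rfl rfl rfl rfl (show i + 1 + j = i + j + 1 by ring)
        (show i + (j + 1) = i + j + 1 by ring),
      of_mul_of _ b h.le_ceil rfl (show i + 1 + j = i + j + 1 by ring),
      of_mul_of a _ h.le_ceil rfl (show i + (j + 1) = i + j + 1 by ring), map_add,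
      negOnePow_smul_eq (R := R), map_smul, _root_.one_mul, sub_eq_add_neg, ← neg_smul]
    congr 2
    simp only [sgn_eq_ite, Int.even_sub, Int.not_even_one]
    by_cases h₂ : Even i <;> simp [h₂]
  · rw [of_mul_of_eq_zero a b h, of_mul_of_eq_zero _ b h, of_mul_of_eq_zero a _ h]
    simp

end Total

open Total in
/-- The total algebra with its sign operators. -/
def signed : SignedDGA R A.Total where
  τ := Total.τ
  τ_τ k l x := by
    induction x using Total.induction with
    | zero => simp only [map_zero]
    | add x y hx hy => simp only [map_add, hx, hy]
    | of p i a => rw [τ_of, map_smul, τ_of, τ_of, smul_smul, ← sgn_add, add_mul, add_comm]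
  τ_mul k x y := by
    induction x using Total.induction with
    | zero => simp only [map_zero, zero_mul, smul_zero]
    | add x y hx hy => simp only [map_add, add_mul, hx, hy, smul_add]
    | of p i a =>
      induction y using Total.induction with
      | zero => simp only [map_zero, mul_zero, smul_zero]
      | add x y hx hy => simp only [map_add, mul_add, hx, hy, smul_add]
      | of q j b => exact τ_mul_of k a b
  τ_one k := by
    rw [one_def, τ_of]
    congr 1
    simp only [sgn_eq_ite, zero_sub, mul_neg, _root_.mul_one, even_neg]
  d := Total.d
  d_d x := by
    induction x using Total.induction with
    | zero => simp only [map_zero]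
    | add x y hx hy => simp only [map_add, hx, hy, add_zero]
    | of p i a => rw [d_of rfl, d_of rfl, A.d_d, map_zero]
  d_mul x y := by
    induction x using Total.induction with
    | zero => simp only [map_zero, zero_mul, sub_zero]
    | add x y hx hy => simp only [map_add, add_mul, hx, hy]; abel
    | of p i a =>
      induction y using Total.induction with
      | zero => simp only [map_zero, mul_zero, sub_zero]
      | add x y hx hy => simp only [map_add, mul_add, hx, hy]; abel
      | of q j b => exact d_mul_of a b
  d_τ k x := by
    induction x using Total.induction with
    | zero => simp only [map_zero, smul_zero]
    | add x y hx hy => simp only [map_add, hx, hy, smul_add]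
    | of p i a =>
      rw [τ_of, map_smul, d_of rfl, τ_of, smul_smul, ← sgn_add]
      congr 1
      simp only [sgn_eq_ite, Int.even_add, Int.even_sub, Int.even_mul, Int.not_even_one]
      by_cases h₁ : Even k <;> by_cases h₂ : Even i <;> simp [h₁, h₂]

end PerverseDGA
end

noncomputable section
open ConvAlg

namespace PerverseDGA

open GMPerversity

variable {R : Type u} [CommRing R] {n : ℕ} {A : PerverseDGA.{u, v} R n}

/-! ### Functions compatible with perversities -/

variable (A) in
open Classical in
/-- The inclusion of the component of perversity `ceil x`; it is zero if `x` is not bounded by a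
perversity. -/
def inc (x : Fin (n + 1) → ℕ) (j : ℤ) : A.obj (ceil x) j →ₗ[R] A.Total :=
  if Bdd x then Total.of A (ceil x) j else 0

theorem inc_of_bdd {x : Fin (n + 1) → ℕ} (h : Bdd x) {j : ℤ} (y : A.obj (ceil x) j) :
    inc A x j y = Total.of A (ceil x) j y := by rw [inc, if_pos h]

theorem inc_of_not_bdd {x : Fin (n + 1) → ℕ} (h : ¬ Bdd x) {j : ℤ} (y : A.obj (ceil x) j) :
    inc A x j y = 0 := by rw [inc, if_neg h]; rfl

/-- `a` and `a'` are homogeneous of perversities `x ≤ x'` and degree `j`, and `a'` is the image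
of `a`. -/
def Rel (x x' : Fin (n + 1) → ℕ) (j : ℤ) (a a' : A.Total) : Prop :=
  ∃ (h : x ≤ x') (y : A.obj (ceil x) j), a = inc A x j y ∧ a' = inc A x' j (A.map (ceil_mono h) y)

namespace Rel

variable {x x' z z' : Fin (n + 1) → ℕ} {i j : ℤ} {a a' b b' : A.Total}

theorem add (h : Rel x x' j a a') (h' : Rel x x' j b b') : Rel x x' j (a + b) (a' + b') := by
  obtain ⟨hx, y, rfl, rfl⟩ := h
  obtain ⟨_, y', rfl, rfl⟩ := h'
  exact ⟨hx, y + y', by simp only [map_add], by simp only [map_add]⟩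

theorem smul (h : Rel x x' j a a') (s : R) : Rel x x' j (s • a) (s • a') := by
  obtain ⟨hx, y, rfl, rfl⟩ := h
  exact ⟨hx, s • y, by simp only [map_smul], by simp only [map_smul]⟩

theorem sub (h : Rel x x' j a a') (h' : Rel x x' j b b') : Rel x x' j (a - b) (a' - b') := by
  obtain ⟨hx, y, rfl, rfl⟩ := h
  obtain ⟨_, y', rfl, rfl⟩ := h'
  exact ⟨hx, y - y', by simp only [map_sub], by simp only [map_sub]⟩

theorem zero (hx : x ≤ x') : Rel x x' j (0 : A.Total) 0 :=
  ⟨hx, 0, by simp only [map_zero], by simp only [map_zero]⟩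

theorem τ (h : Rel x x' j a a') (k : ℤ) : Rel x x' j (A.signed.τ k a) (A.signed.τ k a') := by
  have key : ∀ (x : Fin (n + 1) → ℕ) (y : A.obj (ceil x) j),
      A.signed.τ k (inc A x j y) = sgn R (k * (j - 1)) • inc A x j y := fun x y => by
    by_cases hx : Bdd x
    · rw [inc_of_bdd hx]; exact Total.τ_of k y
    · rw [inc_of_not_bdd hx, map_zero, smul_zero]
  have h' := h.smul (sgn R (k * (j - 1)))
  obtain ⟨hx, y, rfl, rfl⟩ := h
  rwa [key, key]

theorem d (h : Rel x x' i a a') (hj : i + 1 = j) :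
    Rel x x' j (A.signed.d a) (A.signed.d a') := by
  have key : ∀ (x : Fin (n + 1) → ℕ) (y : A.obj (ceil x) i),
      A.signed.d (inc A x i y) = inc A x j (A.d hj y) := fun x y => by
    by_cases hx : Bdd x
    · rw [inc_of_bdd hx, inc_of_bdd hx]; exact Total.d_of hj y
    · rw [inc_of_not_bdd hx, inc_of_not_bdd hx, map_zero]
  obtain ⟨hx, y, rfl, rfl⟩ := h
  exact ⟨hx, A.d hj y, key x y, by rw [key, A.d_map]⟩

end Rel

theorem inc_mul_inc {x z : Fin (n + 1) → ℕ} (hx : Monotone x) (hz : Monotone z)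
    (hb : Bdd (x + z)) {i j k : ℤ} (hk : i + j = k) (y : A.obj (ceil x) i) (y' : A.obj (ceil z) j) :
    inc A x i y * inc A z j y' = inc A (x + z) k (A.mul (hb.ceil_add_ceil hx hz) hk y y') := by
  rw [inc_of_bdd hb, inc_of_bdd hb.left, inc_of_bdd hb.right]
  exact Total.of_mul_of y y' _ (ceil_ceil_add_ceil hx hz hb).symm hk

theorem inc_mul_inc_eq_zero {x z : Fin (n + 1) → ℕ} (hb : ¬ Bdd (x + z)) {i j : ℤ}
    (y : A.obj (ceil x) i) (y' : A.obj (ceil z) j) : inc A x i y * inc A z j y' = 0 := by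
  by_cases h₁ : Bdd x
  · by_cases h₂ : Bdd z
    · rw [inc_of_bdd h₁, inc_of_bdd h₂, Total.of_mul_of_eq_zero]
      exact fun h => hb (h.mono (add_le_add h₁.le_ceil h₂.le_ceil))
    · rw [inc_of_not_bdd h₂, mul_zero]
  · rw [inc_of_not_bdd h₁, zero_mul]

/-- Compatibility of the product with the structure maps. If only the larger sum is unbounded, the
second product is zero, which is what `inc` prescribes there. -/
theorem Rel.mul {x x' z z' : Fin (n + 1) → ℕ} {i j k : ℤ} {a a' b b' : A.Total}
    (hx : Monotone x) (hx' : Monotone x') (hz : Monotone z) (hz' : Monotone z')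
    (h : Rel x x' i a a') (h' : Rel z z' j b b') (hk : i + j = k) :
    Rel (x + z) (x' + z') k (a * b) (a' * b') := by
  obtain ⟨hxx, y, rfl, rfl⟩ := h
  obtain ⟨hzz, y', rfl, rfl⟩ := h'
  have hle : x + z ≤ x' + z' := add_le_add hxx hzz
  by_cases hb' : Bdd (x' + z')
  · have hb := hb'.mono hle
    refine ⟨hle, A.mul (hb.ceil_add_ceil hx hz) hk y y', inc_mul_inc hx hz hb hk y y', ?_⟩
    rw [inc_mul_inc hx' hz' hb' hk, A.map_mul]
  · rw [inc_mul_inc_eq_zero hb']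
    by_cases hb : Bdd (x + z)
    · exact ⟨hle, _, inc_mul_inc hx hz hb hk y y', (inc_of_not_bdd hb' _).symm⟩
    · rw [inc_mul_inc_eq_zero hb]
      exact Rel.zero hle

/-- The relation `Rel` for the entries of two lists, with total perversities `x`, `x'` and total
degree `j` of the suspensions. -/
inductive WordRel : (Fin (n + 1) → ℕ) → (Fin (n + 1) → ℕ) → ℤ → List A.Total → List A.Total → Prop
  | nil : WordRel 0 0 0 [] []
  | cons {x x' y y' : Fin (n + 1) → ℕ} {i j : ℤ} {a a' : A.Total} {l l' : List A.Total} :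
      Monotone x → Monotone x' → Rel x x' (i + 1) a a' → WordRel y y' j l l' →
      WordRel (x + y) (x' + y') (i + j) (a :: l) (a' :: l')

namespace WordRel

variable {x x' y y' : Fin (n + 1) → ℕ} {i j : ℤ} {l l' m m' : List A.Total}

theorem monotone_left (h : WordRel x x' j l l') : Monotone x := by
  induction h with
  | nil => exact monotone_const
  | cons hx hx' _ _ ih => exact hx.add ih

theorem monotone_right (h : WordRel x x' j l l') : Monotone x' := by
  induction h with
  | nil => exact monotone_const
  | cons hx hx' _ _ ih => exact hx'.add ih

theorem le (h : WordRel x x' j l l') : x ≤ x' := by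
  induction h with
  | nil => exact le_rfl
  | cons _ _ hr _ ih => exact add_le_add hr.1 ih

theorem append (h : WordRel x x' i l l') (h' : WordRel y y' j m m') :
    WordRel (x + y) (x' + y') (i + j) (l ++ m) (l' ++ m') := by
  induction h with
  | nil => simpa using h'
  | cons hx hx' hr _ ih =>
    rw [add_assoc, add_assoc, add_assoc]
    exact cons hx hx' hr ih

theorem τ (h : WordRel x x' i l l') (k : ℤ) :
    WordRel x x' i (l.map (A.signed.τ k)) (l'.map (A.signed.τ k)) := by
  induction h with
  | nil => exact nil
  | cons hx hx' hr _ ih => exact cons hx hx' (hr.τ k) ih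

/-- A relation between sums over splittings can be checked on the summands. -/
theorem splitSum {P : A.Total → A.Total → Prop}
    (hP : ∀ a a' b b', P a a' → P b b' → P (a + b) (a' + b')) (h : WordRel x x' j l l')
    {Θ Θ' : List A.Total → List A.Total → A.Total}
    (hΘ : ∀ {y y' i z z' k b b' c c'}, WordRel y y' i b b' → WordRel z z' k c c' → y + z = x →
      y' + z' = x' → i + k = j → P (Θ b c) (Θ' b' c')) :
    P (splitSum Θ l) (splitSum Θ' l') := by
  induction h generalizing Θ Θ' with
  | nil => exact hΘ nil nil (add_zero _) (add_zero _) (add_zero _)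
  | cons hx hx' hr ht ih =>
    refine hP _ _ _ _ (hΘ nil (cons hx hx' hr ht) (zero_add _) (zero_add _) (zero_add _)) (ih ?_)
    intro y y' i z z' k b b' c c' hb hc h₁ h₂ h₃
    exact hΘ (cons hx hx' hr hb) hc (by rw [add_assoc, h₁]) (by rw [add_assoc, h₂])
      (by rw [add_assoc, h₃])

end WordRel

/-- The functions `F` of perversity `x` and degree `f + 1` which are compatible with the structure
maps. -/
structure Typed (x : Fin (n + 1) → ℕ) (f : ℤ) (F : ConvAlg A.Total A.Total) : Prop where
  monotone : Monotone x
  rel : ∀ {y y' j l l'}, WordRel y y' j l l' → ∀ {k}, j + f + 1 = k →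
    Rel (x + y) (x + y') k (F l) (F l')

namespace Typed

variable {x z t : Fin (n + 1) → ℕ} {f g h : ℤ} {F G H : ConvAlg A.Total A.Total}

theorem addFun (hF : Typed x f F) (hG : Typed x f G) : Typed x f (F + G) :=
  ⟨hF.1, fun hl _ hk => (hF.rel hl hk).add (hG.rel hl hk)⟩

theorem subFun (hF : Typed x f F) (hG : Typed x f G) : Typed x f (F - G) :=
  ⟨hF.1, fun hl _ hk => (hF.rel hl hk).sub (hG.rel hl hk)⟩

theorem smulFun (hF : Typed x f F) (s : R) : Typed x f (s • F) :=
  ⟨hF.1, fun hl _ hk => (hF.rel hl hk).smul s⟩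

theorem post_d (hF : Typed x f F) (hg : f + 1 = g) : Typed x g (post A.signed.d F) :=
  ⟨hF.1, fun hl _ hk => (hF.rel hl rfl).d (by omega)⟩

theorem twist (hF : Typed x f F) (k : ℤ) : Typed x f (ConvAlg.twist (A.signed.τ k) F) :=
  ⟨hF.1, fun hl _ hk => hF.rel (hl.τ k) hk⟩

theorem cup (hF : Typed x f F) (hG : Typed z g G) (q : ℤ) (hh : f + g + 1 = h) :
    Typed (x + z) h (A.signed.cup q F G) := by
  refine ⟨monotone_add hF.1 hG.1, fun {y y' j l l'} hl {k} hk =>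
    hl.splitSum (fun _ _ _ _ h₁ h₂ => h₁.add h₂) ?_⟩
  rintro y₁ y₁' i₁ y₂ y₂' i₂ b b' c c' hb hc rfl rfl rfl
  have h₁ := (hF.twist q).rel hb rfl
  have h₂ := hG.rel hc rfl
  have := Rel.mul (monotone_add hF.1 hb.monotone_left) (monotone_add hF.1 hb.monotone_right)
    (monotone_add hG.1 hc.monotone_left) (monotone_add hG.1 hc.monotone_right) h₁ h₂ (k := k) (by omega)
  rwa [add_add_add_comm x y₁, add_add_add_comm x y₁'] at this

/-- The function `w ↦ F (a ++ w)`, summed over insertions of `H`. -/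
theorem ins_shift (hF : Typed x f F) (hH : Typed z h H) {y y' : Fin (n + 1) → ℕ} {i : ℤ}
    {a a' : List A.Total} (ha : WordRel y y' i a a') {s s' : Fin (n + 1) → ℕ} {j : ℤ}
    {l l' : List A.Total} (hl : WordRel s s' j l l') {k : ℤ} (hk : i + j + f + h + 1 = k) (q : ℤ) :
    Rel (x + z + (y + s)) (x + z + (y' + s')) k
      (ins (A.signed.τ q) H (.ofFun fun w => F (a ++ w)) l)
      (ins (A.signed.τ q) H (.ofFun fun w => F (a' ++ w)) l') := by
  refine hl.splitSum (fun _ _ _ _ h₁ h₂ => h₁.add h₂) ?_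
  rintro y₁ y₁' i₁ r r' i₂ b b' c c' hb hc rfl rfl rfl
  refine hc.splitSum (fun _ _ _ _ h₁ h₂ => h₁.add h₂) ?_
  rintro y₂ y₂' i₂ y₃ y₃' i₃ c₁ c₁' c₂ c₂' hc₁ hc₂ rfl rfl rfl
  -- The inserted value is a single entry of perversity `z + y₂`; its suspended degree is that of
  -- the block plus `h`.
  have hw := ha.append ((hb.τ q).append (.cons (monotone_add hH.1 hc₁.monotone_left)
    (monotone_add hH.1 hc₁.monotone_right) (i := i₂ + h) (hH.rel hc₁ rfl) hc₂))
  have := hF.rel hw (k := k) (by omega)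
  convert this using 1 <;> abel

theorem circ (hF : Typed x f F) (hG : Typed z g G) (hh : f + g = h) :
    Typed (x + z) h (A.signed.circ g F G) := by
  refine ⟨monotone_add hF.1 hG.1, fun {y y' j l l'} hl {k} hk => ?_⟩
  have := ins_shift hF hG .nil hl (k := k) (by omega) g
  rwa [zero_add, zero_add] at this

theorem brace (hF : Typed x f F) (hG : Typed z g G) (hH : Typed t h H) :
    Typed (x + z + t) (f + (g + h)) (A.signed.brace g h F G H) := by
  refine ⟨monotone_add (monotone_add hF.1 hG.1) hH.1, fun {y y' j l l'} hl {k} hk =>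
    hl.splitSum (fun _ _ _ _ h₁ h₂ => h₁.add h₂) ?_⟩
  rintro y₁ y₁' i₁ r r' i₂ b b' c c' hb hc rfl rfl rfl
  refine hc.splitSum (fun _ _ _ _ h₁ h₂ => h₁.add h₂) ?_
  rintro y₂ y₂' i₂ y₃ y₃' i₃ c₁ c₁' c₂ c₂' hc₁ hc₂ rfl rfl rfl
  have ha := (hb.τ (g + h)).append (.cons (monotone_add hG.1 hc₁.monotone_left)
    (monotone_add hG.1 hc₁.monotone_right) (i := i₂ + g) ((hG.twist h).rel hc₁ rfl) .nil)
  have := ins_shift hF hH ha hc₂ (k := k) (by omega) h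
  simp only [List.append_assoc, List.singleton_append] at this
  convert this using 1 <;> abel

theorem proj : Typed 0 0 (SignedDGA.proj A.Total) := by
  refine ⟨monotone_const, fun {y y' j l l'} hl {k} hk => ?_⟩
  have hle : 0 + y ≤ 0 + y' := add_le_add_right hl.le 0
  cases hl with
  | nil => exact Rel.zero hle
  | cons hx hx' hr ht =>
    cases ht with
    | nil =>
      rw [zero_add, zero_add, add_zero, add_zero]
      obtain rfl : _ = k := hk
      rw [add_zero, add_zero]
      exact hr
    | cons _ _ _ _ => exact Rel.zero hle

theorem str : Typed 0 1 A.signed.str := by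
  have h := proj.cup (A := A) proj 1 (show (0 : ℤ) + 0 + 1 = 1 by ring)
  rw [add_zero] at h
  exact (proj.post_d (by ring)).subFun h

theorem D (hF : Typed x f F) : Typed x (f + 1) (A.signed.D f F) := by
  have h₁ := proj.cup hF (f + 1) (show 0 + f + 1 = f + 1 by ring)
  have h₂ := hF.cup proj 1 (show f + 0 + 1 = f + 1 by ring)
  have h₃ := hF.circ str rfl
  rw [zero_add] at h₁
  rw [add_zero] at h₂ h₃
  exact ((hF.post_d rfl).subFun h₁).addFun ((h₂.addFun h₃).smulFun _)

end Typed

/-! #### Homogeneous lists -/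

/-- A letter as an element of the total algebra. -/
def Letter.tot (a : A.Letter) : A.Total := Total.of A a.per (a.deg + 1) a.val

/-- A word as a list of elements of the total algebra. -/
def Word.tot (w : A.Word) : List A.Total := w.map Letter.tot

/-- The perversities `ceil p` and `p` are equal only propositionally, so the witness is obtained by
generalizing `ceil p` to a variable perversity and substituting. -/
theorem exists_inc {p p' : GMPerversity n} (h : p ≤ p') {j : ℤ} (a : A.obj p j) :
    Rel p.toFun p'.toFun j (Total.of A p j a) (Total.of A p' j (A.map h a)) := by
  have key : ∀ (q q' : GMPerversity n) (hq : q = p) (hq' : q' = p') (hqq : q ≤ q'),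
      ∃ y : A.obj q j, Total.of A p j a = Total.of A q j y ∧
        Total.of A p' j (A.map h a) = Total.of A q' j (A.map hqq y) := by
    rintro q q' rfl rfl hqq
    exact ⟨a, rfl, rfl⟩
  obtain ⟨y, h₁, h₂⟩ := key _ _ (ceil_self p) (ceil_self p') (ceil_mono h)
  exact ⟨h, y, by rw [inc_of_bdd (bdd_self p), h₁], by rw [inc_of_bdd (bdd_self p'), h₂]⟩

/-- The letter `a'` is the image of `a` under a structure map. -/
def Letter.MapsTo (a a' : A.Letter) : Prop :=
  ∃ (p' : GMPerversity n) (h : a.per ≤ p'), a' = ⟨p', a.deg, A.map h a.val⟩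

theorem Letter.mapsTo_refl (a : A.Letter) : a.MapsTo a :=
  ⟨a.per, le_rfl, by rw [A.map_id]⟩

theorem Word.wordRel {w w' : A.Word} (h : List.Forall₂ Letter.MapsTo w w') :
    WordRel w.per w'.per w.deg w.tot w'.tot := by
  induction h with
  | nil => exact .nil
  | cons hr _ ih =>
    rw [Word.per_cons, Word.per_cons, Word.deg_cons]
    obtain ⟨p', hp, rfl⟩ := hr
    exact .cons (GMPerversity.monotone _) (GMPerversity.monotone _) (exists_inc hp _) ih

theorem Word.wordRel_self (w : A.Word) : WordRel w.per w.per w.deg w.tot w.tot :=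
  Word.wordRel (List.forall₂_same.2 fun a _ => a.mapsTo_refl)

theorem exists_letter {p : GMPerversity n} {i : ℤ} (a : A.obj p i) :
    ∃ b : A.Letter, b.tot = Total.of A p i a := by
  obtain ⟨j, rfl⟩ : ∃ j, i = j + 1 := ⟨i - 1, by ring⟩
  exact ⟨⟨p, j, a⟩, rfl⟩

/-- Multilinear functions are equal if they agree on words. -/
theorem multi_ext {N : Type*} [AddCommGroup N] [Module R N] {Φ Ψ : ConvAlg A.Total N}
    (hΦ : IsMulti R Φ) (hΨ : IsMulti R Ψ) (h : ∀ w : A.Word, Φ w.tot = Ψ w.tot) : Φ = Ψ := by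
  refine ext_apply fun l => ?_
  suffices H : ∀ (l : List A.Total) (w : A.Word), Φ (w.tot ++ l) = Ψ (w.tot ++ l) from H l []
  intro l
  induction l with
  | nil => intro w; simpa using h w
  | cons x l ih =>
    intro w
    induction x using Total.induction with
    | zero => rw [hΦ.zero_entry, hΨ.zero_entry]
    | add x y hx hy => rw [hΦ.add, hΨ.add, hx, hy]
    | of p i a =>
      obtain ⟨b, hb⟩ := exists_letter a
      have := ih (w ++ [b])
      simpa [Word.tot, hb] using this

/-- On a homogeneous word `τ k` acts by a scalar in each letter; multilinearity collects these into
the sign of the total suspended degree. -/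
theorem tot_map_τ {N : Type*} [AddCommGroup N] [Module R N] {Φ : ConvAlg A.Total N}
    (hΦ : IsMulti R Φ) (k : ℤ) (w : A.Word) (a b : List A.Total) :
    Φ (a ++ w.tot.map (A.signed.τ k) ++ b) = sgn R (k * w.deg) • Φ (a ++ w.tot ++ b) := by
  induction w generalizing a with
  | nil => simp [Word.tot, Word.deg_nil, sgn]
  | cons c w ih =>
    have h₁ : A.signed.τ k c.tot = sgn R (k * c.deg) • c.tot := by
      have := Total.τ_of (A := A) k c.val
      rwa [add_sub_cancel_right] at this
    have e₁ : a ++ (Word.tot (c :: w)).map (A.signed.τ k) ++ b =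
        a ++ (sgn R (k * c.deg) • c.tot) :: ((Word.tot w).map (A.signed.τ k) ++ b) := by
      simp [Word.tot, h₁]
    have e₂ := ih (a ++ [c.tot])
    have e₃ : a ++ Word.tot (c :: w) ++ b = a ++ [c.tot] ++ Word.tot w ++ b := by simp [Word.tot]
    rw [e₁, hΦ.smul, e₃, Word.deg_cons, mul_add, sgn_add, ← smul_smul, ← e₂]
    simp

/-- A typed function shifts degrees by a fixed amount, so the sign rule of `HasDeg` is automatic. It
is checked on words, where both sides are the same value up to scalars. -/
theorem Typed.hasDeg {x : Fin (n + 1) → ℕ} {f : ℤ} {F : ConvAlg A.Total A.Total}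
    (hF : Typed x f F) (hm : IsMulti R F) : A.signed.HasDeg f F := fun k => by
  refine multi_ext (hm.twist _) ((hm.post _).smulFun _) fun w => ?_
  have h := tot_map_τ hm k w [] []
  rw [List.append_nil, List.append_nil, List.nil_append, List.nil_append] at h
  rw [ConvAlg.twist_apply, h, ConvAlg.smul_apply, post_apply]
  have hr := hF.rel w.wordRel_self rfl
  obtain ⟨hx, y, h₁, -⟩ := hr
  have hτ : A.signed.τ k (F w.tot) = sgn R (k * (w.deg + f)) • F w.tot := by
    rw [h₁]
    by_cases hx : Bdd (x + w.per)
    · rw [inc_of_bdd hx]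
      have := Total.τ_of (A := A) k y
      rwa [add_sub_cancel_right] at this
    · rw [inc_of_not_bdd hx, map_zero, smul_zero]
  rw [hτ, smul_smul, mul_add, sgn_add, mul_comm (sgn R (k * f)), _root_.mul_assoc, sgn_mul_self,
    _root_.mul_one]

end PerverseDGA
end

noncomputable section
open ConvAlg

/-- The insertion of the structure maps, as a sum over the letters of a list. -/
theorem SignedDGA.ins_str_map {R V N W : Type*} [CommRing R] [Ring V] [Algebra R V]
    [AddCommGroup N] [Module R N] {S : SignedDGA R V} (t : W → V) (w : List W)
    {Φ : ConvAlg V N} (hΦ : IsMulti R Φ) :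
    ins (S.τ 1) S.str Φ (w.map t) =
      ∑ i : Fin w.length,
        Φ (((w.take i).map t).map (S.τ 1) ++ S.d (t w[i]) :: (w.drop (i + 1)).map t) -
      ∑ i : Fin (w.length - 1), Φ (((w.take i).map t).map (S.τ 1) ++
        (S.τ 1 (t w[i]) * t w[(i : ℕ) + 1]) :: (w.drop (i + 2)).map t) := by
  induction w generalizing Φ with
  | nil =>
    rw [Finset.sum_eq_zero fun i _ => i.elim0, Finset.sum_eq_zero fun i _ => i.elim0, sub_zero]
    exact insHead_str_nil hΦ
  | cons a w ih =>
    have ih' : ins (S.τ 1) S.str (.ofFun fun w => Φ (S.τ 1 (t a) :: w)) (w.map t) = _ :=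
      ih (hΦ.shift [S.τ 1 (t a)])
    rw [List.map_cons, ins_cons, ih']
    cases w with
    | nil =>
      rw [List.map_nil, insHead_str_one hΦ]
      simp
    | cons b w =>
      rw [List.map_cons, insHead_str_cons_cons hΦ]
      have e₁ := Fin.sum_univ_succ (n := (b :: w).length) (fun i : Fin ((b :: w).length + 1) =>
        Φ ((((a :: b :: w).take i).map t).map (S.τ 1) ++
          S.d (t (a :: b :: w)[i]) :: ((a :: b :: w).drop (i + 1)).map t))
      have e₂ := Fin.sum_univ_succ (n := w.length) (fun i : Fin (w.length + 1) =>
        Φ ((((a :: b :: w).take i).map t).map (S.τ 1) ++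
          (S.τ 1 (t ((a :: b :: w)[(i : ℕ)]'(by simp only [List.length_cons]; omega))) *
            t ((a :: b :: w)[(i : ℕ) + 1]'(by simp only [List.length_cons]; omega))) ::
            ((a :: b :: w).drop (i + 2)).map t))
      refine Eq.trans ?_ (congrArg₂ (· - ·) e₁ e₂).symm
      exact sub_add_sub_comm _ _ _ _

namespace PerverseDGA

open GMPerversity

variable {R : Type u} [CommRing R] {n : ℕ} {A : PerverseDGA.{u, v} R n}

/-! ### Values of functions on words -/

section Val

variable {x x' z z' y : Fin (n + 1) → ℕ} {p p₁ p₂ : GMPerversity n} {i j k : ℤ} {a a' b b' : A.Total}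

/-- The image in `A_p^j` of an element of perversity `x ≤ p` and degree `j`. -/
def valₗ (h : x ≤ p.toFun) (j : ℤ) : A.Total →ₗ[R] A.obj p j :=
  A.map (ceil_le h) ∘ₗ Total.comp A (ceil x) j

theorem valₗ_inc (h : x ≤ p.toFun) (c : A.obj (ceil x) j) :
    valₗ h j (inc A x j c) = A.map (ceil_le h) c := by
  rw [inc_of_bdd ⟨p, h⟩, valₗ, LinearMap.comp_apply, Total.comp_of]

theorem Rel.val (hr : Rel x x' j a a') (h : x ≤ p.toFun) (h' : x' ≤ p.toFun) :
    valₗ h j a = valₗ h' j a' := by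
  obtain ⟨hx, c, rfl, rfl⟩ := hr
  rw [valₗ_inc, valₗ_inc, A.map_map]

theorem Rel.val_d (hr : Rel x x' i a a') (h : x ≤ p.toFun) (hj : i + 1 = j) :
    valₗ h j (A.signed.d a) = A.d hj (valₗ h i a) := by
  obtain ⟨hx, c, rfl, -⟩ := hr
  have : A.signed.d (inc A x i c) = inc A x j (A.d hj c) := by
    rw [inc_of_bdd ⟨p, h⟩, inc_of_bdd ⟨p, h⟩]
    exact Total.d_of hj c
  rw [this, valₗ_inc, valₗ_inc, A.d_map]

theorem Rel.val_mul (hx : Monotone x) (hz : Monotone z) (ha : Rel x x' i a a')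
    (hb : Rel z z' j b b') (e : x + z = y) (hy : y ≤ p.toFun) (h₁ : x ≤ p₁.toFun)
    (h₂ : z ≤ p₂.toFun) (hp : p₁.toFun + p₂.toFun ≤ p.toFun) (hk : i + j = k) :
    valₗ hy k (a * b) = A.mul hp hk (valₗ h₁ i a) (valₗ h₂ j b) := by
  subst e
  obtain ⟨_, c, rfl, -⟩ := ha
  obtain ⟨_, c', rfl, -⟩ := hb
  rw [inc_mul_inc hx hz ⟨p, hy⟩ hk, valₗ_inc, valₗ_inc, valₗ_inc, A.map_mul]

theorem rel_of (h : x ≤ p.toFun) (c : A.obj (ceil x) j) :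
    Rel x p.toFun j (inc A x j c) (Total.of A p j (A.map (ceil_le h) c)) := by
  have key : ∀ (q : GMPerversity n) (hq : q = p) (hxq : ceil x ≤ q),
      Total.of A p j (A.map (ceil_le h) c) = Total.of A q j (A.map hxq c) := by
    rintro q rfl hxq
    rfl
  exact ⟨h, c, rfl, by rw [inc_of_bdd (bdd_self p), key _ (ceil_self p)]⟩

/-- A homogeneous element of unrounded perversity `x` is related to its image in any component whose
perversity bounds `x`. This allows a value of a function to be replaced by a letter of larger
perversity. -/
theorem Rel.to_of (hr : Rel x x' j a a') (h : x ≤ p.toFun) :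
    Rel x p.toFun j a (Total.of A p j (valₗ h j a)) := by
  obtain ⟨_, c, rfl, -⟩ := hr
  rw [valₗ_inc]
  exact rel_of h c

theorem Letter.rel_self (a : A.Letter) : Rel a.per.toFun a.per.toFun (a.deg + 1) a.tot a.tot := by
  have := exists_inc (le_refl a.per) a.val
  rwa [A.map_id] at this

theorem Letter.val_tot (a : A.Letter) : valₗ (le_refl a.per.toFun) (a.deg + 1) a.tot = a.val := by
  have h := a.rel_self.to_of le_rfl
  have h' := h.val le_rfl le_rfl
  have key : ∀ (q : GMPerversity n) (hq : q = a.per) (hqp : q ≤ a.per),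
      A.map hqp (Total.comp A q (a.deg + 1) a.tot) = a.val := by
    rintro q rfl hqp
    rw [A.map_id]
    exact Total.comp_of _
  exact key _ (ceil_self _) _

theorem Letter.tot_d (a : A.Letter) : a.d.tot = A.signed.d a.tot :=
  (Total.d_of rfl a.val).symm

theorem Letter.tot_mul (a b : A.Letter) (h : a.per.toFun + b.per.toFun ≤ p.toFun) :
    (a.mul b h).tot = a.tot * b.tot :=
  (Total.of_mul_of a.val b.val _ rfl (by simp only [Letter.mul]; ring)).symm

theorem Letter.rel_mul (a b : A.Letter) (h : a.per.toFun + b.per.toFun ≤ p.toFun) :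
    Rel (a.per.toFun + b.per.toFun) (a.mul b h).per.toFun ((a.mul b h).deg + 1) (a.tot * b.tot)
      (a.mul b h).tot := by
  have e : a.deg + 1 + (b.deg + 1) = (a.mul b h).deg + 1 := by simp only [Letter.mul]; ring
  have hr := Rel.mul a.per.monotone a.per.monotone b.per.monotone b.per.monotone a.rel_self
    b.rel_self e
  have hc : a.per.toFun + b.per.toFun ≤ (a.mul b h).per.toFun := le_ceil h
  have h₁ := hr.to_of hc
  obtain ⟨_, c, hc', -⟩ := hr
  have hid : A.map (ceil_le hc) c = c := A.map_id c
  rw [hc', valₗ_inc, hid] at h₁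
  rw [Letter.tot_mul, hc']
  rwa [inc_of_bdd ⟨p, h⟩] at h₁ ⊢

end Val

/-! ### Comparison of operations on lists with the explicit formulas on words -/

section ToWordFun

variable {x z : Fin (n + 1) → ℕ} {r r₁ r₂ s p : GMPerversity n} {q q' q₁ q₂ q₃ f : ℤ}
  {F G : ConvAlg A.Total A.Total}

/-- In a common target, values on related lists agree. This is what makes the roundings in the
explicit formulas, which enlarge the perversity of intermediate letters, harmless. -/
theorem Typed.val_congr (hF : Typed x f F) {y y' X X' : Fin (n + 1) → ℕ} {j k : ℤ}
    {l l' : List A.Total} (hl : WordRel y y' j l l') (hk : j + f + 1 = k) (e : x + y = X)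
    (e' : x + y' = X') (h : X ≤ p.toFun) (h' : X' ≤ p.toFun) :
    valₗ h k (F l) = valₗ h' k (F l') := by
  subst e e'
  exact Rel.val (hF.rel hl hk) h _

/-- The values on words of a function of perversity `x ≤ r`. -/
def toWordFun (hx : x ≤ r.toFun) (q : ℤ) (F : ConvAlg A.Total A.Total) : A.WordFun r q := fun i =>
  valₗ ((add_le_add_left hx _).trans i.le) i.tgtDeg (F i.word.tot)

theorem toWordFun_add (hx : x ≤ r.toFun) (q : ℤ) (F G : ConvAlg A.Total A.Total) :
    toWordFun hx q (F + G) = toWordFun hx q F + toWordFun hx q G := funext fun _ => map_add _ _ _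

theorem toWordFun_sub (hx : x ≤ r.toFun) (q : ℤ) (F G : ConvAlg A.Total A.Total) :
    toWordFun hx q (F - G) = toWordFun hx q F - toWordFun hx q G := funext fun _ => map_sub _ _ _

theorem toWordFun_smul (hx : x ≤ r.toFun) (q : ℤ) (c : R) (F : ConvAlg A.Total A.Total) :
    toWordFun hx q (c • F) = c • toWordFun hx q F := funext fun _ => LinearMap.map_smul _ _ _

theorem toWordFun_zero (hx : x ≤ r.toFun) (q : ℤ) :
    toWordFun hx q (0 : ConvAlg A.Total A.Total) = 0 := funext fun _ => map_zero _

theorem Word.tot_append (w w' : A.Word) : Word.tot (w ++ w') = Word.tot w ++ Word.tot w' :=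
  List.map_append

theorem Word.tot_cons (a : A.Letter) (w : A.Word) : Word.tot (a :: w) = a.tot :: Word.tot w := rfl

theorem apply_map_τ_append {N : Type*} [AddCommGroup N] [Module R N] {Φ : ConvAlg A.Total N}
    (hΦ : IsMulti R Φ) (k : ℤ) (w : A.Word) (b : List A.Total) :
    Φ ((Word.tot w).map (A.signed.τ k) ++ b) = sgn R (k * w.deg) • Φ (Word.tot w ++ b) :=
  tot_map_τ hΦ k w [] b

theorem apply_map_τ {N : Type*} [AddCommGroup N] [Module R N] {Φ : ConvAlg A.Total N}
    (hΦ : IsMulti R Φ) (k : ℤ) (w : A.Word) :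
    Φ ((Word.tot w).map (A.signed.τ k)) = sgn R (k * w.deg) • Φ (Word.tot w) := by
  simpa using apply_map_τ_append hΦ k w []

/-- A function is determined by its values on words. -/
theorem Typed.eq_zero (hF : Typed r.toFun f F) (hm : IsMulti R F) (hq : f + 1 = q)
    (h : toWordFun (le_refl r.toFun) q F = 0) : F = 0 := by
  refine multi_ext hm isMulti_zero fun w => ?_
  obtain ⟨_, c, hc, -⟩ := hF.rel w.wordRel_self (k := w.deg + q) (by omega)
  -- The target `ceil (r + w.per)` is the component in which the value on `w` lives, so no
  -- information is lost by the structure map. This requires the perversity of `F` to be exactly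
  -- `r`.
  by_cases hb : Bdd (r.toFun + w.per)
  · have h' : valₗ hb.le_ceil (w.deg + q) (F w.tot) = 0 :=
      congrFun h ⟨w, ceil (r.toFun + w.per), w.deg + q, hb.le_ceil, rfl⟩
    rw [hc, valₗ_inc, A.map_id] at h'
    rw [hc, h', map_zero]
    rfl
  · rw [hc, inc_of_not_bdd hb]
    rfl

theorem toWordFun_cup (hF : Typed x (q₁ - 1) F) (hG : Typed z (q₂ - 1) G) (hm : IsMulti R F)
    (hx : x ≤ r₁.toFun) (hz : z ≤ r₂.toFun) (hxz : x + z ≤ s.toFun)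
    (h : r₁.toFun + r₂.toFun ≤ s.toFun) (hq : q₁ + q₂ = q₃) :
    toWordFun hxz q₃ (A.signed.cup q₂ F G) =
      PerverseDGA.cup h hq (toWordFun hx q₁ F) (toWordFun hz q₂ G) := by
  funext ⟨w, p, j, hle, hdeg⟩
  show valₗ _ _ (splitSum _ (w.map Letter.tot)) = _
  rw [splitSum_map, splitSum_eq_sum, map_sum]
  refine Finset.sum_congr rfl fun i _ => ?_
  dsimp only [toWordFun]
  rw [negOnePow_smul_eq (R := R), ← Word.tot, ← Word.tot, ConvAlg.twist_apply, apply_map_τ hm,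
    smul_mul_assoc, map_smul]
  congr 1
  refine Rel.val_mul (monotone_add hF.monotone (Word.per_monotone _))
    (monotone_add hG.monotone (Word.per_monotone _))
    (hF.rel (Word.wordRel_self _) (by ring)) (hG.rel (Word.wordRel_self _) (by ring)) ?_ _ _ _ _ _
  rw [add_add_add_comm, ← Word.per_append, List.take_append_drop]

theorem Typed.rel_letterOf (hG : Typed z (q - 1) G) (hz : z ≤ r.toFun) (w : A.Word)
    (h : r.toFun + w.per ≤ p.toFun) :
    Rel (z + w.per) (letterOf (toWordFun hz q G) w h).per.toFun
      ((letterOf (toWordFun hz q G) w h).deg + 1) (G w.tot)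
      (letterOf (toWordFun hz q G) w h).tot :=
  (hG.rel w.wordRel_self (by simp only [letterOf]; ring)).to_of _

theorem toWordFun_circ (hF : Typed x (q₁ - 1) F) (hG : Typed z (q₂ - 1) G) (hm : IsMulti R F)
    (hx : x ≤ r₁.toFun) (hz : z ≤ r₂.toFun) (hxz : x + z ≤ s.toFun)
    (h : r₁.toFun + r₂.toFun ≤ s.toFun) (hq : q₁ + q₂ - 1 = q₃) :
    toWordFun hxz q₃ (A.signed.circ (q₂ - 1) F G) =
      PerverseDGA.circ h hq (toWordFun hx q₁ F) (toWordFun hz q₂ G) := by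
  funext ⟨w, p, j, hle, hdeg⟩
  show valₗ _ _ (splitSum _ (w.map Letter.tot)) = _
  rw [splitSum_map, splitSum_eq_sum, map_sum]
  refine Finset.sum_congr rfl fun i _ => ?_
  dsimp only
  rw [splitSum_map, splitSum_eq_sum, map_sum]
  -- The inner sum runs over the splittings of `w.drop i`, whose number is `w.length + 1 - i`.
  refine Fintype.sum_equiv (finCongr (by simp; omega)) _ _ fun l => ?_
  dsimp only [toWordFun, finCongr_apply, Fin.val_cast]
  rw [negOnePow_smul_eq (R := R), ← Word.tot, ← Word.tot, ← Word.tot, apply_map_τ_append hm,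
    map_smul]
  congr 1
  -- The value `G b` and the letter in the explicit formula differ by a structure map, from
  -- perversity `z + b.per` to the rounded `r₂ + b.per`; hence they are related and `F` cannot
  -- distinguish them in the target.
  have hr := hG.rel_letterOf hz ((w.drop i).take l)
    (GMPerversity.le_of_add_le_left (circ_aux h ⟨w, p, j, hle, hdeg⟩ i l))
  have hw := (Word.wordRel_self (w.take i)).append (.cons
    (monotone_add hG.monotone (Word.per_monotone _)) (GMPerversity.monotone _) hr
    (Word.wordRel_self ((w.drop i).drop l)))
  have e : insertWord h (toWordFun hz q₂ G) ⟨w, p, j, hle, hdeg⟩ i l = w.take i ++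
    letterOf (toWordFun hz q₂ G) ((w.drop i).take l)
      (GMPerversity.le_of_add_le_left (circ_aux h ⟨w, p, j, hle, hdeg⟩ i l)) ::
      (w.drop i).drop l := rfl
  have hd := congrArg Word.deg (Word.split_three w i l)
  have hp := congrArg Word.per (Word.split_three w i l)
  rw [Word.deg_append, Word.deg_append] at hd
  rw [Word.per_append, Word.per_append] at hp
  have ht : Word.tot (insertWord h (toWordFun hz q₂ G) ⟨w, p, j, hle, hdeg⟩ i l) = _ :=
    congrArg Word.tot e
  rw [Word.tot_append, Word.tot_cons] at ht
  have he : Word.per (insertWord h (toWordFun hz q₂ G) ⟨w, p, j, hle, hdeg⟩ i l) = _ :=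
    congrArg Word.per e
  rw [Word.per_append, Word.per_cons] at he
  have key := hF.val_congr (k := j) hw (by simp only [letterOf]; omega)
    (show _ = x + z + w.per by rw [← hp]; abel) (by rw [he])
    ((add_le_add_left hxz _).trans hle)
    ((add_le_add_left hx _).trans
      (insertWord_le h (toWordFun hz q₂ G) ⟨w, p, j, hle, hdeg⟩ i l))
  rw [← ht] at key
  exact key

theorem toWordFun_bracket (hF : Typed x (q₁ - 1) F) (hG : Typed z (q₂ - 1) G) (hm : IsMulti R F)
    (hm' : IsMulti R G) (hx : x ≤ r₁.toFun) (hz : z ≤ r₂.toFun) (hxz : x + z ≤ s.toFun)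
    (h : r₁.toFun + r₂.toFun ≤ s.toFun) (hq : q₁ + q₂ - 1 = q₃) :
    toWordFun hxz q₃ (A.signed.br (q₁ - 1) (q₂ - 1) F G) =
      PerverseDGA.bracket h hq (toWordFun hx q₁ F) (toWordFun hz q₂ G) := by
  have e : ∀ (y : Fin (n + 1) → ℕ) (hy : y = x + z) (hys : y ≤ s.toFun) (K : ConvAlg A.Total A.Total),
      toWordFun hxz q₃ K = toWordFun hys q₃ K := by
    rintro y rfl _ _
    rfl
  rw [SignedDGA.br, toWordFun_sub, toWordFun_smul, toWordFun_circ hF hG hm hx hz hxz h hq,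
    e (z + x) (add_comm _ _) (add_le_comm hxz), toWordFun_circ hG hF hm' hz hx _ (add_le_comm h)
      (by omega), PerverseDGA.bracket]
  congr 1
  funext i
  exact (negOnePow_smul_eq (R := R) _ _).symm

theorem toWordFun_D (hF : Typed x (q - 1) F) (hm : IsMulti R F) (hx : x ≤ r.toFun)
    (hq : q + 1 = q') : toWordFun hx q' (A.signed.D (q - 1) F) = diff hq (toWordFun hx q F) := by
  funext ⟨w, p, j, hle, hdeg⟩
  have hle' : x + w.per ≤ p.toFun := (add_le_add_left hx _).trans hle
  have e₁ : valₗ hle' j (A.signed.d (F w.tot)) =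
      A.d (show w.deg + q + 1 = j by omega) (toWordFun hx q F ⟨w, p, w.deg + q, hle, rfl⟩) :=
    (hF.rel w.wordRel_self (by ring)).val_d _ _
  -- The insertion of `str` gives the terms with `d a_i` and those with `a_i a_{i+1}`.
  have e₂ : sgn R q • valₗ hle' j (A.signed.circ 1 F A.signed.str w.tot) =
      (∑ i : Fin w.length, (Word.deg (w.take i) + q).negOnePow • toWordFun hx q F
        ⟨w.dAt i i.2, p, j, dAt_le ⟨w, p, j, hle, hdeg⟩ i i.2, dAt_deg hq ⟨w, p, j, hle, hdeg⟩ i i.2⟩) -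
      ∑ i : Fin (w.length - 1), (Word.deg (w.take (i + 1)) + q).negOnePow • toWordFun hx q F
        ⟨mulWord ⟨w, p, j, hle, hdeg⟩ i (by simp; omega), p, j, mulWord_le ⟨w, p, j, hle, hdeg⟩ i _,
          mulWord_deg hq ⟨w, p, j, hle, hdeg⟩ i _⟩ := by
    have := SignedDGA.ins_str_map (S := A.signed) Letter.tot w hm
    rw [SignedDGA.circ, Word.tot, this, map_sub, map_sum, map_sum, smul_sub, Finset.smul_sum,
      Finset.smul_sum]
    congr 1
    · refine Finset.sum_congr rfl fun i _ => ?_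
      rw [negOnePow_smul_eq (R := R), ← Word.tot, apply_map_τ_append hm, map_smul, smul_smul,
        ← sgn_add, _root_.one_mul, add_comm q]
      congr 1
      have ht : Word.tot (w.take i) ++ A.signed.d w[i].tot :: (w.drop (i + 1)).map Letter.tot =
          Word.tot (w.dAt i i.2) := by
        rw [Word.dAt, Word.tot_append, Word.tot_cons, Letter.tot_d]
        rfl
      have hs := Word.split_one w i i.2
      rw [ht]
      refine hF.val_congr (Word.wordRel_self (w.dAt i i.2)) ?_ ?_ rfl _ _
      · have := dAt_deg hq ⟨w, p, j, hle, hdeg⟩ i i.2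
        dsimp only at this
        omega
      · conv_rhs => rw [← hs]
        rw [Word.dAt, Word.per_append, Word.per_append, Word.per_cons, Word.per_cons]
        rfl
    · refine Finset.sum_congr rfl fun i _ => ?_
      have hi : (i : ℕ) + 1 < w.length := by omega
      have hs := Word.split_two w i hi
      -- The binary part of `str` multiplies with `τ 1` of the first letter. This supplies the
      -- degree of that letter, so the sign exponent runs over the first `i + 1` letters.
      have hτ : A.signed.τ 1 w[i].tot = sgn R w[i].deg • w[i].tot := by
        have := Total.τ_of (A := A) 1 w[i].val
        rwa [add_sub_cancel_right, _root_.one_mul] at this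
      have hdt : Word.deg (w.take (i + 1)) = Word.deg (w.take i) + w[i].deg := by
        rw [List.take_succ_eq_append_getElem (by omega), Word.deg_append, Word.deg_cons,
          Word.deg_nil, add_zero]
        rfl
      rw [negOnePow_smul_eq (R := R), ← Word.tot, apply_map_τ_append hm, hτ, smul_mul_assoc,
        hm.smul, smul_smul, map_smul, smul_smul, ← sgn_add, ← sgn_add, _root_.one_mul, hdt,
        add_comm q]
      congr 1
      have hr := Letter.rel_mul w[i] w[(i : ℕ) + 1]
        (GMPerversity.le_of_add_le_left (mulLetter_aux ⟨w, p, j, hle, hdeg⟩ i hi))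
      have hw := (Word.wordRel_self (w.take i)).append (.cons
        (monotone_add (GMPerversity.monotone _) (GMPerversity.monotone _))
        (GMPerversity.monotone _) hr (Word.wordRel_self (w.drop (i + 2))))
      have e : mulWord ⟨w, p, j, hle, hdeg⟩ i hi = w.take i ++
        w[i].mul w[(i : ℕ) + 1] (GMPerversity.le_of_add_le_left
          (mulLetter_aux ⟨w, p, j, hle, hdeg⟩ i hi)) :: w.drop (i + 2) := rfl
      have ht : Word.tot (mulWord ⟨w, p, j, hle, hdeg⟩ i hi) = _ := congrArg Word.tot e
      rw [Word.tot_append, Word.tot_cons] at ht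
      have he : Word.per (mulWord ⟨w, p, j, hle, hdeg⟩ i hi) = _ := congrArg Word.per e
      rw [Word.per_append, Word.per_cons] at he
      have hd : Word.deg (mulWord ⟨w, p, j, hle, hdeg⟩ i hi) = _ := congrArg Word.deg e
      rw [Word.deg_append, Word.deg_cons] at hd
      have hd' := mulWord_deg hq ⟨w, p, j, hle, hdeg⟩ i hi
      dsimp only [toWordFun]
      rw [ht]
      refine hF.val_congr hw ?_ ?_ (by rw [he]) _ _
      · rw [← hd]
        dsimp only at hd'
        omega
      · conv_rhs => rw [← hs]
        rw [Word.per_append, Word.per_cons, Word.per_cons, add_assoc w[i].per.toFun]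
        rfl
  have e₃ : ∀ hw : w ≠ [], valₗ hle' j (A.signed.cup q (SignedDGA.proj A.Total) F w.tot) =
      (((w.head hw).deg + 1 + 1) * q).negOnePow •
        headTerm hq (toWordFun hx q F) ⟨w, p, j, hle, hdeg⟩ hw := fun hw => by
    have hs := List.cons_head_tail hw
    have ht : w.tot = (w.head hw).tot :: Word.tot w.tail := by rw [← Word.tot_cons, hs]
    have hτ : A.signed.τ q (w.head hw).tot = sgn R (q * (w.head hw).deg) • (w.head hw).tot := by
      have := Total.τ_of (A := A) q (w.head hw).val
      rwa [add_sub_cancel_right] at this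
    -- The exponent `(|a_1| + 1)|f|` of the formula exceeds the Koszul exponent `(|a_1| - 1)|f|` by
    -- an even number.
    have hsg : sgn R (((w.head hw).deg + 1 + 1) * q) = sgn R (q * (w.head hw).deg) := by
      rw [show ((w.head hw).deg + 1 + 1) * q = q * (w.head hw).deg + (q + q) by ring, sgn_add,
        sgn_add q, sgn_mul_self, _root_.mul_one]
    rw [ht, SignedDGA.proj_cup_cons, hτ, smul_mul_assoc, map_smul, negOnePow_smul_eq (R := R), hsg]
    congr 1
    have := Rel.val_mul (k := j) (GMPerversity.monotone _)
      (monotone_add hF.monotone (Word.per_monotone _)) (w.head hw).rel_self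
      (hF.rel (Word.wordRel_self w.tail) (show _ = Word.deg w.tail + q by ring))
      (show _ = x + w.per by
        conv_rhs => rw [← hs]
        rw [Word.per_cons]; abel) hle' le_rfl
      (p₂ := ceil (r.toFun + Word.per w.tail)) (le_trans (add_le_add_left hx _) (GMPerversity.le_ceil
        (GMPerversity.le_of_add_le_left (head_le ⟨w, p, j, hle, hdeg⟩ hw))))
      (GMPerversity.add_ceil_le (GMPerversity.monotone_add r.monotone (Word.per_monotone _))
        (GMPerversity.monotone _) (head_le ⟨w, p, j, hle, hdeg⟩ hw)) (by
          have h := hdeg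
          rw [← hs, Word.deg_cons] at h
          omega)
    rw [this, Letter.val_tot]
    rfl
  have e₄ : ∀ hw : w ≠ [], sgn R q • valₗ hle' j (A.signed.cup 1 F (SignedDGA.proj A.Total) w.tot) =
      (Word.deg w.dropLast + q).negOnePow •
        lastTerm hq (toWordFun hx q F) ⟨w, p, j, hle, hdeg⟩ hw := fun hw => by
    have hs := List.dropLast_append_getLast hw
    have ht : w.tot = Word.tot w.dropLast ++ [(w.getLast hw).tot] := by
      conv_lhs => rw [← hs, Word.tot_append]
      rfl
    rw [ht, SignedDGA.cup_proj_concat, apply_map_τ hm, smul_mul_assoc, map_smul, smul_smul,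
      negOnePow_smul_eq (R := R), ← sgn_add, _root_.one_mul, add_comm q]
    congr 1
    have := Rel.val_mul (k := j) (monotone_add hF.monotone (Word.per_monotone _))
      (GMPerversity.monotone _)
      (hF.rel (Word.wordRel_self w.dropLast) (show _ = Word.deg w.dropLast + q by ring))
      (w.getLast hw).rel_self
      (show _ = x + w.per by
        conv_rhs => rw [← hs]
        rw [Word.per_append, Word.per_cons, Word.per_nil]; abel) hle'
      (p₁ := ceil (r.toFun + Word.per w.dropLast)) (le_trans (add_le_add_left hx _)
        (GMPerversity.le_ceil (GMPerversity.le_of_add_le_left (getLast_le ⟨w, p, j, hle, hdeg⟩ hw))))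
      le_rfl
      (GMPerversity.ceil_add_le (GMPerversity.monotone_add r.monotone (Word.per_monotone _))
        (GMPerversity.monotone _) (getLast_le ⟨w, p, j, hle, hdeg⟩ hw)) (by
          have h := hdeg
          rw [← hs, Word.deg_append, Word.deg_cons, Word.deg_nil] at h
          omega)
    rw [this, Letter.val_tot]
    rfl
  have hD : toWordFun hx q' (A.signed.D (q - 1) F) ⟨w, p, j, hle, hdeg⟩ =
      valₗ hle' j (A.signed.d (F w.tot)) -
        valₗ hle' j (A.signed.cup q (SignedDGA.proj A.Total) F w.tot) +
        (sgn R q • valₗ hle' j (A.signed.cup 1 F (SignedDGA.proj A.Total) w.tot) +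
          sgn R q • valₗ hle' j (A.signed.circ 1 F A.signed.str w.tot)) := by
    rw [← smul_add, ← map_add, ← map_sub, ← map_smul, ← map_add, SignedDGA.D, sub_add_cancel]
    rfl
  rw [hD, e₁, e₂]
  have hR : diff hq (toWordFun hx q F) ⟨w, p, j, hle, hdeg⟩ =
    diffInt hq (toWordFun hx q F) ⟨w, p, j, hle, hdeg⟩ +
      diffExt hq (toWordFun hx q F) ⟨w, p, j, hle, hdeg⟩ := rfl
  rw [hR]
  simp only [diffInt, diffExt]
  -- On the empty word both multiplication terms vanish, in accordance with the `if` in `diffExt`.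
  by_cases hw : w = []
  · subst hw
    rw [dif_neg (by simp), show Word.tot ([] : A.Word) = [] from rfl, SignedDGA.proj_cup_nil,
      SignedDGA.cup_proj_nil, map_zero, smul_zero]
    abel
  · rw [dif_pos hw, e₃ hw, e₄ hw]
    abel

end ToWordFun
end PerverseDGA
end

noncomputable section
open ConvAlg

namespace PerverseDGA

open GMPerversity PerverseGradedModule

variable {R : Type u} [CommRing R] {n : ℕ} {A : PerverseDGA.{u, v} R n}

/-! ### Pure tensors in the bar construction -/

section Bar

variable {k : ℕ} {p p' : GMPerversity n} {d : ℤ}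

open Classical in
/-- Pure tensors of elements of `s Ā`. -/
def tensorMulti (x : TensorIndex n k p d) :
    MultilinearMap R (fun t => A.suspBar.obj (x.per t) (x.deg t)) (A.barConstruction.obj p d) :=
  (DirectSum.lof R ℕ (fun k => A.suspBar.TensorPower k p d) k ∘ₗ
    (A.suspBar.tensorRel k p d).mkQ ∘ₗ
    DirectSum.lof R (TensorIndex n k p d)
      (fun x => ⨂[R] t, A.suspBar.obj (x.per t) (x.deg t)) x).compMultilinearMap
    (PiTensorProduct.tprod R)

/-- The class of an element of `A` in `s Ā`. -/
def suspMk (p : GMPerversity n) (i : ℤ) : A.obj p (i + 1) →ₗ[R] A.suspBar.obj p i :=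
  (A.unitSubmodule p (i + 1)).mkQ

theorem suspMk_surjective (p : GMPerversity n) (i : ℤ) :
    Function.Surjective (suspMk (A := A) p i) := Submodule.mkQ_surjective _

theorem suspMk_eq_zero {i : ℤ} {a : A.obj p (i + 1)} (h : a ∈ A.unitSubmodule p (i + 1)) :
    suspMk p i a = 0 := (Submodule.Quotient.mk_eq_zero _).2 h

theorem map_tensorMulti (h : p ≤ p') (x : TensorIndex n k p d)
    (c : ∀ t, A.suspBar.obj (x.per t) (x.deg t)) :
    A.barConstruction.map h (tensorMulti x c) = tensorMulti (x.mono h) c := by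
  refine (DirectSum.lmap_lof _ _ _).trans (congrArg _ ?_)
  exact congrArg (Submodule.Quotient.mk (p := A.suspBar.tensorRel k p' d))
    (A.suspBar.preTensorMap_preTensor h x c)

/-- The defining relation of the colimit: a pure tensor equals the tensor of its images under the
structure maps. -/
theorem tensorMulti_map (x : TensorIndex n k p d) (p₁ : Fin k → GMPerversity n)
    (h : ∑ t, (p₁ t).toFun ≤ p.toFun) (hp : ∀ t, x.per t ≤ p₁ t)
    (c : ∀ t, A.suspBar.obj (x.per t) (x.deg t)) :
    tensorMulti x c = tensorMulti ⟨p₁, x.deg, h, x.deg_eq⟩ fun t => A.suspBar.map (hp t) (c t) := by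
  refine congrArg (DirectSum.lof R ℕ (fun k => A.suspBar.TensorPower k p d) k) ?_
  refine (Submodule.Quotient.eq _).2 ?_
  exact Submodule.subset_span ⟨x, p₁, h, hp, c, rfl⟩

/-- Linear maps on the bar construction are determined by their values on pure tensors. -/
theorem bar_ext {N : Type*} [AddCommGroup N] [Module R N]
    {φ ψ : A.barConstruction.obj p d →ₗ[R] N}
    (h : ∀ k (x : TensorIndex n k p d) (c : ∀ t, A.obj (x.per t) (x.deg t + 1)),
      φ (tensorMulti x fun t => suspMk _ _ (c t)) = ψ (tensorMulti x fun t => suspMk _ _ (c t))) :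
    φ = ψ := by
  classical
  refine DirectSum.linearMap_ext R fun k => Submodule.linearMap_qext _ ?_
  refine DirectSum.linearMap_ext R fun x => PiTensorProduct.ext (MultilinearMap.ext fun c => ?_)
  choose b hb using fun t => suspMk_surjective _ _ (c t)
  obtain rfl : (fun t => suspMk _ _ (b t)) = c := funext hb
  exact h k x b

/-- The index of a family of letters. -/
def letterIndex (L : Fin k → A.Letter) (hp : ∑ t, (L t).per.toFun ≤ p.toFun)
    (hd : ∑ t, (L t).deg = d) : TensorIndex n k p d :=
  ⟨fun t => (L t).per, fun t => (L t).deg, hp, hd⟩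

theorem Word.bar_eq {w : A.Word} (e : w.length = k) (L : Fin k → A.Letter)
    (hL : ∀ t, L t = w.get (t.cast e.symm)) (hp : ∑ t, (L t).per.toFun ≤ p.toFun)
    (hd : ∑ t, (L t).deg = d) (hp' : w.per ≤ p.toFun) (hd' : w.deg = d) :
    w.bar hp' hd' = tensorMulti (letterIndex L hp hd) fun t => suspMk _ _ (L t).val := by
  subst e
  obtain rfl : L = w.get := funext hL
  rfl

theorem Word.per_ofFn (L : Fin k → A.Letter) :
    Word.per (List.ofFn L) = ∑ t, (L t).per.toFun := by
  rw [Word.per, List.map_ofFn, List.sum_ofFn]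
  rfl

theorem Word.deg_ofFn (L : Fin k → A.Letter) : Word.deg (List.ofFn L) = ∑ t, (L t).deg := by
  rw [Word.deg, List.map_ofFn, List.sum_ofFn]
  rfl

theorem Word.bar_ofFn (L : Fin k → A.Letter) (hp : ∑ t, (L t).per.toFun ≤ p.toFun)
    (hd : ∑ t, (L t).deg = d) :
    Word.bar (List.ofFn L) ((Word.per_ofFn L).trans_le hp) ((Word.deg_ofFn L).trans hd) =
      tensorMulti (letterIndex L hp hd) fun t => suspMk _ _ (L t).val :=
  Word.bar_eq (List.length_ofFn) L (fun t => by simp) hp hd _ _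

theorem Word.map_bar (h : p ≤ p') (w : A.Word) (hp : w.per ≤ p.toFun) (hd : w.deg = d) :
    A.barConstruction.map h (w.bar hp hd) = w.bar (hp.trans h) hd :=
  map_tensorMulti h _ _

theorem Word.bar_mapsTo {w w' : A.Word} (h : List.Forall₂ Letter.MapsTo w w')
    (hp : w.per ≤ p.toFun) (hd : w.deg = d) (hp' : w'.per ≤ p.toFun) (hd' : w'.deg = d) :
    w.bar hp hd = w'.bar hp' hd' := by
  obtain ⟨hlen, hget⟩ := List.forall₂_iff_get.1 h
  choose P hP hP' using fun t : Fin w.length => hget t t.2 (hlen ▸ t.2)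
  have hs : ∑ t, (P t).toFun = w'.per := by
    rw [Word.per, ← Fin.sum_univ_fun_getElem]
    refine Fintype.sum_equiv (finCongr hlen) _ _ fun t => ?_
    exact congrArg (fun a : A.Letter => a.per.toFun) (hP' t).symm
  have hs' : ∑ t, (w.get t).deg = d := (Fin.sum_univ_fun_getElem w fun a => a.deg).trans hd
  rw [Word.bar_eq hlen.symm (fun t => ⟨P t, (w.get t).deg, A.map (hP t) (w.get t).val⟩)
    (fun t => (hP' t).symm) (hs.trans_le hp') hs']
  exact tensorMulti_map (letterIndex w.get _ _) P (hs.trans_le hp') hP _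

theorem exists_ofFn_update (u v : A.Word) :
    ∃ (k : ℕ) (L : Fin k → A.Letter) (t : Fin k),
      ∀ c, u ++ c :: v = List.ofFn (Function.update L t c) := by
  induction u with
  | nil =>
    refine ⟨v.length + 1, Fin.cons ⟨0, 0, 0⟩ v.get, 0, fun c => ?_⟩
    rw [Fin.update_cons_zero, List.ofFn_cons, List.ofFn_get]
    rfl
  | cons a u ih =>
    obtain ⟨k, L, t, h⟩ := ih
    refine ⟨k + 1, Fin.cons a L, t.succ, fun c => ?_⟩
    rw [← Fin.cons_update, List.ofFn_cons, ← h]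
    rfl

/-- With the other letters fixed, `[…|a|…]` is a partial map of the multilinear tensor map, and it
depends on `a` only through its class in `s Ā`. -/
theorem Word.exists_bar_eq (u v : A.Word) (p₁ : GMPerversity n) (i : ℤ)
    (hp : Word.per u + (p₁.toFun + Word.per v) ≤ p.toFun)
    (hd : Word.deg u + (i + Word.deg v) = d) :
    ∃ φ : A.suspBar.obj p₁ i →ₗ[R] A.barConstruction.obj p d, ∀ a hp' hd',
      Word.bar (u ++ ⟨p₁, i, a⟩ :: v) hp' hd' = φ (suspMk p₁ i a) := by
  classical
  obtain ⟨k, L, t₀, h⟩ := exists_ofFn_update u v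
  have key : ∀ (L : Fin k → A.Letter) (c : A.Letter), L t₀ = c →
      ∑ t, (L t).per.toFun ≤ p.toFun → ∑ t, (L t).deg = d →
      ∃ φ : A.suspBar.obj c.per c.deg →ₗ[R] A.barConstruction.obj p d,
        ∀ (a : A.obj c.per (c.deg + 1)) hp' hd', Word.bar (List.ofFn (Function.update L t₀
          ⟨c.per, c.deg, a⟩)) hp' hd' = φ (suspMk c.per c.deg a) := by
    rintro L _ rfl hp₁ hd₁
    refine ⟨(tensorMulti (letterIndex L hp₁ hd₁)).toLinearMap (fun t => suspMk _ _ (L t).val) t₀,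
      fun a hp' hd' => ?_⟩
    have e : Function.update L t₀ ⟨(L t₀).per, (L t₀).deg, a⟩ = fun t =>
        ⟨(L t).per, (L t).deg, Function.update (fun t => (L t).val) t₀ a t⟩ := by
      funext t
      by_cases ht : t = t₀
      · subst ht; simp
      · simp [ht]
    have e' : (fun t => suspMk _ _ (Function.update (fun t => (L t).val) t₀ a t)) =
        Function.update (fun t => suspMk _ _ (L t).val) t₀ (suspMk _ _ a) := by
      funext t
      by_cases ht : t = t₀
      · subst ht; simp
      · simp [ht]
    refine (Word.bar_eq List.length_ofFn (fun t =>
        ⟨(L t).per, (L t).deg, Function.update (fun t => (L t).val) t₀ a t⟩) (fun t => ?_)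
        hp₁ hd₁ _ _).trans (congrArg (tensorMulti (letterIndex L hp₁ hd₁)) e')
    rw [e]
    simp
  -- The zero letter fixes the perversity and degree in position `t₀`; the actual letter is then
  -- supplied by a second update.
  have h0 := h ⟨p₁, i, 0⟩
  obtain ⟨φ, hφ⟩ := key (Function.update L t₀ ⟨p₁, i, 0⟩) ⟨p₁, i, 0⟩ (Function.update_self _ _ _)
    (by rw [← Word.per_ofFn, ← h0, Word.per_append, Word.per_cons]; exact hp)
    (by rw [← Word.deg_ofFn, ← h0, Word.deg_append, Word.deg_cons]; exact hd)
  refine ⟨φ, fun a hp' hd' => ?_⟩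
  have := hφ a
  simp only [Function.update_idem, ← h] at this
  exact this hp' hd'

end Bar

/-! ### Multilinear functions on words -/

section Extend

variable {N : Type w} [AddCommGroup N] [Module R N]

/-- Functions on words which are linear in each letter. -/
def IsMultiWord (φ : A.Word → N) : Prop := ∀ (u v : A.Word) (p : GMPerversity n) (i : ℤ),
  ∃ ψ : A.obj p (i + 1) →ₗ[R] N, ∀ a, φ (u ++ ⟨p, i, a⟩ :: v) = ψ a

variable (A N) in
/-- The module of functions on words which are linear in each letter. -/
def wordMulti : Submodule R (A.Word → N) where
  carrier := {φ | IsMultiWord φ}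
  add_mem' {φ φ'} h h' u v p i := by
    obtain ⟨ψ, hψ⟩ := h u v p i
    obtain ⟨ψ', hψ'⟩ := h' u v p i
    exact ⟨ψ + ψ', fun a => congrArg₂ (· + ·) (hψ a) (hψ' a)⟩
  zero_mem' _ _ _ _ := ⟨0, fun _ => rfl⟩
  smul_mem' s φ h u v p i := by
    obtain ⟨ψ, hψ⟩ := h u v p i
    exact ⟨s • ψ, fun a => congrArg (s • ·) (hψ a)⟩

/-- An element of degree `i` as an element of degree `(i - 1) + 1`. -/
def shiftDeg (p : GMPerversity n) (i : ℤ) : A.obj p i →ₗ[R] A.obj p (i - 1 + 1) :=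
  Total.comp A p (i - 1 + 1) ∘ₗ Total.of A p i

/-- The degrees `i` and `i - 1 + 1` agree only propositionally; passing through `Total` replaces a
transport. -/
theorem letter_shiftDeg (a : A.Letter) :
    (⟨a.per, a.deg + 1 - 1, shiftDeg a.per (a.deg + 1) a.val⟩ : A.Letter) = a := by
  have key : ∀ i, i = a.deg → (⟨a.per, i,
      Total.comp A a.per (i + 1) (Total.of A a.per (a.deg + 1) a.val)⟩ : A.Letter) = a := by
    rintro _ rfl
    rw [Total.comp_of]
  exact key _ (by ring)

variable (N) in
/-- `φ ↦ (w ↦ φ (a :: w))` for homogeneous `a`. -/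
def consLetter (p : GMPerversity n) (i : ℤ) : A.obj p i →ₗ[R] (wordMulti A N →ₗ[R] wordMulti A N) where
  toFun a :=
    { toFun φ := ⟨fun w => φ.1 (⟨p, i - 1, shiftDeg p i a⟩ :: w), fun u v p' i' =>
        φ.2 (⟨p, i - 1, shiftDeg p i a⟩ :: u) v p' i'⟩
      map_add' _ _ := rfl
      map_smul' _ _ := rfl }
  map_add' a b := by
    refine LinearMap.ext fun φ => Subtype.ext (funext fun w => ?_)
    obtain ⟨ψ, hψ⟩ := φ.2 [] w p (i - 1)
    have := map_add ψ (shiftDeg p i a) (shiftDeg p i b)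
    rw [← map_add, ← hψ, ← hψ, ← hψ] at this
    exact this
  map_smul' s a := by
    refine LinearMap.ext fun φ => Subtype.ext (funext fun w => ?_)
    obtain ⟨ψ, hψ⟩ := φ.2 [] w p (i - 1)
    have := map_smul ψ s (shiftDeg p i a)
    rw [← map_smul, ← hψ, ← hψ] at this
    exact this

variable (N) in
/-- `φ ↦ (w ↦ φ (a :: w))`. -/
def consWord : A.Total →ₗ[R] (wordMulti A N →ₗ[R] wordMulti A N) :=
  Total.lift (N := wordMulti A N →ₗ[R] wordMulti A N) fun p i => consLetter N p i

theorem consWord_tot (a : A.Letter) (φ : wordMulti A N) (w : A.Word) :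
    (consWord N a.tot φ).1 w = φ.1 (a :: w) := by
  rw [consWord, Letter.tot, Total.lift_of]
  exact congrArg (fun b => φ.1 (b :: w)) (letter_shiftDeg a)

variable (N) in
/-- The extension of a function on words to lists. -/
def extendWord : List A.Total → wordMulti A N →ₗ[R] N
  | [] => LinearMap.proj [] ∘ₗ (wordMulti A N).subtype
  | x :: l => extendWord l ∘ₗ consWord N x

/-- Functions on words which are linear in each letter extend to multilinear functions. -/
theorem IsMultiWord.exists_isMulti {φ : A.Word → N} (hφ : IsMultiWord φ) :
    ∃ Φ : ConvAlg A.Total N, IsMulti R Φ ∧ ∀ w : A.Word, Φ w.tot = φ w := by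
  refine ⟨.ofFun fun l => extendWord N l ⟨φ, hφ⟩, ⟨fun a x y b => ?_, fun a s x b => ?_⟩, ?_⟩
  · show extendWord N _ _ = extendWord N _ _ + extendWord N _ _
    rw [← LinearMap.add_apply]
    congr 1
    induction a with
    | nil =>
      simp only [List.nil_append, extendWord, map_add]
      exact LinearMap.comp_add _ _ _
    | cons z a ih =>
      simp only [List.cons_append, extendWord, ih]
      exact LinearMap.add_comp _ _ _
  · show extendWord N _ _ = s • extendWord N _ _
    rw [← LinearMap.smul_apply]
    congr 1
    induction a with
    | nil =>
      simp only [List.nil_append, extendWord, map_smul]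
      exact LinearMap.comp_smul _ _ _
    | cons z a ih =>
      simp only [List.cons_append, extendWord, ih]
      exact LinearMap.smul_comp _ _ _
  · have : ∀ (w : A.Word) (φ : wordMulti A N), extendWord N (Word.tot w) φ = φ.1 w := by
      intro w
      induction w with
      | nil => exact fun _ => rfl
      | cons a w ih =>
        intro φ
        rw [← consWord_tot, ← ih]
        rfl
    exact fun w => this w ⟨φ, hφ⟩

end Extend

/-! ### Compatibility on words -/

section TypedOfWords

variable {x x' y y' : Fin (n + 1) → ℕ} {j f : ℤ} {a a' : A.Total} {F : ConvAlg A.Total A.Total}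

theorem exists_inc_congr (hb : Bdd x ↔ Bdd y) (hc : Bdd y → ceil x = ceil y) (c : A.obj (ceil x) j) :
    ∃ c' : A.obj (ceil y) j, inc A x j c = inc A y j c' := by
  by_cases h : Bdd y
  · rw [inc_of_bdd (hb.2 h)]
    simp only [inc_of_bdd h]
    have key : ∀ p, ceil x = p →
        ∃ c' : A.obj p j, Total.of A (ceil x) j c = Total.of A p j c' := by
      rintro _ rfl
      exact ⟨c, rfl⟩
    exact key _ (hc h)
  · exact ⟨0, by rw [inc_of_not_bdd (fun h' => h (hb.1 h')), inc_of_not_bdd h]⟩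

/-- `Rel` sees its perversities only through their roundings and their boundedness, so `ceil z + y`
may be exchanged for `z + y`. -/
theorem Rel.congr (hr : Rel x x' j a a') (hy : y ≤ y') (hb : Bdd x ↔ Bdd y) (hb' : Bdd x' ↔ Bdd y')
    (hc : Bdd y → ceil x = ceil y) (hc' : Bdd y' → ceil x' = ceil y') : Rel y y' j a a' := by
  obtain ⟨hx, c, rfl, rfl⟩ := hr
  by_cases h' : Bdd y'
  · have h := h'.mono hy
    rw [inc_of_bdd (hb.2 h), inc_of_bdd (hb'.2 h')]
    have key : ∀ p p' (_ : ceil x = p) (_ : ceil x' = p') (hp : p ≤ p'),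
        ∃ c' : A.obj p j, Total.of A (ceil x) j c = Total.of A p j c' ∧
          Total.of A (ceil x') j (A.map (ceil_mono hx) c) = Total.of A p' j (A.map hp c') := by
      rintro _ _ rfl rfl _
      exact ⟨c, rfl, rfl⟩
    obtain ⟨c', h₁, h₂⟩ := key _ _ (hc h) (hc' h') (ceil_mono hy)
    exact ⟨hy, c', by rw [h₁, inc_of_bdd h], by rw [h₂, inc_of_bdd h']⟩
  · obtain ⟨c', h₁⟩ := exists_inc_congr hb hc c
    exact ⟨hy, c', h₁, by
      rw [inc_of_not_bdd h', inc_of_not_bdd (fun h => h' (hb'.1 h))]⟩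

/-- It suffices to check the compatibility with the structure maps on words. -/
theorem typed_of_words (hx : Monotone x) (hm : IsMulti R F)
    (h : ∀ w w' : A.Word, List.Forall₂ Letter.MapsTo w w' →
      Rel (x + w.per) (x + w'.per) (w.deg + f + 1) (F w.tot) (F w'.tot)) : Typed x f F := by
  -- Induction on the related lists, moving one entry at a time into the words `u`, `u'`.
  suffices H : ∀ {y y' j l l'}, WordRel y y' j l l' → ∀ u u' : A.Word,
      List.Forall₂ Letter.MapsTo u u' → Rel (x + u.per + y) (x + u'.per + y')
        (u.deg + j + f + 1) (F (u.tot ++ l)) (F (u'.tot ++ l')) by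
    refine ⟨hx, fun {y y' j l l'} hl k hk => ?_⟩
    subst hk
    have := H hl [] [] .nil
    rwa [Word.per_nil, Word.deg_nil, add_zero, zero_add] at this
  intro y y' j l l' hl
  induction hl with
  | nil =>
    intro u u' hu
    rw [add_zero, add_zero, add_zero, List.append_nil, List.append_nil]
    exact h u u' hu
  | @cons z z' y y' i j a a' l l' hz hz' hr hl ih =>
    intro u u' hu
    have hle : x + u.per + (z + y) ≤ x + u'.per + (z' + y') :=
      add_le_add (add_le_add_right (Word.wordRel hu).le _) (add_le_add hr.1 hl.le)
    have hmono : Monotone (x + u.per + y) :=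
      monotone_add (monotone_add hx u.per_monotone) hl.monotone_left
    have hmono' : Monotone (x + u'.per + y') :=
      monotone_add (monotone_add hx u'.per_monotone) hl.monotone_right
    have e : ∀ s t c : Fin (n + 1) → ℕ, x + s + (c + t) = c + (x + s + t) :=
      fun _ _ _ => by abel
    have ih' : ∀ c c' : A.Letter, c.MapsTo c' → Rel (c.per.toFun + (x + u.per + y))
        (c'.per.toFun + (x + u'.per + y')) (u.deg + (c.deg + j) + f + 1)
        (F (u.tot ++ c.tot :: l)) (F (u'.tot ++ c'.tot :: l')) := fun c c' hc => by
      have := ih (u ++ [c]) (u' ++ [c']) (List.rel_append hu (.cons hc .nil))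
      have hp : ∀ (v : A.Word) (b : A.Letter) (t : Fin (n + 1) → ℕ),
          x + Word.per (v ++ [b]) + t = b.per.toFun + (x + v.per + t) := fun v b t => by
        rw [Word.per_append, Word.per_cons, Word.per_nil]
        abel
      have ht : ∀ (v : A.Word) (b : A.Letter) (m : List A.Total),
          Word.tot (v ++ [b]) ++ m = v.tot ++ b.tot :: m := fun v b m => by
        rw [Word.tot_append, List.append_assoc]
        rfl
      rwa [hp, hp, ht, ht, Word.deg_append, Word.deg_cons, Word.deg_nil, add_zero,
        add_assoc u.deg] at this
    obtain ⟨hzz, c, rfl, rfl⟩ := hr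
    rw [e, e] at hle ⊢
    -- A bounded entry is the letter of perversity `ceil z`, and replacing `ceil z` by `z` in the
    -- total perversity is harmless. An unbounded entry is zero, where multilinearity gives the
    -- value zero.
    by_cases hb : Bdd z
    · by_cases hb' : Bdd z'
      · have := ih' ⟨ceil z, i, c⟩ ⟨ceil z', i, A.map (ceil_mono hzz) c⟩ ⟨_, ceil_mono hzz, rfl⟩
        rw [inc_of_bdd hb, inc_of_bdd hb']
        exact this.congr hle (bdd_ceil_add_iff hz hmono hb) (bdd_ceil_add_iff hz' hmono' hb')
          (ceil_ceil_add hz hmono) (ceil_ceil_add hz' hmono')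
      -- Here the second entry is zero, so only the homogeneity of the first value is needed; it
      -- comes from relating the first letter to itself.
      · obtain ⟨_, c', hc', -⟩ := ih' ⟨ceil z, i, c⟩ ⟨ceil z, i, c⟩ (Letter.mapsTo_refl _)
        obtain ⟨c'', hc''⟩ := exists_inc_congr (bdd_ceil_add_iff hz hmono hb)
          (ceil_ceil_add hz hmono) c'
        refine ⟨hle, c'', ?_, ?_⟩
        · rw [inc_of_bdd hb]
          exact hc'.trans hc''
        · rw [inc_of_not_bdd hb', hm.zero_entry, inc_of_not_bdd fun h => hb' h.left]
    · have hb' : ¬ Bdd z' := fun h => hb (h.mono hzz)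
      rw [inc_of_not_bdd hb, inc_of_not_bdd hb', hm.zero_entry, hm.zero_entry]
      exact Rel.zero hle

end TypedOfWords

end PerverseDGA
end

noncomputable section
open ConvAlg

/-- A multilinear map descends to quotients if it vanishes when one entry is in the submodule. -/
theorem MultilinearMap.exists_quotient {R ι N : Type*} {M : ι → Type*} [CommRing R] [Finite ι]
    [∀ i, AddCommGroup (M i)] [∀ i, Module R (M i)] [AddCommGroup N] [Module R N]
    (g : MultilinearMap R M N) (P : ∀ i, Submodule R (M i))
    (h : ∀ c i, c i ∈ P i → g c = 0) :
    ∃ g' : MultilinearMap R (fun i => M i ⧸ P i) N, ∀ c, g' (fun i => (P i).mkQ (c i)) = g c := by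
  classical
  have : Fintype ι := Fintype.ofFinite ι
  -- Independence of representatives, by exchanging one entry after another over a finite set of
  -- positions.
  have aux : ∀ s : Finset ι, ∀ c c' : ∀ i, M i, (∀ i, c i - c' i ∈ P i) →
      (∀ i ∉ s, c i = c' i) → g c = g c' := by
    intro s
    induction s using Finset.induction_on with
    | empty => exact fun c c' _ he => congrArg g (funext fun i => he i (Finset.notMem_empty i))
    | insert a s _ ih =>
      intro c c' hc he
      have h₁ : g (Function.update c a (c a - c' a)) = 0 := h _ a (by simpa using hc a)
      rw [g.map_update_sub, Function.update_eq_self, sub_eq_zero] at h₁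
      rw [h₁]
      refine ih _ _ (fun i => ?_) fun i hi => ?_
      · by_cases hia : i = a
        · subst hia; simp
        · simpa [hia] using hc i
      · by_cases hia : i = a
        · subst hia; simp
        · simpa [hia] using he i (by simp [hia, hi])
  have key : ∀ c c' : ∀ i, M i, (∀ i, (P i).mkQ (c i) = (P i).mkQ (c' i)) → g c = g c' :=
    fun c c' hc => aux Finset.univ c c' (fun i => (Submodule.Quotient.eq _).1 (hc i))
      fun i hi => absurd (Finset.mem_univ i) hi
  have hout : ∀ i (y : M i ⧸ P i), (P i).mkQ (Quotient.out y) = y := fun i y => Quotient.out_eq y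
  refine ⟨⟨fun c => g fun i => Quotient.out (c i), fun {_} c i y z => ?_, fun {_} c i s y => ?_⟩,
    fun c => key _ _ fun i => hout i _⟩
  · have e : ∀ y : M i ⧸ P i, g (fun t => Quotient.out (Function.update c i y t)) =
        g (Function.update (fun t => Quotient.out (c t)) i (Quotient.out y)) := fun y => by
      congr 1
      funext t
      by_cases ht : t = i
      · subst ht; simp
      · simp [ht]
    rw [e y, e z, ← g.map_update_add]
    refine key _ _ fun t => ?_
    by_cases ht : t = i
    · subst ht; simp [hout]
    · simp [ht]
  · have e : ∀ y : M i ⧸ P i, g (fun t => Quotient.out (Function.update c i y t)) =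
        g (Function.update (fun t => Quotient.out (c t)) i (Quotient.out y)) := fun y => by
      congr 1
      funext t
      by_cases ht : t = i
      · subst ht; simp
      · simp [ht]
    rw [e y, ← g.map_update_smul]
    refine key _ _ fun t => ?_
    by_cases ht : t = i
    · subst ht; simp [hout]
    · simp [ht]

namespace PerverseDGA

open GMPerversity PerverseGradedModule

variable {R : Type u} [CommRing R] {n : ℕ} {A : PerverseDGA.{u, v} R n}

/-! ### Cochains as functions on lists -/

section OfCochain

variable {r : GMPerversity n} {q : ℤ}

/-- Naturality of a cochain in its source perversity: the value on a word at any index is already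
given by the value with the smallest source, `ceil w.per`. -/
theorem HC.apply_bar (f : A.HC r q) (w : A.Word) {p p' : GMPerversity n} {i j : ℤ}
    (h : r.toFun + p.toFun ≤ p'.toFun) (hj : i + q = j) (hp : w.per ≤ p.toFun) (hi : w.deg = i) :
    f.1 ⟨p, p', i, j, h, hj⟩ (w.bar hp hi) =
      HC.eval f ⟨w, p', j, (add_le_add_right hp r.toFun).trans h, by rw [hi, hj]⟩ := by
  subst hi
  have hc : r.toFun + (ceil w.per).toFun ≤ p'.toFun := 
    (add_le_add_right (show (ceil w.per).toFun ≤ p.toFun from ceil_le hp) r.toFun).trans h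
  have := f.2 p (ceil w.per) p' p' w.deg j h hc hj (ceil_le hp) le_rfl
    (w.bar (GMPerversity.le_ceil hp) rfl)
  rw [Word.map_bar, PerverseGradedModule.map_id] at this
  exact this

/-- The elements `[a_1|…|a_k]` span the bar construction in every perversity and degree. -/
theorem HC.eval_injective : Function.Injective (HC.eval (A := A) (r := r) (q := q)) := by
  intro f g h
  refine Subtype.ext (funext fun ⟨p, p', i, j, hle, hj⟩ => bar_ext fun k x c => ?_)
  have e := Word.bar_ofFn (A := A) (p := p) (d := i) (fun t => ⟨x.per t, x.deg t, c t⟩) x.per_le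
    x.deg_eq
  have e' : (tensorMulti x fun t => suspMk _ _ (c t)) = _ := e.symm
  rw [e', HC.apply_bar, HC.apply_bar, h]

open Classical in
/-- The value of a cochain on a word, as an element of the total algebra. -/
def HC.onWord (f : A.HC r q) (w : A.Word) : A.Total :=
  if h : Bdd (r.toFun + w.per) then
    Total.of A (ceil (r.toFun + w.per)) (w.deg + q)
      (HC.eval f ⟨w, ceil (r.toFun + w.per), w.deg + q, h.le_ceil, rfl⟩)
  else 0

theorem HC.onWord_eq (f : A.HC r q) (w : A.Word) {y : Fin (n + 1) → ℕ} {j : ℤ} (hy : w.per = y)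
    (hj : w.deg + q = j) (h : Bdd (r.toFun + y)) :
    HC.onWord f w = Total.of A (ceil (r.toFun + y)) j
      (HC.eval f ⟨w, ceil (r.toFun + y), j, by rw [hy]; exact h.le_ceil, hj⟩) := by
  subst hy hj
  rw [HC.onWord, dif_pos h]

theorem HC.onWord_eq_zero (f : A.HC r q) (w : A.Word) (h : ¬ Bdd (r.toFun + w.per)) :
    HC.onWord f w = 0 := by rw [HC.onWord, dif_neg h]

/-- The dependence on one letter factors linearly through `s Ā`; both multilinearity and vanishing
on the unit follow from this. -/
theorem HC.exists_onWord_eq (f : A.HC r q) (u v : A.Word) (p : GMPerversity n) (i : ℤ) :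
    ∃ φ : A.suspBar.obj p i →ₗ[R] A.Total, ∀ a,
      HC.onWord f (u ++ ⟨p, i, a⟩ :: v) = φ (suspMk p i a) := by
  have hper : ∀ a, Word.per (u ++ ⟨p, i, a⟩ :: v) = Word.per u + (p.toFun + Word.per v) :=
    fun a => by rw [Word.per_append, Word.per_cons]
  have hdeg : ∀ a, Word.deg (u ++ ⟨p, i, a⟩ :: v) = Word.deg u + (i + Word.deg v) :=
    fun a => by rw [Word.deg_append, Word.deg_cons]
  by_cases h : Bdd (r.toFun + (Word.per u + (p.toFun + Word.per v)))
  · obtain ⟨φ, hφ⟩ := Word.exists_bar_eq (A := A) u v p i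
      (p := ceil (Word.per u + (p.toFun + Word.per v))) h.right.le_ceil rfl
    have hle : r.toFun + (ceil (Word.per u + (p.toFun + Word.per v))).toFun ≤
        (ceil (r.toFun + (Word.per u + (p.toFun + Word.per v)))).toFun :=
      add_ceil_le (monotone_add (Word.per_monotone _)
        (monotone_add p.monotone (Word.per_monotone _))) r.monotone (add_le_comm h.le_ceil)
    refine ⟨Total.of A _ _ ∘ₗ f.1 ⟨_, ceil (r.toFun + (Word.per u + (p.toFun + Word.per v))), _, _,
      hle, rfl⟩ ∘ₗ φ, fun a => ?_⟩
    rw [HC.onWord_eq f _ (hper a) (congrArg (· + q) (hdeg a)) h, LinearMap.comp_apply,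
      LinearMap.comp_apply, ← hφ a ((hper a).trans_le h.right.le_ceil) (hdeg a), HC.apply_bar]
  · exact ⟨0, fun a => HC.onWord_eq_zero f _ (by rwa [hper])⟩

theorem HC.rel_onWord (f : A.HC r q) {w w' : A.Word} (h : List.Forall₂ Letter.MapsTo w w') :
    Rel (r.toFun + w.per) (r.toFun + w'.per) (w.deg + q) (HC.onWord f w) (HC.onWord f w') := by
  have hle : r.toFun + w.per ≤ r.toFun + w'.per := add_le_add_right (Word.wordRel h).le _
  have hdeg : w.deg = w'.deg := by
    induction h with
    | nil => rfl
    | cons hc _ ih =>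
      obtain ⟨_, _, rfl⟩ := hc
      rw [Word.deg_cons, Word.deg_cons, ih (add_le_add_right (Word.wordRel ‹_›).le _)]
  by_cases hb : Bdd (r.toFun + w.per)
  · refine ⟨hle, HC.eval f ⟨w, ceil (r.toFun + w.per), w.deg + q, hb.le_ceil, rfl⟩, ?_, ?_⟩
    · rw [HC.onWord, dif_pos hb, inc_of_bdd hb]
    · by_cases hb' : Bdd (r.toFun + w'.per)
      · rw [HC.onWord_eq f w' rfl (congrArg (· + q) hdeg.symm) hb', inc_of_bdd hb',
          HC.map_eval f w (ceil_mono hle) hb.le_ceil (hle.trans hb'.le_ceil) rfl]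
        -- In the source perversity `ceil w'.per` the words `w` and `w'` define the same element of
        -- the bar construction, by the colimit relation.
        have hp := Word.bar_mapsTo h (p := ceil w'.per) (d := w.deg)
          ((Word.wordRel h).le.trans hb'.right.le_ceil) rfl hb'.right.le_ceil hdeg.symm
        have hr : r.toFun + (ceil w'.per).toFun ≤ (ceil (r.toFun + w'.per)).toFun :=
          add_ceil_le w'.per_monotone r.monotone (add_le_comm hb'.le_ceil)
        have := congrArg (f.1 ⟨ceil w'.per, ceil (r.toFun + w'.per), w.deg, w.deg + q, hr, rfl⟩) hp
        rw [HC.apply_bar, HC.apply_bar] at this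
        rw [this]
      · rw [HC.onWord_eq_zero f w' hb', inc_of_not_bdd hb']
  · have hb' : ¬ Bdd (r.toFun + w'.per) := fun h => hb (h.mono hle)
    rw [HC.onWord_eq_zero f w hb, HC.onWord_eq_zero f w' hb']
    exact Rel.zero hle

theorem zero_eq_neg_one_add_one : (0 : ℤ) = -1 + 1 := by norm_num

variable (A) in
/-- The letter `1`. -/
def Letter.one : A.Letter := ⟨0, -1, zero_eq_neg_one_add_one ▸ A.one⟩

theorem Letter.tot_one : (Letter.one A).tot = 1 := by
  have key : ∀ k (h : 0 = k), Total.of A 0 k (h ▸ A.one) = 1 := by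
    rintro _ rfl
    rfl
  exact key _ zero_eq_neg_one_add_one

theorem Letter.one_mem_unitSubmodule :
    (Letter.one A).val ∈ A.unitSubmodule (Letter.one A).per ((Letter.one A).deg + 1) := by
  have key : ∀ k (h : 0 = k), (h ▸ A.one : A.obj 0 k) ∈ A.unitSubmodule 0 k := by
    rintro _ rfl
    exact Submodule.subset_span ⟨rfl, (A.map_id _).symm⟩
  exact key _ zero_eq_neg_one_add_one

/-- Multilinearity extends the vanishing from words to lists, first to the right of the entry `1`
and then to its left. -/
theorem isNormalized_of_words {F : ConvAlg A.Total A.Total} (hm : IsMulti R F)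
    (h : ∀ u v : A.Word, F (Word.tot (u ++ Letter.one A :: v)) = 0) : IsNormalized F := by
  have h₁ : ∀ (u : A.Word) (b : List A.Total), F (u.tot ++ 1 :: b) = 0 := fun u b => by
    have : shift (u.tot ++ [1]) F = 0 := multi_ext (hm.shift _) isMulti_zero fun v => by
      have := h u v
      rw [Word.tot_append, Word.tot_cons, Letter.tot_one] at this
      rw [shift_apply, List.append_assoc]
      exact this
    have := congrArg (fun Φ : ConvAlg A.Total A.Total => Φ b) this
    rw [shift_apply, List.append_assoc] at this
    exact this
  intro a b
  have : (.ofFun fun l => F (l ++ 1 :: b) : ConvAlg A.Total A.Total) = 0 := by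
    refine multi_ext ⟨fun a x y c => ?_, fun a s x c => ?_⟩ isMulti_zero fun u => h₁ u b
    · simpa only [List.append_assoc, List.cons_append] using hm.add a x y (c ++ 1 :: b)
    · simpa only [List.append_assoc, List.cons_append] using hm.smul a s x (c ++ 1 :: b)
  exact congrArg (fun Φ : ConvAlg A.Total A.Total => Φ a) this

/-- The functions on lists given by cochains of perversity `x` and degree `q`. -/
structure IsFun (x : Fin (n + 1) → ℕ) (q : ℤ) (F : ConvAlg A.Total A.Total) : Prop where
  multi : IsMulti R F
  typed : Typed x (q - 1) F
  normalized : IsNormalized F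

/-- The values on words, each taken in the smallest possible target, are linear in every letter and
so extend to lists. Compatibility with structure maps and normalization are inherited from the bar
construction. -/
theorem HC.exists_isFun (f : A.HC r q) :
    ∃ F : ConvAlg A.Total A.Total, IsFun r.toFun q F ∧
      HC.eval f = toWordFun (le_refl r.toFun) q F := by
  have hφ : IsMultiWord (HC.onWord f) := fun u v p i => by
    obtain ⟨φ, hφ⟩ := HC.exists_onWord_eq f u v p i
    exact ⟨φ ∘ₗ suspMk p i, hφ⟩
  obtain ⟨F, hm, hF⟩ := hφ.exists_isMulti
  refine ⟨F, ⟨hm, typed_of_words r.monotone hm fun w w' h => ?_, isNormalized_of_words hm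
    fun u v => ?_⟩, ?_⟩
  · rw [hF, hF, show w.deg + (q - 1) + 1 = w.deg + q by ring]
    exact HC.rel_onWord f h
  · obtain ⟨φ, hφ⟩ := HC.exists_onWord_eq f u v (Letter.one A).per (Letter.one A).deg
    have := hφ (Letter.one A).val
    rw [suspMk_eq_zero Letter.one_mem_unitSubmodule, map_zero] at this
    rw [hF]
    exact this
  · funext ⟨w, p, j, hle, hj⟩
    have hb : Bdd (r.toFun + w.per) := ⟨p, hle⟩
    show _ = valₗ hle j (F w.tot)
    rw [hF, HC.onWord_eq f w rfl hj hb, ← inc_of_bdd hb, valₗ_inc, HC.map_eval]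

end OfCochain

/-! ### From functions on lists back to cochains -/

section ToCochain

variable {x : Fin (n + 1) → ℕ} {r : GMPerversity n} {q : ℤ} {F : ConvAlg A.Total A.Total}

theorem valₗ_congr {x y : Fin (n + 1) → ℕ} {p : GMPerversity n} (e : x = y) (h : x ≤ p.toFun)
    (h' : y ≤ p.toFun) (j : ℤ) (a : A.Total) : valₗ h j a = valₗ h' j a := by
  subst e
  rfl

theorem map_valₗ {p p' : GMPerversity n} (h : x ≤ p.toFun) (hp : p ≤ p') (h' : x ≤ p'.toFun) (j : ℤ)
    (a : A.Total) : A.map hp (valₗ h j a) = valₗ h' j a := A.map_map _ _ _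

theorem Letter.mapsTo_unit {p : GMPerversity n} {i : ℤ} {a : A.obj p (i + 1)}
    (h : ∃ h : 0 = i + 1, a = h ▸ A.map p.zero_le A.one) :
    (Letter.one A).MapsTo ⟨p, i, a⟩ := by
  obtain ⟨h, rfl⟩ := h
  obtain rfl : i = -1 := by omega
  have key : ∀ k (h : 0 = k), (h ▸ A.map p.zero_le A.one : A.obj p k) =
      A.map p.zero_le (h ▸ A.one : A.obj 0 k) := by
    rintro _ rfl
    rfl
  exact ⟨p, p.zero_le, congrArg (Letter.mk p (-1)) (key _ h)⟩

/-- Normalization concerns only the unit in perversity zero. The unit submodule in perversity `p` is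
spanned by the image of that unit under a structure map, and typedness carries the vanishing over.
-/
theorem IsFun.val_unit (hF : IsFun x q F) (u v : A.Word) (p : GMPerversity n) (i : ℤ)
    {a : A.obj p (i + 1)} (ha : a ∈ A.unitSubmodule p (i + 1)) {p' : GMPerversity n} {j : ℤ}
    (hle : x + Word.per (u ++ ⟨p, i, a⟩ :: v) ≤ p'.toFun)
    (hj : Word.deg (u ++ ⟨p, i, a⟩ :: v) + q = j) :
    valₗ hle j (F (Word.tot (u ++ ⟨p, i, a⟩ :: v))) = 0 := by
  have hper : ∀ a, Word.per (u ++ ⟨p, i, a⟩ :: v) = Word.per u + (p.toFun + Word.per v) :=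
    fun a => by rw [Word.per_append, Word.per_cons]
  have hdeg : ∀ a, Word.deg (u ++ ⟨p, i, a⟩ :: v) = Word.deg u + (i + Word.deg v) :=
    fun a => by rw [Word.deg_append, Word.deg_cons]
  have htot : ∀ a, Word.tot (u ++ ⟨p, i, a⟩ :: v) =
      Word.tot u ++ Total.of A p (i + 1) a :: Word.tot v := fun a => by
    rw [Word.tot_append, Word.tot_cons]
    rfl
  rw [hper] at hle
  rw [hdeg] at hj
  rw [valₗ_congr (by rw [hper]) _ hle, htot]
  let φ : A.obj p (i + 1) →ₗ[R] A.obj p' j :=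
    { toFun a := valₗ hle j (F (Word.tot u ++ Total.of A p (i + 1) a :: Word.tot v))
      map_add' a b := by rw [map_add, hF.multi.add, map_add]
      map_smul' s a := by rw [map_smul, hF.multi.smul, map_smul]; rfl }
  have hφ : A.unitSubmodule p (i + 1) ≤ LinearMap.ker φ := by
    refine Submodule.span_le.2 fun b hb => ?_
    show valₗ hle j (F (Word.tot u ++ Total.of A p (i + 1) b :: Word.tot v)) = 0
    have hM := Letter.mapsTo_unit hb
    have hfor : List.Forall₂ Letter.MapsTo (u ++ Letter.one A :: v) (u ++ ⟨p, i, b⟩ :: v) :=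
      List.rel_append (List.forall₂_same.2 fun a _ => a.mapsTo_refl)
        (.cons hM (List.forall₂_same.2 fun a _ => a.mapsTo_refl))
    have hw := Word.wordRel hfor
    have hd : (Letter.one A).deg = i := by
      obtain ⟨_, _, h⟩ := hM
      exact (congrArg Letter.deg h).symm
    have := hF.typed.val_congr hw (k := j) (by
      rw [Word.deg_append, Word.deg_cons, hd]
      omega) rfl (by rw [hper])
      ((add_le_add_right (hw.le.trans_eq (hper b)) _).trans hle) hle
    have h0 : F (Word.tot (u ++ Letter.one A :: v)) = 0 := by
      rw [Word.tot_append, Word.tot_cons, Letter.tot_one, hF.normalized]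
    rw [← htot, ← this, h0, map_zero]
  exact hφ ha

/-- The universal property of the bar construction: multilinear maps which kill units and respect
the structure maps descend to the quotients and to the colimit. -/
theorem exists_linearMap_bar {p : GMPerversity n} {d : ℤ} {N : Type w} [AddCommGroup N] [Module R N]
    (g : ∀ k (y : TensorIndex n k p d),
      MultilinearMap R (fun t => A.obj (y.per t) (y.deg t + 1)) N)
    (hg : ∀ k y c t, c t ∈ A.unitSubmodule (y.per t) (y.deg t + 1) → g k y c = 0)
    (hg' : ∀ k (y : TensorIndex n k p d) (p₁ : Fin k → GMPerversity n)
      (h : ∑ t, (p₁ t).toFun ≤ p.toFun) (hp : ∀ t, y.per t ≤ p₁ t) c,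
      g k y c = g k ⟨p₁, y.deg, h, y.deg_eq⟩ fun t => A.map (hp t) (c t)) :
    ∃ ψ : A.barConstruction.obj p d →ₗ[R] N,
      ∀ k y c, ψ (tensorMulti y fun t => suspMk _ _ (c t)) = g k y c := by
  classical
  choose G hG using fun k y => MultilinearMap.exists_quotient (g k y)
    (fun t => A.unitSubmodule (y.per t) (y.deg t + 1)) (hg k y)
  let ψ₀ : ∀ k, A.suspBar.PreTensorPower k p d →ₗ[R] N := fun k =>
    DirectSum.toModule R (TensorIndex n k p d) N fun y => PiTensorProduct.lift (G k y)
  have hψ₀ : ∀ k (y : TensorIndex n k p d) (c : ∀ t, A.obj (y.per t) (y.deg t + 1)),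
      ψ₀ k (A.suspBar.preTensor y fun t => suspMk _ _ (c t)) = g k y c := fun k y c => by
    refine Eq.trans ?_ (hG k y c)
    refine (DirectSum.toModule_lof R y _).trans ?_
    exact PiTensorProduct.lift.tprod _
  have hker : ∀ k, A.suspBar.tensorRel k p d ≤ LinearMap.ker (ψ₀ k) := fun k => by
    refine Submodule.span_le.2 ?_
    rintro _ ⟨y, p₁, h, hp, c, rfl⟩
    choose c' hc' using fun t => suspMk_surjective _ _ (c t)
    obtain rfl : (fun t => suspMk _ _ (c' t)) = c := funext hc'
    refine LinearMap.mem_ker.2 ?_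
    rw [map_sub, hψ₀, sub_eq_zero, hg' k y p₁ h hp]
    exact (hψ₀ k ⟨p₁, y.deg, h, y.deg_eq⟩ _).symm
  refine ⟨DirectSum.toModule R ℕ N fun k => (A.suspBar.tensorRel k p d).liftQ (ψ₀ k) (hker k),
    fun k y c => ?_⟩
  refine Eq.trans ?_ (hψ₀ k y c)
  exact DirectSum.toModule_lof R (M := fun k => A.suspBar.TensorPower k p d)
    (φ := fun k => (A.suspBar.tensorRel k p d).liftQ (ψ₀ k) (hker k)) k _

/-- The word of a family of homogeneous elements. -/
def tupleWord {k : ℕ} (P : Fin k → GMPerversity n) (i : Fin k → ℤ)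
    (c : ∀ t, A.obj (P t) (i t + 1)) : A.Word := List.ofFn fun t => ⟨P t, i t, c t⟩

theorem IsMulti.exists_tuple {N : Type w} [AddCommGroup N] [Module R N] {Φ : ConvAlg A.Total N}
    (hΦ : IsMulti R Φ) {k : ℕ} (P : Fin k → GMPerversity n) (i : Fin k → ℤ) :
    ∃ g : MultilinearMap R (fun t => A.obj (P t) (i t + 1)) N,
      ∀ c, g c = Φ (Word.tot (tupleWord P i c)) := by
  obtain ⟨φ, rfl⟩ := hΦ.exists_eq_post
  refine ⟨(φ.compMultilinearMap (TensorAlgebra.tprod R A.Total k)).compLinearMap fun t =>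
    Total.of A (P t) (i t + 1), fun c => ?_⟩
  rw [MultilinearMap.compLinearMap_apply, LinearMap.compMultilinearMap_apply, post_apply,
    TensorAlgebra.tprod_apply]
  congr 1
  simp only [tens, Word.tot, tupleWord, List.map_ofFn]
  rfl

/-- For each pair of source and target, the values of `F` define a linear map on the bar
construction: normalization lets them descend to `s Ā`, and typedness makes them respect the colimit
relations. The resulting family is compatible because all values are images of the same elements. -/
theorem IsFun.exists_cochain (hF : IsFun x q F) (hx : x ≤ r.toFun) :
    ∃ f : A.HC r q, HC.eval f = toWordFun hx q F := by
  have hper : ∀ {k : ℕ} (P : Fin k → GMPerversity n) (i : Fin k → ℤ)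
      (c : ∀ t, A.obj (P t) (i t + 1)), Word.per (tupleWord P i c) = ∑ t, (P t).toFun :=
    fun P i c => Word.per_ofFn _
  have hdeg : ∀ {k : ℕ} (P : Fin k → GMPerversity n) (i : Fin k → ℤ)
      (c : ∀ t, A.obj (P t) (i t + 1)), Word.deg (tupleWord P i c) = ∑ t, i t :=
    fun P i c => Word.deg_ofFn _
  have H : ∀ z : HomIndex n r q, ∃ ψ : A.barConstruction.obj z.src z.srcDeg →ₗ[R] A.obj z.tgt z.tgtDeg,
      ∀ k (y : TensorIndex n k z.src z.srcDeg) (c : ∀ t, A.obj (y.per t) (y.deg t + 1)),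
        ψ (tensorMulti y fun t => suspMk _ _ (c t)) =
          valₗ ((add_le_add hx y.per_le).trans z.le) z.tgtDeg
            (F (Word.tot (tupleWord y.per y.deg c))) := fun z => by
    choose g hg using fun k (y : TensorIndex n k z.src z.srcDeg) => IsMulti.exists_tuple
      (hF.multi.post (valₗ ((add_le_add hx y.per_le).trans z.le) z.tgtDeg)) y.per y.deg
    refine (exists_linearMap_bar g (fun k y c t ht => ?_) fun k y p₁ h hp c => ?_).imp
      fun ψ hψ k y c => (hψ k y c).trans (hg k y c)
    · rw [hg, post_apply]
      have hlt : (t : ℕ) < (tupleWord y.per y.deg c).length := by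
        rw [tupleWord, List.length_ofFn]; exact t.2
      have hs := Word.split_one (tupleWord y.per y.deg c) t hlt
      have hget : (tupleWord y.per y.deg c)[(t : ℕ)] = ⟨y.per t, y.deg t, c t⟩ := by
        simp [tupleWord]
      rw [hget] at hs
      have hp' := hper y.per y.deg c
      have hd' := hdeg y.per y.deg c
      rw [← hs] at hp' hd'
      have := hF.val_unit _ _ (y.per t) (y.deg t) ht (p' := z.tgt) (j := z.tgtDeg)
        (by rw [hp']; exact (add_le_add hx y.per_le).trans z.le)
        (by rw [hd', y.deg_eq, z.deg_eq])
      rw [valₗ_congr (by rw [hp']) _ ((add_le_add hx y.per_le).trans z.le), hs] at this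
      exact this
    · rw [hg, hg, post_apply, post_apply]
      have hw : List.Forall₂ Letter.MapsTo (tupleWord y.per y.deg c)
          (tupleWord p₁ y.deg fun t => A.map (hp t) (c t)) := by
        refine List.forall₂_iff_get.2 ⟨by simp [tupleWord], fun i h₁ h₂ => ?_⟩
        simp only [tupleWord, List.get_ofFn]
        exact ⟨_, hp _, rfl⟩
      refine hF.typed.val_congr (Word.wordRel hw) ?_ ?_ ?_ _ _
      · rw [hdeg, y.deg_eq, ← z.deg_eq]; ring
      · rw [hper]
      · rw [hper]
  choose ψ hψ using H
  refine ⟨⟨ψ, fun u u' v v' i j h h' hj hu hv b => ?_⟩, ?_⟩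
  -- Compatibility is checked on pure tensors, where both sides are the image of one value of `F` in
  -- the component of perversity `v'`.
  · have : A.map hv ∘ₗ ψ ⟨u, v, i, j, h, hj⟩ ∘ₗ A.barConstruction.map hu =
        ψ ⟨u', v', i, j, h', hj⟩ := bar_ext fun k y c => by
      rw [LinearMap.comp_apply, LinearMap.comp_apply, map_tensorMulti, hψ]
      refine Eq.trans ?_ (map_valₗ ((add_le_add hx (y.mono hu).per_le).trans h) hv _ _ _)
      exact congrArg _ (hψ ⟨u, v, i, j, h, hj⟩ k (y.mono hu) c)
    exact LinearMap.congr_fun this b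
  · funext ⟨w, p, j, hle, hj⟩
    have hw : tupleWord (fun t => (w.get t).per) (fun t => (w.get t).deg) (fun t => (w.get t).val) =
        w := List.ofFn_get w
    refine (hψ _ w.length (letterIndex w.get _ _) fun t => (w.get t).val).trans ?_
    have hs : ∑ t, (w.get t).per.toFun = w.per := Fin.sum_univ_fun_getElem w fun a => a.per.toFun
    refine (congrArg _ (congrArg F (congrArg Word.tot hw))).trans ?_
    exact valₗ_congr (congrArg (x + ·) hs) _ _ _ _

end ToCochain

end PerverseDGA
end

/-! ### Homotopies for the axioms, and operations on represented cochains -/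

noncomputable section
open ConvAlg

namespace SignedDGA

variable {R V : Type*} [CommRing R] [Ring V] [Algebra R V] {S : SignedDGA R V} {f g h : ℤ}
  {F G H : ConvAlg V V}

/-- The cup product of cocycles is commutative up to a coboundary. -/
theorem cup_sub_cup_eq_D (hF : S.IsCochain f F) (hG : S.IsCochain g G) (hDF : S.D f F = 0)
    (hDG : S.D g G = 0) :
    S.cup (g + 1) F G - sgn R ((f + 1) * (g + 1)) • S.cup (f + 1) G F =
      S.D (f + g) (sgn R f • S.circ g F G) := by
  rw [D_smul, D_circ hF hG, hDF, hDG, zero_circ, circ_zero hF.1]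
  simp only [sgn_eq_ite, Int.even_add, Int.even_mul, Int.not_even_one]
  by_cases h₁ : Even f <;> by_cases h₂ : Even g <;> simp [h₁, h₂] <;> abel

/-- The bracket of cocycles is a derivation of the cup product up to a coboundary. -/
theorem br_cup_sub_eq_D (hF : S.IsCochain f F) (hG : S.IsCochain g G) (hH : S.IsCochain h H)
    (hDF : S.D f F = 0) (hDG : S.D g G = 0) (hDH : S.D h H = 0) :
    S.br f (g + h + 1) F (S.cup (h + 1) G H) -
      (S.cup (h + 1) (S.br f g F G) H +
        sgn R (f * (g + 1)) • S.cup (f + h + 1) G (S.br f h F H)) =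
      S.D (f + (g + h)) (-(sgn R (f + g)) • S.brace g h F G H) := by
  rw [D_smul, D_brace hF hG hH hDF hDG hDH, br, br, br, cup_circ hG.1 hF.2, sub_cup, cup_sub,
    smul_cup, cup_smul, show h + 1 + f = f + h + 1 by ring]
  simp only [sgn_eq_ite, Int.even_add, Int.even_mul, Int.not_even_one]
  by_cases h₁ : Even f <;> by_cases h₂ : Even g <;> by_cases h₃ : Even h <;>
    simp [h₁, h₂, h₃] <;> abel

theorem br_eq_neg (f g : ℤ) (F G : ConvAlg V V) :
    S.br f g F G = -(sgn R (f * g) • S.br g f G F) := by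
  rw [br, br, mul_comm g f, smul_sub, smul_smul, sgn_mul_self, one_smul, neg_sub]

theorem br_add (hF : IsMulti R F) (f g : ℤ) (G G' : ConvAlg V V) :
    S.br f g F (G + G') = S.br f g F G + S.br f g F G' := by
  rw [br, br, br, circ_add hF, add_circ, smul_add, add_sub_add_comm]

theorem br_smul (hF : IsMulti R F) (f g : ℤ) (s : R) (G : ConvAlg V V) :
    S.br f g F (s • G) = s • S.br f g F G := by
  rw [br, br, circ_smul hF, smul_circ, smul_sub, smul_comm s]

theorem add_br (hG : IsMulti R G) (f g : ℤ) (F F' : ConvAlg V V) :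
    S.br f g (F + F') G = S.br f g F G + S.br f g F' G := by
  rw [br, br, br, circ_add hG, add_circ, smul_add, add_sub_add_comm]

theorem smul_br (hG : IsMulti R G) (f g : ℤ) (s : R) (F : ConvAlg V V) :
    S.br f g (s • F) G = s • S.br f g F G := by
  rw [br, br, circ_smul hG, smul_circ, smul_sub, smul_comm s]

theorem zero_br (hG : IsMulti R G) (f g : ℤ) : S.br f g 0 G = 0 := by
  rw [br, zero_circ, circ_zero hG, smul_zero, sub_zero]

theorem br_zero (hF : IsMulti R F) (f g : ℤ) : S.br f g F 0 = 0 := by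
  rw [br, zero_circ, circ_zero hF, smul_zero, sub_zero]

end SignedDGA

namespace PerverseDGA

open GMPerversity PerverseGradedModule

variable {R : Type u} [CommRing R] {n : ℕ} {A : PerverseDGA.{u, v} R n}

/-! ### Operations on cochains -/

namespace IsFun

variable {x z t : Fin (n + 1) → ℕ} {q q' q₁ q₂ q₃ q₄ : ℤ} {F G H : ConvAlg A.Total A.Total}

theorem cochain (hF : IsFun x q F) : A.signed.IsCochain (q - 1) F :=
  ⟨hF.multi, hF.typed.hasDeg hF.multi⟩

theorem addFun (hF : IsFun x q F) (hG : IsFun x q G) : IsFun x q (F + G) :=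
  ⟨hF.1.addFun hG.1, hF.2.addFun hG.2, hF.3.addFun hG.3⟩

theorem smulFun (hF : IsFun x q F) (s : R) : IsFun x q (s • F) :=
  ⟨hF.1.smulFun s, hF.2.smulFun s, hF.3.smulFun s⟩

theorem subFun (hF : IsFun x q F) (hG : IsFun x q G) : IsFun x q (F - G) :=
  ⟨hF.1.subFun hG.1, hF.2.subFun hG.2, hF.3.subFun hG.3⟩

theorem D (hF : IsFun x q F) (hq : q + 1 = q') : IsFun x q' (A.signed.D (q - 1) F) := by
  refine ⟨hF.cochain.D.multi, ?_, SignedDGA.isNormalized_D hF.1 hF.3 _⟩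
  obtain rfl : q = q' - 1 := by omega
  have := hF.typed.D
  rwa [show q' - 1 - 1 + 1 = q' - 1 by ring] at this

theorem cup (hF : IsFun x q₁ F) (hG : IsFun z q₂ G) (hq : q₁ + q₂ = q₃) :
    IsFun (x + z) q₃ (A.signed.cup q₂ F G) :=
  ⟨(hF.cochain.cup hG.cochain q₂).multi, hF.typed.cup hG.typed q₂ (by omega),
    SignedDGA.isNormalized_cup hF.1 hF.3 hG.3 q₂⟩

theorem circ (hF : IsFun x q₁ F) (hG : IsFun z q₂ G) (hq : q₁ + q₂ - 1 = q₃) :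
    IsFun (x + z) q₃ (A.signed.circ (q₂ - 1) F G) :=
  ⟨(hF.cochain.circ hG.cochain).multi, hF.typed.circ hG.typed (by omega),
    SignedDGA.isNormalized_ins hF.1 hF.3 hG.3 _⟩

theorem br (hF : IsFun x q₁ F) (hG : IsFun z q₂ G) (hq : q₁ + q₂ - 1 = q₃) :
    IsFun (x + z) q₃ (A.signed.br (q₁ - 1) (q₂ - 1) F G) := by
  have h := hG.circ hF (show q₂ + q₁ - 1 = q₃ by omega)
  rw [add_comm z x] at h
  exact (hF.circ hG hq).subFun (h.smulFun _)

theorem brace (hF : IsFun x q₁ F) (hG : IsFun z q₂ G) (hH : IsFun t q₃ H)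
    (hq : q₁ + q₂ + q₃ - 2 = q₄) :
    IsFun (x + z + t) q₄ (A.signed.brace (q₂ - 1) (q₃ - 1) F G H) := by
  refine ⟨(hF.cochain.brace hG.cochain hH.cochain).multi, ?_,
    SignedDGA.isNormalized_brace hF.1 hG.1 hF.3 hG.3 hH.3 _ _⟩
  have := hF.typed.brace hG.typed hH.typed
  rwa [show q₁ - 1 + (q₂ - 1 + (q₃ - 1)) = q₄ - 1 by omega] at this

end IsFun

/-- The cochain `f` is given by the function `F` of perversity `x`. -/
structure Represents {r : GMPerversity n} {q : ℤ} (x : Fin (n + 1) → ℕ)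
    (F : ConvAlg A.Total A.Total) (f : A.HC r q) : Prop where
  isFun : IsFun x q F
  le : x ≤ r.toFun
  eval_eq : HC.eval f = toWordFun le q F

namespace Represents

variable {x z y : Fin (n + 1) → ℕ} {r r' r₁ r₂ s : GMPerversity n} {q q' q₁ q₂ q₃ : ℤ}
  {F G K : ConvAlg A.Total A.Total} {f f' : A.HC r q}

theorem unique (h : Represents x F f) (h' : Represents x F f') : f = f' :=
  HC.eval_injective (h.eval_eq.trans h'.eval_eq.symm)

theorem congr (h : Represents x F f) (e : x = y) (e' : F = G) : Represents y G f := by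
  subst e e'
  exact h

theorem add (h : Represents x F f) (h' : Represents x G f') : Represents x (F + G) (f + f') :=
  ⟨h.isFun.addFun h'.isFun, h.le, by rw [map_add, h.eval_eq, h'.eval_eq, toWordFun_add]⟩

theorem smul (h : Represents x F f) (c : R) : Represents x (c • F) (c • f) :=
  ⟨h.isFun.smulFun c, h.le, by rw [map_smul, h.eval_eq, toWordFun_smul]⟩

theorem sub (h : Represents x F f) (h' : Represents x G f') : Represents x (F - G) (f - f') :=
  ⟨h.isFun.subFun h'.isFun, h.le, by rw [map_sub, h.eval_eq, h'.eval_eq, toWordFun_sub]⟩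

theorem map (h : Represents x F f) (hr : r ≤ r') : Represents x F (IHom.map hr f : A.HC r' q) :=
  ⟨h.isFun, h.le.trans hr, by rw [HC.eval_map, h.eval_eq]; rfl⟩

theorem diff_eval (h : Represents x F f) (hq : q + 1 = q') :
    diff hq (HC.eval f) = toWordFun h.le q' (A.signed.D (q - 1) F) := by
  rw [h.eval_eq, toWordFun_D h.isFun.typed h.isFun.multi]

end Represents

section Operations

variable {x z : Fin (n + 1) → ℕ} {r r' r₁ r₂ s : GMPerversity n} {q q' q₁ q₂ q₃ : ℤ}
  {F G : ConvAlg A.Total A.Total}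

theorem HC.exists_represents (f : A.HC r q) : ∃ F, Represents r.toFun F f := by
  obtain ⟨F, hF, h⟩ := f.exists_isFun
  exact ⟨F, hF, le_rfl, h⟩

theorem IsFun.exists_represents (hF : IsFun x q F) (hx : x ≤ r.toFun) :
    ∃ f : A.HC r q, Represents x F f := by
  obtain ⟨f, hf⟩ := hF.exists_cochain hx
  exact ⟨f, hF, hx, hf⟩

/-- Existence holds because `D` of a representing function is again of the required kind, uniqueness
because a cochain is determined by its values on words. -/
theorem HC.existsUnique_diff (hq : q + 1 = q') (f : A.HC r q) :
    ∃! g : A.HC r q', HC.eval g = diff hq (HC.eval f) := by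
  obtain ⟨F, hF⟩ := f.exists_represents
  obtain ⟨g, hg⟩ := (hF.isFun.D hq).exists_cochain hF.le
  exact ⟨g, hg.trans (hF.diff_eval hq).symm, fun g' hg' =>
    HC.eval_injective (hg'.trans ((hF.diff_eval hq).trans hg.symm))⟩

theorem HC.diff_diff {q'' : ℤ} (hq : q + 1 = q') (hq' : q' + 1 = q'') (f : A.HC r q) :
    diff hq' (diff hq (HC.eval f)) = 0 := by
  obtain ⟨F, hF⟩ := f.exists_represents
  have h := hF.isFun.D hq
  rw [hF.diff_eval hq, ← toWordFun_D h.typed h.multi]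
  subst hq
  rw [show q + 1 - 1 = q - 1 + 1 by ring, SignedDGA.D_D hF.isFun.cochain, toWordFun_zero]

theorem toWordFun_cup_isFun (hF : IsFun x q₁ F) (hG : IsFun z q₂ G) (hx : x ≤ r₁.toFun)
    (hz : z ≤ r₂.toFun) (h : r₁.toFun + r₂.toFun ≤ s.toFun) (hq : q₁ + q₂ = q₃) :
    toWordFun ((add_le_add hx hz).trans h) q₃ (A.signed.cup q₂ F G) =
      PerverseDGA.cup h hq (toWordFun hx q₁ F) (toWordFun hz q₂ G) :=
  toWordFun_cup hF.typed hG.typed hF.multi hx hz _ h hq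

theorem HC.exists_cup (h : r₁.toFun + r₂.toFun ≤ s.toFun) (hq : q₁ + q₂ = q₃) (f : A.HC r₁ q₁)
    (g : A.HC r₂ q₂) :
    ∃ k : A.HC s q₃, HC.eval k = PerverseDGA.cup h hq (HC.eval f) (HC.eval g) := by
  obtain ⟨F, hF⟩ := f.exists_represents
  obtain ⟨G, hG⟩ := g.exists_represents
  obtain ⟨k, hk⟩ := (hF.isFun.cup hG.isFun hq).exists_cochain h
  refine ⟨k, ?_⟩
  rw [hk, hF.eval_eq, hG.eval_eq, ← toWordFun_cup_isFun hF.isFun hG.isFun hF.le hG.le h hq]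

theorem HC.exists_bracket (h : r₁.toFun + r₂.toFun ≤ s.toFun) (hq : q₁ + q₂ - 1 = q₃)
    (f : A.HC r₁ q₁) (g : A.HC r₂ q₂) :
    ∃ k : A.HC s q₃, HC.eval k = PerverseDGA.bracket h hq (HC.eval f) (HC.eval g) := by
  obtain ⟨F, hF⟩ := f.exists_represents
  obtain ⟨G, hG⟩ := g.exists_represents
  obtain ⟨k, hk⟩ := (hF.isFun.br hG.isFun hq).exists_cochain h
  refine ⟨k, ?_⟩
  rw [hk, hF.eval_eq, hG.eval_eq, ← toWordFun_bracket hF.isFun.typed hG.isFun.typed hF.isFun.multi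
    hG.isFun.multi hF.le hG.le h h hq]

theorem Represents.of_cup {f : A.HC r₁ q₁} {g : A.HC r₂ q₂} {k : A.HC s q₃}
    (hF : Represents x F f) (hG : Represents z G g) (h : r₁.toFun + r₂.toFun ≤ s.toFun)
    (hq : q₁ + q₂ = q₃) (hk : HC.eval k = PerverseDGA.cup h hq (HC.eval f) (HC.eval g)) :
    Represents (x + z) (A.signed.cup q₂ F G) k :=
  ⟨hF.isFun.cup hG.isFun hq, (add_le_add hF.le hG.le).trans h, by
    rw [hk, hF.eval_eq, hG.eval_eq, ← toWordFun_cup_isFun hF.isFun hG.isFun hF.le hG.le h hq]⟩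

theorem Represents.of_bracket {f : A.HC r₁ q₁} {g : A.HC r₂ q₂} {k : A.HC s q₃}
    (hF : Represents x F f) (hG : Represents z G g) (h : r₁.toFun + r₂.toFun ≤ s.toFun)
    (hq : q₁ + q₂ - 1 = q₃) (hk : HC.eval k = PerverseDGA.bracket h hq (HC.eval f) (HC.eval g)) :
    Represents (x + z) (A.signed.br (q₁ - 1) (q₂ - 1) F G) k :=
  ⟨hF.isFun.br hG.isFun hq, (add_le_add hF.le hG.le).trans h, by
    rw [hk, hF.eval_eq, hG.eval_eq, ← toWordFun_bracket hF.isFun.typed hG.isFun.typed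
      hF.isFun.multi hG.isFun.multi hF.le hG.le _ h hq]⟩

/-- The cup product of cochains. -/
def HC.cup (h : r₁.toFun + r₂.toFun ≤ s.toFun) (hq : q₁ + q₂ = q₃) :
    A.HC r₁ q₁ →ₗ[R] A.HC r₂ q₂ →ₗ[R] A.HC s q₃ :=
  -- Any choice of representing functions represents the product. Bilinearity thus follows from
  -- bilinearity for functions and from the uniqueness of the represented cochain.
  have rep := fun {x z F G} {f : A.HC r₁ q₁} {g : A.HC r₂ q₂} (hF : Represents x F f)
    (hG : Represents z G g) => hF.of_cup hG h hq (HC.exists_cup h hq f g).choose_spec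
  LinearMap.mk₂ R (fun f g => (HC.exists_cup h hq f g).choose)
    (fun f f' g => by
      obtain ⟨F, hF⟩ := f.exists_represents
      obtain ⟨F', hF'⟩ := f'.exists_represents
      obtain ⟨G, hG⟩ := g.exists_represents
      exact ((rep (hF.add hF') hG).congr rfl (SignedDGA.add_cup _ _ _ _)).unique
        ((rep hF hG).add (rep hF' hG)))
    (fun c f g => by
      obtain ⟨F, hF⟩ := f.exists_represents
      obtain ⟨G, hG⟩ := g.exists_represents
      exact ((rep (hF.smul c) hG).congr rfl (SignedDGA.smul_cup _ _ _ _)).unique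
        ((rep hF hG).smul c))
    (fun f g g' => by
      obtain ⟨F, hF⟩ := f.exists_represents
      obtain ⟨G, hG⟩ := g.exists_represents
      obtain ⟨G', hG'⟩ := g'.exists_represents
      exact ((rep hF (hG.add hG')).congr rfl (SignedDGA.cup_add _ _ _ _)).unique
        ((rep hF hG).add (rep hF hG')))
    (fun c f g => by
      obtain ⟨F, hF⟩ := f.exists_represents
      obtain ⟨G, hG⟩ := g.exists_represents
      exact ((rep hF (hG.smul c)).congr rfl (SignedDGA.cup_smul _ _ _ _)).unique
        ((rep hF hG).smul c))

/-- The bracket of cochains. -/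
def HC.bracket (h : r₁.toFun + r₂.toFun ≤ s.toFun) (hq : q₁ + q₂ - 1 = q₃) :
    A.HC r₁ q₁ →ₗ[R] A.HC r₂ q₂ →ₗ[R] A.HC s q₃ :=
  have rep := fun {x z F G} {f : A.HC r₁ q₁} {g : A.HC r₂ q₂} (hF : Represents x F f)
    (hG : Represents z G g) => hF.of_bracket hG h hq (HC.exists_bracket h hq f g).choose_spec
  LinearMap.mk₂ R (fun f g => (HC.exists_bracket h hq f g).choose)
    (fun f f' g => by
      obtain ⟨F, hF⟩ := f.exists_represents
      obtain ⟨F', hF'⟩ := f'.exists_represents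
      obtain ⟨G, hG⟩ := g.exists_represents
      exact ((rep (hF.add hF') hG).congr rfl (SignedDGA.add_br hG.isFun.multi _ _ _ _)).unique
        ((rep hF hG).add (rep hF' hG)))
    (fun c f g => by
      obtain ⟨F, hF⟩ := f.exists_represents
      obtain ⟨G, hG⟩ := g.exists_represents
      exact ((rep (hF.smul c) hG).congr rfl (SignedDGA.smul_br hG.isFun.multi _ _ _ _)).unique
        ((rep hF hG).smul c))
    (fun f g g' => by
      obtain ⟨F, hF⟩ := f.exists_represents
      obtain ⟨G, hG⟩ := g.exists_represents
      obtain ⟨G', hG'⟩ := g'.exists_represents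
      exact ((rep hF (hG.add hG')).congr rfl (SignedDGA.br_add hF.isFun.multi _ _ _ _)).unique
        ((rep hF hG).add (rep hF hG')))
    (fun c f g => by
      obtain ⟨F, hF⟩ := f.exists_represents
      obtain ⟨G, hG⟩ := g.exists_represents
      exact ((rep hF (hG.smul c)).congr rfl (SignedDGA.br_smul hF.isFun.multi _ _ _ _)).unique
        ((rep hF hG).smul c))

theorem HC.eval_cup (h : r₁.toFun + r₂.toFun ≤ s.toFun) (hq : q₁ + q₂ = q₃) (f : A.HC r₁ q₁)
    (g : A.HC r₂ q₂) :
    HC.eval (HC.cup h hq f g) = PerverseDGA.cup h hq (HC.eval f) (HC.eval g) :=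
  (HC.exists_cup h hq f g).choose_spec

theorem HC.eval_bracket (h : r₁.toFun + r₂.toFun ≤ s.toFun) (hq : q₁ + q₂ - 1 = q₃)
    (f : A.HC r₁ q₁) (g : A.HC r₂ q₂) :
    HC.eval (HC.bracket h hq f g) = PerverseDGA.bracket h hq (HC.eval f) (HC.eval g) :=
  (HC.exists_bracket h hq f g).choose_spec

theorem Represents.cup {f : A.HC r₁ q₁} {g : A.HC r₂ q₂} (hF : Represents x F f)
    (hG : Represents z G g) (h : r₁.toFun + r₂.toFun ≤ s.toFun) (hq : q₁ + q₂ = q₃) :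
    Represents (x + z) (A.signed.cup q₂ F G) (HC.cup h hq f g) :=
  hF.of_cup hG h hq (HC.eval_cup h hq f g)

theorem Represents.bracket {f : A.HC r₁ q₁} {g : A.HC r₂ q₂} (hF : Represents x F f)
    (hG : Represents z G g) (h : r₁.toFun + r₂.toFun ≤ s.toFun) (hq : q₁ + q₂ - 1 = q₃) :
    Represents (x + z) (A.signed.br (q₁ - 1) (q₂ - 1) F G) (HC.bracket h hq f g) :=
  hF.of_bracket hG h hq (HC.eval_bracket h hq f g)

end Operations

end PerverseDGA
end

noncomputable section
open ConvAlg

/-- The bilinear map of quotients induced by a bilinear map. -/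
def Submodule.mapQ₂ {R M N P : Type*} [CommRing R] [AddCommGroup M] [AddCommGroup N]
    [AddCommGroup P] [Module R M] [Module R N] [Module R P] (M' : Submodule R M)
    (N' : Submodule R N) (P' : Submodule R P) (b : M →ₗ[R] N →ₗ[R] P)
    (h₁ : ∀ m ∈ M', ∀ n, b m n ∈ P') (h₂ : ∀ m, ∀ n ∈ N', b m n ∈ P') :
    (M ⧸ M') →ₗ[R] (N ⧸ N') →ₗ[R] (P ⧸ P') :=
  M'.liftQ
    { toFun := fun m => N'.mapQ P' (b m) (fun n hn => h₂ m n hn)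
      map_add' := fun m m' => Submodule.linearMap_qext _ (LinearMap.ext fun n => by simp)
      map_smul' := fun c m => Submodule.linearMap_qext _ (LinearMap.ext fun n => by simp) }
    (fun m hm => LinearMap.mem_ker.2 <| Submodule.linearMap_qext _ <| LinearMap.ext fun n =>
      (Submodule.Quotient.mk_eq_zero P').2 (h₁ m hm n))

namespace PerverseDGA

open GMPerversity PerverseGradedModule

variable {R : Type u} [CommRing R] {n : ℕ} {A : PerverseDGA.{u, v} R n}
  {x z : Fin (n + 1) → ℕ} {p r r' r₁ r₂ s : GMPerversity n} {q q' q₁ q₂ q₃ : ℤ}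
  {F G H K : ConvAlg A.Total A.Total}

/-! ### Cocycles and coboundaries -/

theorem IsFun.D_cup (hF : IsFun x q₁ F) (G : ConvAlg A.Total A.Total) (hq : q₁ + q₂ = q₃) :
    A.signed.D (q₃ - 1) (A.signed.cup q₂ F G) = A.signed.cup q₂ (A.signed.D (q₁ - 1) F) G +
      sgn R q₁ • A.signed.cup (q₂ + 1) F (A.signed.D (q₂ - 1) G) := by
  have := SignedDGA.D_cup hF.cochain (q₂ - 1) G
  rwa [sub_add_cancel, sub_add_cancel, show q₁ - 1 + (q₂ - 1) + 1 = q₃ - 1 by omega] at this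

theorem IsFun.D_br (hF : IsFun x q₁ F) (hG : IsFun z q₂ G) (hq : q₁ + q₂ - 1 = q₃) :
    A.signed.D (q₃ - 1) (A.signed.br (q₁ - 1) (q₂ - 1) F G) =
      A.signed.br q₁ (q₂ - 1) (A.signed.D (q₁ - 1) F) G +
        sgn R (q₁ - 1) • A.signed.br (q₁ - 1) q₂ F (A.signed.D (q₂ - 1) G) := by
  have := SignedDGA.D_br hF.cochain hG.cochain
  rwa [sub_add_cancel, sub_add_cancel, show q₁ - 1 + (q₂ - 1) = q₃ - 1 by omega] at this

theorem Represents.mem_cocycles {f : A.HC r q} (h : Represents x F f)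
    (hD : A.signed.D (q - 1) F = 0) : f ∈ A.cocycles r q := by
  show diff rfl (HC.eval f) = 0
  rw [h.diff_eval, hD, toWordFun_zero]

/-- The representing function of perversity exactly `r` is itself closed, since its differential is
determined by the values on words. The identities for closed functions therefore apply to cocycles.
-/
theorem cocycles.exists_represents (f : A.cocycles r q) :
    ∃ F, Represents r.toFun F f.1 ∧ A.signed.D (q - 1) F = 0 := by
  obtain ⟨F, hF⟩ := f.1.exists_represents
  have h := hF.isFun.D rfl
  refine ⟨F, hF, h.typed.eq_zero h.multi (sub_add_cancel _ 1) ?_⟩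
  rw [← hF.diff_eval]
  exact f.2

theorem Represents.mem_coboundaries {f : A.HC r q} (h : Represents x F f)
    (hH : IsFun x (q - 1) H) (e : F = A.signed.D (q - 1 - 1) H) : f ∈ A.coboundaries r q := by
  obtain ⟨g, hg⟩ := hH.exists_represents h.le
  refine ⟨g, ?_⟩
  show diff _ (HC.eval g) = HC.eval f
  subst e
  rw [hg.diff_eval, h.eval_eq]

theorem exists_represents_D {f : A.HC r q} (hf : f ∈ A.coboundaries r q) :
    ∃ G, IsFun r.toFun (q - 1) G ∧ Represents r.toFun (A.signed.D (q - 1 - 1) G) f := by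
  obtain ⟨g, hg⟩ := hf
  obtain ⟨G, hG⟩ := g.exists_represents
  refine ⟨G, hG.isFun, hG.isFun.D (sub_add_cancel q 1), le_rfl, ?_⟩
  rw [← hG.diff_eval (sub_add_cancel q 1)]
  exact hg.symm

theorem HC.cup_mem_cocycles (h : r₁.toFun + r₂.toFun ≤ s.toFun) (hq : q₁ + q₂ = q₃)
    (f : A.cocycles r₁ q₁) (g : A.cocycles r₂ q₂) : HC.cup h hq f.1 g.1 ∈ A.cocycles s q₃ := by
  obtain ⟨F, hF, hDF⟩ := cocycles.exists_represents f
  obtain ⟨G, hG, hDG⟩ := cocycles.exists_represents g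
  refine (hF.cup hG h hq).mem_cocycles ?_
  rw [hF.isFun.D_cup G hq, hDF, hDG, SignedDGA.zero_cup, SignedDGA.cup_zero, smul_zero, add_zero]

theorem HC.bracket_mem_cocycles (h : r₁.toFun + r₂.toFun ≤ s.toFun) (hq : q₁ + q₂ - 1 = q₃)
    (f : A.cocycles r₁ q₁) (g : A.cocycles r₂ q₂) :
    HC.bracket h hq f.1 g.1 ∈ A.cocycles s q₃ := by
  obtain ⟨F, hF, hDF⟩ := cocycles.exists_represents f
  obtain ⟨G, hG, hDG⟩ := cocycles.exists_represents g
  refine (hF.bracket hG h hq).mem_cocycles ?_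
  rw [hF.isFun.D_br hG.isFun hq, hDF, hDG, SignedDGA.zero_br hG.isFun.multi,
    SignedDGA.br_zero hF.isFun.multi, smul_zero, add_zero]

theorem HC.cup_mem_coboundaries_left (h : r₁.toFun + r₂.toFun ≤ s.toFun) (hq : q₁ + q₂ = q₃)
    {f : A.HC r₁ q₁} (hf : f ∈ A.coboundaries r₁ q₁) (g : A.cocycles r₂ q₂) :
    HC.cup h hq f g.1 ∈ A.coboundaries s q₃ := by
  obtain ⟨K, hK, hF⟩ := exists_represents_D hf
  obtain ⟨G, hG, hDG⟩ := cocycles.exists_represents g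
  -- The derivation rule gives `D (K ∪ G) = (D K) ∪ G` for closed `G`, so `K ∪ G` is a primitive.
  refine (hF.cup hG h hq).mem_coboundaries
    (hK.cup hG.isFun (show q₁ - 1 + q₂ = q₃ - 1 by omega)) ?_
  rw [hK.D_cup G (show q₁ - 1 + q₂ = q₃ - 1 by omega), hDG, SignedDGA.cup_zero, smul_zero, add_zero]

theorem HC.cup_mem_coboundaries_right (h : r₁.toFun + r₂.toFun ≤ s.toFun) (hq : q₁ + q₂ = q₃)
    (f : A.cocycles r₁ q₁) {g : A.HC r₂ q₂} (hg : g ∈ A.coboundaries r₂ q₂) :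
    HC.cup h hq f.1 g ∈ A.coboundaries s q₃ := by
  obtain ⟨F, hF, hDF⟩ := cocycles.exists_represents f
  obtain ⟨K, hK, hG⟩ := exists_represents_D hg
  -- Here the primitive is `± F ∪ K`; the scalar cancels the sign in the derivation rule.
  refine (hF.cup hG h hq).mem_coboundaries
    ((hF.isFun.cup hK (show q₁ + (q₂ - 1) = q₃ - 1 by omega)).smulFun (sgn R q₁)) ?_
  rw [SignedDGA.D_smul, hF.isFun.D_cup K (show q₁ + (q₂ - 1) = q₃ - 1 by omega), hDF,
    SignedDGA.zero_cup, zero_add, smul_smul, sgn_mul_self, one_smul, sub_add_cancel]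

theorem HC.bracket_mem_coboundaries_left (h : r₁.toFun + r₂.toFun ≤ s.toFun)
    (hq : q₁ + q₂ - 1 = q₃) {f : A.HC r₁ q₁} (hf : f ∈ A.coboundaries r₁ q₁)
    (g : A.cocycles r₂ q₂) : HC.bracket h hq f g.1 ∈ A.coboundaries s q₃ := by
  obtain ⟨K, hK, hF⟩ := exists_represents_D hf
  obtain ⟨G, hG, hDG⟩ := cocycles.exists_represents g
  refine (hF.bracket hG h hq).mem_coboundaries
    (hK.br hG.isFun (show q₁ - 1 + q₂ - 1 = q₃ - 1 by omega)) ?_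
  rw [hK.D_br hG.isFun (show q₁ - 1 + q₂ - 1 = q₃ - 1 by omega), hDG,
    SignedDGA.br_zero hK.multi, smul_zero, add_zero]

theorem HC.bracket_mem_coboundaries_right (h : r₁.toFun + r₂.toFun ≤ s.toFun)
    (hq : q₁ + q₂ - 1 = q₃) (f : A.cocycles r₁ q₁) {g : A.HC r₂ q₂}
    (hg : g ∈ A.coboundaries r₂ q₂) : HC.bracket h hq f.1 g ∈ A.coboundaries s q₃ := by
  obtain ⟨F, hF, hDF⟩ := cocycles.exists_represents f
  obtain ⟨K, hK, hG⟩ := exists_represents_D hg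
  refine (hF.bracket hG h hq).mem_coboundaries
    ((hF.isFun.br hK (show q₁ + (q₂ - 1) - 1 = q₃ - 1 by omega)).smulFun (sgn R (q₁ - 1))) ?_
  rw [SignedDGA.D_smul, hF.isFun.D_br hK (show q₁ + (q₂ - 1) - 1 = q₃ - 1 by omega), hDF,
    SignedDGA.zero_br hK.multi, zero_add, smul_smul, sgn_mul_self, one_smul]

/-! ### Operations on Hochschild cohomology -/

/-- The cup product of cocycles. -/
def cocycles.cup (h : r₁.toFun + r₂.toFun ≤ s.toFun) (hq : q₁ + q₂ = q₃) :
    A.cocycles r₁ q₁ →ₗ[R] A.cocycles r₂ q₂ →ₗ[R] A.cocycles s q₃ :=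
  LinearMap.mk₂ R (fun f g => ⟨HC.cup h hq f.1 g.1, HC.cup_mem_cocycles h hq f g⟩)
    (fun f f' g => Subtype.ext (LinearMap.map_add₂ (HC.cup h hq) f.1 f'.1 g.1))
    (fun c f g => Subtype.ext (LinearMap.map_smul₂ (HC.cup h hq) c f.1 g.1))
    (fun f g g' => Subtype.ext (map_add (HC.cup h hq f.1) g.1 g'.1))
    (fun c f g => Subtype.ext (map_smul (HC.cup h hq f.1) c g.1))

/-- The bracket of cocycles. -/
def cocycles.bracket (h : r₁.toFun + r₂.toFun ≤ s.toFun) (hq : q₁ + q₂ - 1 = q₃) :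
    A.cocycles r₁ q₁ →ₗ[R] A.cocycles r₂ q₂ →ₗ[R] A.cocycles s q₃ :=
  LinearMap.mk₂ R (fun f g => ⟨HC.bracket h hq f.1 g.1, HC.bracket_mem_cocycles h hq f g⟩)
    (fun f f' g => Subtype.ext (LinearMap.map_add₂ (HC.bracket h hq) f.1 f'.1 g.1))
    (fun c f g => Subtype.ext (LinearMap.map_smul₂ (HC.bracket h hq) c f.1 g.1))
    (fun f g g' => Subtype.ext (map_add (HC.bracket h hq f.1) g.1 g'.1))
    (fun c f g => Subtype.ext (map_smul (HC.bracket h hq f.1) c g.1))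

/-- The cup product on Hochschild cohomology. -/
def HH.cup (h : r₁.toFun + r₂.toFun ≤ s.toFun) (hq : q₁ + q₂ = q₃) :
    A.HH.obj r₁ q₁ →ₗ[R] A.HH.obj r₂ q₂ →ₗ[R] A.HH.obj s q₃ :=
  Submodule.mapQ₂ _ _ _ (cocycles.cup h hq)
    (fun _ hf g => HC.cup_mem_coboundaries_left h hq hf g)
    (fun f _ hg => HC.cup_mem_coboundaries_right h hq f hg)

/-- The bracket on Hochschild cohomology. -/
def HH.bracket (h : r₁.toFun + r₂.toFun ≤ s.toFun) (hq : q₁ + q₂ - 1 = q₃) :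
    A.HH.obj r₁ q₁ →ₗ[R] A.HH.obj r₂ q₂ →ₗ[R] A.HH.obj s q₃ :=
  Submodule.mapQ₂ _ _ _ (cocycles.bracket h hq)
    (fun _ hf g => HC.bracket_mem_coboundaries_left h hq hf g)
    (fun f _ hg => HC.bracket_mem_coboundaries_right h hq f hg)

theorem HH.cup_mk (h : r₁.toFun + r₂.toFun ≤ s.toFun) (hq : q₁ + q₂ = q₃)
    (f : A.cocycles r₁ q₁) (g : A.cocycles r₂ q₂) :
    HH.cup h hq (HH.mk A f) (HH.mk A g) = HH.mk A (cocycles.cup h hq f g) := rfl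

theorem HH.bracket_mk (h : r₁.toFun + r₂.toFun ≤ s.toFun) (hq : q₁ + q₂ - 1 = q₃)
    (f : A.cocycles r₁ q₁) (g : A.cocycles r₂ q₂) :
    HH.bracket h hq (HH.mk A f) (HH.mk A g) = HH.mk A (cocycles.bracket h hq f g) := rfl

theorem HH.mk_add (f g : A.cocycles r q) : HH.mk A (f + g) = HH.mk A f + HH.mk A g := rfl

theorem HH.mk_sub (f g : A.cocycles r q) : HH.mk A (f - g) = HH.mk A f - HH.mk A g := rfl

theorem HH.mk_smul (c : R) (f : A.cocycles r q) : HH.mk A (c • f) = c • HH.mk A f := rfl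

theorem HH.mk_surjective : Function.Surjective (HH.mk A (r := r) (q := q)) :=
  Submodule.Quotient.mk_surjective _

theorem HH.mk_eq_of_represents {f f' : A.cocycles r q} (h : Represents x F f.1)
    (h' : Represents x F f'.1) : HH.mk A f = HH.mk A f' :=
  congrArg (HH.mk A) (Subtype.ext (h.unique h'))

theorem HH.mk_eq_of_sub_eq_D {f f' : A.cocycles r q} (h : Represents x F f.1)
    (h' : Represents x G f'.1) (hH : IsFun x (q - 1) H)
    (e : F - G = A.signed.D (q - 1 - 1) H) : HH.mk A f = HH.mk A f' :=
  (Submodule.Quotient.eq _).2 ((h.sub h').mem_coboundaries hH e)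

/-- Hochschild cohomology is a perverse Gerstenhaber algebra. -/
def HH.gerstenhaber (A : PerverseDGA.{u, v} R n) : PerverseGerstenhaber A.HH where
  cup {_ _ _} h {_ _ _} hq := HH.cup h hq
  bracket {_ _ _} h {_ _ _} hq := HH.bracket h hq
  map_cup {_ _ _ _ _ _} h h' hp hq hr {_ _ _} hk a b := by
    obtain ⟨f, rfl⟩ := HH.mk_surjective a
    obtain ⟨g, rfl⟩ := HH.mk_surjective b
    obtain ⟨F, hF, -⟩ := cocycles.exists_represents f
    obtain ⟨G, hG, -⟩ := cocycles.exists_represents g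
    -- One function represents a cochain and all its images under structure maps, so both sides are
    -- represented by the same cup product.
    exact HH.mk_eq_of_represents ((hF.cup hG h hk).map hr) ((hF.map hp).cup (hG.map hq) h' hk)
  map_bracket {_ _ _ _ _ _} h h' hp hq hr {_ _ _} hk a b := by
    obtain ⟨f, rfl⟩ := HH.mk_surjective a
    obtain ⟨g, rfl⟩ := HH.mk_surjective b
    obtain ⟨F, hF, -⟩ := cocycles.exists_represents f
    obtain ⟨G, hG, -⟩ := cocycles.exists_represents g
    exact HH.mk_eq_of_represents ((hF.bracket hG h hk).map hr)
      ((hF.map hp).bracket (hG.map hq) h' hk)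
  cup_assoc {_ _ _ _ _ _} h₁ h₂ h₃ h₄ {i j k _ _ _} e₁ e₂ e₃ e₄ a b c := by
    obtain ⟨f, rfl⟩ := HH.mk_surjective a
    obtain ⟨g, rfl⟩ := HH.mk_surjective b
    obtain ⟨h, rfl⟩ := HH.mk_surjective c
    obtain ⟨F, hF, -⟩ := cocycles.exists_represents f
    obtain ⟨G, hG, -⟩ := cocycles.exists_represents g
    obtain ⟨H, hH, -⟩ := cocycles.exists_represents h
    refine HH.mk_eq_of_represents ((hF.cup hG h₁ e₁).cup hH h₂ e₂)
      ((hF.cup (hG.cup hH h₃ e₃) h₄ e₄).congr (add_assoc _ _ _).symm ?_)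
    rw [SignedDGA.cup_assoc, add_comm k j, e₃]
  cup_comm {_ _ _} h h' {i j k} e e' a b := by
    obtain ⟨f, rfl⟩ := HH.mk_surjective a
    obtain ⟨g, rfl⟩ := HH.mk_surjective b
    obtain ⟨F, hF, hDF⟩ := cocycles.exists_represents f
    obtain ⟨G, hG, hDG⟩ := cocycles.exists_represents g
    rw [HH.cup_mk, HH.cup_mk, negOnePow_smul_eq (R := R), ← HH.mk_smul]
    -- The primitive is the insertion `± F ∘ G`.
    have hc := SignedDGA.cup_sub_cup_eq_D hF.isFun.cochain hG.isFun.cochain hDF hDG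
    rw [sub_add_cancel, sub_add_cancel, show i - 1 + (j - 1) = k - 1 - 1 by omega] at hc
    exact HH.mk_eq_of_sub_eq_D (hF.cup hG h e)
      (((hG.cup hF h' e').congr (add_comm _ _) rfl).smul (sgn R (i * j)))
      ((hF.isFun.circ hG.isFun (by omega)).smulFun _) hc
  bracket_skew {_ _ _} h h' {i j k} e e' a b := by
    obtain ⟨f, rfl⟩ := HH.mk_surjective a
    obtain ⟨g, rfl⟩ := HH.mk_surjective b
    obtain ⟨F, hF, -⟩ := cocycles.exists_represents f
    obtain ⟨G, hG, -⟩ := cocycles.exists_represents g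
    rw [HH.bracket_mk, HH.bracket_mk, negOnePow_smul_eq (R := R), ← neg_smul, ← HH.mk_smul]
    refine HH.mk_eq_of_represents (hF.bracket hG h e)
      (((hG.bracket hF h' e').smul _).congr (add_comm _ _) ?_)
    rw [SignedDGA.br_eq_neg (i - 1) (j - 1) F G, neg_smul]
  jacobi {_ _ _ _ _ _ _} h₁ h₂ h₃ h₄ h₅ h₆ {i j k ij jk ik _} e₁ e₂ e₃ e₄ e₅ e₆ a b c := by
    obtain ⟨f, rfl⟩ := HH.mk_surjective a
    obtain ⟨g, rfl⟩ := HH.mk_surjective b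
    obtain ⟨h, rfl⟩ := HH.mk_surjective c
    obtain ⟨F, hF, -⟩ := cocycles.exists_represents f
    obtain ⟨G, hG, -⟩ := cocycles.exists_represents g
    obtain ⟨H, hH, -⟩ := cocycles.exists_represents h
    simp only [HH.bracket_mk, negOnePow_smul_eq (R := R)]
    rw [← HH.mk_smul, ← HH.mk_sub]
    refine HH.mk_eq_of_represents ((hF.bracket hG h₁ e₁).bracket hH h₂ e₂)
      ((((hF.bracket (hG.bracket hH h₃ e₃) h₄ e₄).congr (add_assoc _ _ _).symm rfl).sub
        (((hG.bracket (hF.bracket hH h₅ e₅) h₆ e₆).congr ?_ rfl).smul _)).congr rfl ?_)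
    · exact (add_left_comm _ _ _).trans (add_assoc _ _ _).symm
    -- The Jacobi identity already holds for the representing functions; only the indices must be
    -- matched.
    · have := SignedDGA.br_br hF.isFun.cochain hG.isFun.cochain hH.isFun.cochain
      rw [show i - 1 + (j - 1) = ij - 1 by omega, show j - 1 + (k - 1) = jk - 1 by omega,
        show i - 1 + (k - 1) = ik - 1 by omega] at this
      exact this.symm
  leibniz {_ _ _ _ _ _ _} h₁ h₂ h₃ h₄ h₅ h₆ {i j k ij jk ik l} e₁ e₂ e₃ e₄ e₅ e₆ a b c := by
    obtain ⟨f, rfl⟩ := HH.mk_surjective a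
    obtain ⟨g, rfl⟩ := HH.mk_surjective b
    obtain ⟨h, rfl⟩ := HH.mk_surjective c
    obtain ⟨F, hF, hDF⟩ := cocycles.exists_represents f
    obtain ⟨G, hG, hDG⟩ := cocycles.exists_represents g
    obtain ⟨H, hH, hDH⟩ := cocycles.exists_represents h
    simp only [HH.bracket_mk, HH.cup_mk, negOnePow_smul_eq (R := R)]
    rw [← HH.mk_smul, ← HH.mk_add]
    -- The primitive is the brace `± F{G,H}`.
    have hc := SignedDGA.br_cup_sub_eq_D hF.isFun.cochain hG.isFun.cochain hH.isFun.cochain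
      hDF hDG hDH
    rw [show j - 1 + (k - 1) + 1 = jk - 1 by omega, sub_add_cancel, sub_add_cancel,
      show i - 1 + (k - 1) + 1 = ik by omega,
      show i - 1 + (j - 1 + (k - 1)) = l - 1 - 1 by omega] at hc
    refine HH.mk_eq_of_sub_eq_D
      ((hF.bracket (hG.cup hH h₃ e₃) h₄ e₄).congr (add_assoc _ _ _).symm rfl)
      (((hF.bracket hG h₁ e₁).cup hH h₂ e₂).add
        (((hG.cup (hF.bracket hH h₅ e₅) h₆ e₆).congr ?_ rfl).smul _))
      ((hF.isFun.brace hG.isFun hH.isFun (by omega)).smulFun _) hc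
    exact (add_left_comm _ _ _).trans (add_assoc _ _ _).symm

end PerverseDGA
end

theorem theoremA {R : Type u} [CommRing R] {n : ℕ} (A : PerverseDGA.{u, v} R n) :
    -- the formula for the differential defines a differential on the Hochschild cochains
    (∀ (r : GMPerversity n) (q q' : ℤ) (hq : q + 1 = q') (f : A.HC r q),
      ∃! g : A.HC r q', PerverseDGA.HC.eval g = PerverseDGA.diff hq (PerverseDGA.HC.eval f)) ∧
    (∀ (r : GMPerversity n) (q q' q'' : ℤ) (hq : q + 1 = q') (hq' : q' + 1 = q'') (f : A.HC r q),
      PerverseDGA.diff hq' (PerverseDGA.diff hq (PerverseDGA.HC.eval f)) = 0) ∧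
    -- the formulas for the cup product and the bracket define operations on cochains
    (∀ (r₁ r₂ s : GMPerversity n) (h : r₁.toFun + r₂.toFun ≤ s.toFun) (q₁ q₂ q₃ : ℤ)
      (hq : q₁ + q₂ = q₃) (f : A.HC r₁ q₁) (g : A.HC r₂ q₂), ∃! k : A.HC s q₃,
      PerverseDGA.HC.eval k =
        PerverseDGA.cup h hq (PerverseDGA.HC.eval f) (PerverseDGA.HC.eval g)) ∧
    (∀ (r₁ r₂ s : GMPerversity n) (h : r₁.toFun + r₂.toFun ≤ s.toFun) (q₁ q₂ q₃ : ℤ)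
      (hq : q₁ + q₂ - 1 = q₃) (f : A.HC r₁ q₁) (g : A.HC r₂ q₂), ∃! k : A.HC s q₃,
      PerverseDGA.HC.eval k =
        PerverseDGA.bracket h hq (PerverseDGA.HC.eval f) (PerverseDGA.HC.eval g)) ∧
    -- they induce a perverse Gerstenhaber algebra structure on the Hochschild cohomology
    ∃ G : PerverseGerstenhaber A.HH,
      (∀ (r₁ r₂ s : GMPerversity n) (h : r₁.toFun + r₂.toFun ≤ s.toFun) (q₁ q₂ q₃ : ℤ)
        (hq : q₁ + q₂ = q₃) (f : A.cocycles r₁ q₁) (g : A.cocycles r₂ q₂),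
        ∃ k : A.cocycles s q₃,
          PerverseDGA.HC.eval k.1 =
            PerverseDGA.cup h hq (PerverseDGA.HC.eval f.1) (PerverseDGA.HC.eval g.1) ∧
          G.cup h hq (PerverseDGA.HH.mk A f) (PerverseDGA.HH.mk A g) = PerverseDGA.HH.mk A k) ∧
      (∀ (r₁ r₂ s : GMPerversity n) (h : r₁.toFun + r₂.toFun ≤ s.toFun) (q₁ q₂ q₃ : ℤ)
        (hq : q₁ + q₂ - 1 = q₃) (f : A.cocycles r₁ q₁) (g : A.cocycles r₂ q₂),
        ∃ k : A.cocycles s q₃,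
          PerverseDGA.HC.eval k.1 =
            PerverseDGA.bracket h hq (PerverseDGA.HC.eval f.1) (PerverseDGA.HC.eval g.1) ∧
          G.bracket h hq (PerverseDGA.HH.mk A f) (PerverseDGA.HH.mk A g) =
            PerverseDGA.HH.mk A k) := by
  refine ⟨fun r q q' hq f => PerverseDGA.HC.existsUnique_diff hq f,
    fun r q q' q'' hq hq' f => PerverseDGA.HC.diff_diff hq hq' f,
    fun r₁ r₂ s h q₁ q₂ q₃ hq f g => ⟨_, PerverseDGA.HC.eval_cup h hq f g, fun k hk =>
      PerverseDGA.HC.eval_injective (hk.trans (PerverseDGA.HC.eval_cup h hq f g).symm)⟩,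
    fun r₁ r₂ s h q₁ q₂ q₃ hq f g => ⟨_, PerverseDGA.HC.eval_bracket h hq f g, fun k hk =>
      PerverseDGA.HC.eval_injective (hk.trans (PerverseDGA.HC.eval_bracket h hq f g).symm)⟩,
    PerverseDGA.HH.gerstenhaber A,
    fun r₁ r₂ s h q₁ q₂ q₃ hq f g => ⟨PerverseDGA.cocycles.cup h hq f g,
      PerverseDGA.HC.eval_cup h hq f.1 g.1, PerverseDGA.HH.cup_mk h hq f g⟩,
    fun r₁ r₂ s h q₁ q₂ q₃ hq f g => ⟨PerverseDGA.cocycles.bracket h hq f g,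
      PerverseDGA.HC.eval_bracket h hq f.1 g.1, PerverseDGA.HH.bracket_mk h hq f g⟩⟩
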